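/- Let $\eta>0$ and $0<\varphi<\frac{\pi}{2}$. Put $\rho=\frac{\eta\beta}{2\pi}$ and $$Z_\varphi(\beta)=\Big[\frac{\rho}{2\pi}\,e^{-2\rho\ln(\rho)\sin\varphi}\,\big|\Gamma(i\rho e^{-i\varphi})\big|^2\Big]^3\quad(\beta>0),\qquad \omega_\varphi=\frac{3}{\pi}\Big(\sin\varphi+\big(\tfrac{\pi}{2}-\varphi\big)\cos\varphi\Big)\eta .$$ $Z_\varphi$ is the effective partition function of a charged harmonic oscillator of frequency $\eta$ coupled to the photon field. The effective measure of states $\mu_\varphi$ is the positive measure on $[0,\infty)$ with Laplace transform $Z_\varphi$, and the effective density of states $\phi$ is the function vanishing for $\omega<\omega_\varphi$, positive and continuous for $\omega\ge\omega_\varphi$, such that $\mu_\varphi=\delta_{\omega_\varphi}+\phi\,d\omega$. Let $p_j=\omega_\varphi+j\eta e^{-i\varphi}$ for $j\in\mathbb Z\setminus\{0\}$, let $S=\{\omega_\varphi+s e^{\pm i\varphi}: s\in\mathbb R,\ |s|\ge\eta\}$, and for $j\ge 1$ let $$\ell_j(z)=\frac{-1}{2\pi i\,(z-p_j)}+\frac{1}{2\pi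 i\,(z-\overline{p_j})}.$$ On the real line $$\ell_j(\omega)=\frac1\pi\,\frac{j\eta\sin\varphi}{(\omega-\omega_\varphi-j\eta\cos\varphi)^2+(j\eta\sin\varphi)^2},$$ which is a Lorentz profile of total mass $\int\ell_j\,d\omega=1$. The density $\phi$ exists and, restricted to $[\omega_\varphi,\infty)$, has a (unique) analytic continuation to $\mathbb C\setminus S$, again denoted $\phi$. For every $N\in\mathbb N$ there are functions $h_N,\tilde h_N$ and a constant $C$ (depending on $N$, $\eta$, $\varphi$) such that for all $z=\omega_\varphi+s e^{i\chi}$ with $0<s<N\eta$ and $|\chi|<\frac{\pi}{2}$ $$\phi(z)=\begin{cases}\displaystyle\sum_{j=1}^N\binom{j+2}{2}\ell_j(z)+h_N(z)&\text{if }|\chi|<\varphi,\\[2mm]\displaystyle-\sum_{j=1}^3(-1)^j\binom3j\ell_j(z)+\tilde h_N(z)&\text{if }|\chi|>\varphi,\end{cases}$$ with $$|h_N(z)|\le C\big(1+|\ln(\varphi-|\chi|)|\big)\ \text{ for }|\chi|<\varphi,\qquad |\tilde h_N(z)|\le C\big(1+|\ln(|\chi|-\varphi)|\big)\ \text{ for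 }|\chi|>\varphi .$$ Moreover $h_N$ and $\tilde h_N$ are analytic up to singularities at the points $p_j,\overline{p_j}$ and cuts along $S$: they are analytic on $\mathbb C\setminus S$, and near every point of $S$ other than the $p_j,\overline{p_j}$ ($j\in\mathbb Z\setminus\{0\}$) their restriction to either side of the cut extends analytically across the cut. -/

import Mathlib

open MeasureTheory Set

noncomputable section

/-- The effective partition function `Z_φ(β)` of the charged oscillator of frequency `η` at coupling
angle `φ`, as a function of `β = ħ / (k T)`, written through `ρ = η β / (2 π)`. -/
def partitionFunction (η φ β : ℝ) : ℝ :=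
  let ρ : ℝ := η * β / (2 * Real.pi)
  (ρ / (2 * Real.pi) * Real.exp (-2 * ρ * Real.log ρ * Real.sin φ) *
    ‖Complex.Gamma (Complex.I * ρ * Complex.exp (-(Complex.I * φ)))‖ ^ 2) ^ 3

/-- The ground state frequency `ω_φ`. -/
def groundFrequency (η φ : ℝ) : ℝ :=
  3 / Real.pi * (Real.sin φ + (Real.pi / 2 - φ) * Real.cos φ) * η

/-- `μ` is the effective measure of states: a positive measure on `[0, ∞[` whose Laplace transform
is the partition function (this determines `μ`). -/
structure IsEffectiveMeasure (η φ : ℝ) (μ : Measure ℝ) : Prop where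
  support : μ (Iio 0) = 0
  integrable : ∀ β : ℝ, 0 < β → Integrable (fun ω : ℝ => Real.exp (-β * ω)) μ
  laplace : ∀ β : ℝ, 0 < β → ∫ ω : ℝ, Real.exp (-β * ω) ∂μ = partitionFunction η φ β

/-- `f` is the effective density of states: it vanishes below `ω_φ`, is positive and continuous on
`[ω_φ, ∞[`, and `δ_{ω_φ} + f λ` is the effective measure of states. -/
structure IsEffectiveDensity (η φ : ℝ) (f : ℝ → ℝ) : Prop where
  zero : ∀ ω : ℝ, ω < groundFrequency η φ → f ω = 0
  pos : ∀ ω : ℝ, groundFrequency η φ ≤ ω → 0 < f ω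
  continuousOn : ContinuousOn f (Ici (groundFrequency η φ))
  measure : IsEffectiveMeasure η φ
    (Measure.dirac (groundFrequency η φ) +
      volume.withDensity (fun ω : ℝ => ENNReal.ofReal (f ω)))

/-- The points `p_j = ω_φ + j η e^{-iφ}`. -/
def resonance (η φ : ℝ) (j : ℤ) : ℂ :=
  (groundFrequency η φ : ℂ) + j * η * Complex.exp (-(Complex.I * φ))

/-- The points `p_j` and their conjugates, for nonzero integers `j`. -/
def singularPoints (η φ : ℝ) : Set ℂ :=
  {z | ∃ j : ℤ, j ≠ 0 ∧ (z = resonance η φ j ∨ z = (starRingEnd ℂ) (resonance η φ j))}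

/-- The cuts `ω_φ + s e^{± iφ}`, `|s| ≥ η`. -/
def cuts (η φ : ℝ) : Set ℂ :=
  {z | ∃ s : ℝ, η ≤ |s| ∧
    (z = groundFrequency η φ + s * Complex.exp (Complex.I * φ) ∨
      z = groundFrequency η φ + s * Complex.exp (-(Complex.I * φ)))}

/-- `Φ` is the analytic continuation of the effective density of states from `[ω_φ, ∞[` to the
plane without the cuts. That domain is open and star-shaped about `ω_φ`, so `Φ` is determined there;
its values on the cuts are irrelevant. -/
structure IsContinuedDensity (η φ : ℝ) (Φ : ℂ → ℂ) : Prop where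
  analytic : AnalyticOnNhd ℂ Φ (cuts η φ)ᶜ
  density : ∃ f : ℝ → ℝ, IsEffectiveDensity η φ f ∧
    ∀ ω : ℝ, groundFrequency η φ ≤ ω → Φ ω = f ω

/-- `h` is analytic up to singularities at the points `p_j`, `conj p_j` and cuts: it is analytic off
the cuts, and at each point of a cut other than the singular points the restriction of `h` to either
side of the cut extends analytically across the cut. -/
def AnalyticUpToCuts (η φ : ℝ) (h : ℂ → ℂ) : Prop :=
  AnalyticOnNhd ℂ h (cuts η φ)ᶜ ∧
  ∀ u : ℂ, (u = Complex.exp (Complex.I * φ) ∨ u = Complex.exp (-(Complex.I * φ))) →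
    ∀ s : ℝ, η ≤ |s| → (groundFrequency η φ : ℂ) + s * u ∉ singularPoints η φ →
      ∃ ε : ℝ, 0 < ε ∧
        (∃ G : ℂ → ℂ,
          AnalyticOnNhd ℂ G (Metric.ball ((groundFrequency η φ : ℂ) + s * u) ε) ∧
          EqOn h G (Metric.ball ((groundFrequency η φ : ℂ) + s * u) ε ∩
            {z | 0 < ((z - groundFrequency η φ) / u).im})) ∧
        (∃ G : ℂ → ℂ,
          AnalyticOnNhd ℂ G (Metric.ball ((groundFrequency η φ : ℂ) + s * u) ε) ∧
          EqOn h G (Metric.ball ((groundFrequency η φ : ℂ) + s * u) ε ∩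
            {z | ((z - groundFrequency η φ) / u).im < 0}))

/-- The pole pair `ℓ_j(z) = -1 / (2πi (z - p_j)) + 1 / (2πi (z - conj p_j))`. -/
def polePair (η φ : ℝ) (j : ℕ) (z : ℂ) : ℂ :=
  -1 / (2 * Real.pi * Complex.I * (z - resonance η φ j)) +
    1 / (2 * Real.pi * Complex.I * (z - (starRingEnd ℂ) (resonance η φ j)))

end

namespace ChargedOscillator

open Filter Topology Metric

/-! ### Holomorphic dependence of integrals on a parameter -/

/-! Write `J` for Binet's function, the remainder in Stirling's formula. With `w = iρe^{-iφ}`,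
Stirling's formula turns `Z_φ(β)` into `exp(-βω_φ) · exp(3(J(w) + J(w̄)))`: the elementary terms
give exactly the ground frequency, and only `J` remains. Now `J` is the Laplace transform of the
even meromorphic function `B(x) = ∑ 2/(x² + (2πk)²)`, which may be taken along any ray in the right
half plane. Choosing the rays `c` and `c̄` with `c = slope η φ` makes `3(J(w) + J(w̄))` the Laplace
transform at `β` of `logDensity c`. The exponential of a transform is the transform of the unit mass
plus the convolution exponential, and the latter converges on any star domain on which the exponent
is holomorphic. This yields the density and its continuation. It is positive because `Re (c B(cx)) >
0`, and unique by Laplace inversion and the identity theorem.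

For the singularities, factor the exponential: `density_eq` writes the density as `f + g + f*g` with
`f(z) = c·borel 3 (cz)` and `g` its counterpart for `c̄`, where `borel κ` has Laplace transform
`exp(κJ) - 1`. In the closed first quadrant `g` is holomorphic, so everything rests on `borel 3`
near the imaginary axis.

There the inversion integral is bent into two half-lines running to the left
(`exists_borel_eq_lineIntegral`). On the upper one the reflection formula `e^{J(v)} e^{J(-v)} (1 -
q) = 1`, `q = e^{2πiv}`, gives `e^{κJ(v)} = e^{-κJ(-v)} (1 - q)^{-κ}`. Expanding `(1 - q)^{-κ} = ∑
c_j q^j`, the factor `q^j` shifts `x` by `2πij`. The leading part `1` of `e^{-κJ(-v)}` then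
integrates to a simple pole with coefficient `c_j`; the remaining part is `O(1/|v|)` and integrates
to a logarithmically bounded function (`lineIntegral_expansion`). The lower half-line is the
conjugate. For `κ = 3` the coefficients are `binom(j+2, 2)`. To the left of the imaginary axis,
evenness of `B` gives `borel 3 (x) = -borel (-3) (-x)`, and the coefficients become those of the
polynomial `(1 - q)^3`; hence only three pole pairs occur beyond the cut.

The cross term `f*g` is controlled by the integral of `|borel 3|` along a ray, and a simple pole
integrated along a ray at angular distance `d` contributes only `O(1 + |ln d|)`. Extension across
the cuts comes from rotating the half-line integrals by a right angle, after which they converge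
regardless of the sign of `Re x`, and from moving the convolution path to a broken line. -/

theorem hasDerivAt_integral_of_differentiableOn {α : Type*} [MeasurableSpace α] {μ : Measure α}
    {F : ℂ → α → ℂ} {z₀ : ℂ} {r : ℝ} (hr : 0 < r) {bound : α → ℝ}
    (hmeas : ∀ z ∈ ball z₀ r, AEStronglyMeasurable (F z) μ)
    (hdiff : ∀ᵐ t ∂μ, DifferentiableOn ℂ (fun z => F z t) (ball z₀ r))
    (hbound : ∀ᵐ t ∂μ, ∀ z ∈ ball z₀ r, ‖F z t‖ ≤ bound t) (hint : Integrable bound μ) :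
    HasDerivAt (fun z => ∫ t, F z t ∂μ) (∫ t, deriv (fun z => F z t) z₀ ∂μ) z₀ := by
  have hr2 : 0 < r / 2 := by positivity
  have hr4 : 0 < r / 4 := by positivity
  have hz₀ : z₀ ∈ ball z₀ r := mem_ball_self hr
  have hderiv : ∀ᵐ t ∂μ, ∀ z ∈ ball z₀ r,
      HasDerivAt (fun z => F z t) (deriv (fun z => F z t) z) z := by
    filter_upwards [hdiff] with t ht z hz
    exact (ht.differentiableAt (isOpen_ball.mem_nhds hz)).hasDerivAt
  refine (hasDerivAt_integral_of_dominated_loc_of_deriv_le (s := ball z₀ (r / 2))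
    (bound := fun t => bound t / (r / 4)) (F' := fun z t => deriv (fun z => F z t) z)
    (ball_mem_nhds z₀ hr2) ?_ ?_ ?_ ?_ ?_ ?_).2
  · filter_upwards [ball_mem_nhds z₀ hr] with z hz using hmeas z hz
  · refine hint.mono' (hmeas z₀ hz₀) ?_
    filter_upwards [hbound] with t ht using ht z₀ hz₀
  -- Measurability of the derivative: it is a pointwise limit of difference quotients along a real
  -- null sequence.
  · obtain ⟨s, -, hspos, hslim⟩ := exists_seq_strictAnti_tendsto' hr
    have hmem (n : ℕ) : z₀ + (s n : ℂ) ∈ ball z₀ r := by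
      simpa [abs_of_pos (hspos n).1] using (hspos n).2
    refine aestronglyMeasurable_of_tendsto_ae atTop
      (f := fun n t => (s n : ℂ)⁻¹ * (F (z₀ + s n) t - F z₀ t)) (fun n => ?_) ?_
    · exact ((hmeas _ (hmem n)).sub (hmeas _ hz₀)).const_mul _
    · filter_upwards [hderiv] with t ht
      have h1 := hasDerivAt_iff_tendsto_slope_zero.1 (ht z₀ hz₀)
      have h2 : Tendsto (fun n => (s n : ℂ)) atTop (𝓝[≠] 0) := by
        refine tendsto_nhdsWithin_iff.2 ⟨?_, Eventually.of_forall fun n => ?_⟩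
        · exact_mod_cast (Complex.continuous_ofReal.tendsto 0).comp hslim
        · simpa using (hspos n).1.ne'
      simpa [Function.comp_def] using h1.comp h2
  -- Cauchy's estimate on discs of radius `r / 4`, which stay inside `ball z₀ r`, converts the bound
  -- for `F` into one for its derivative.
  · filter_upwards [hdiff, hbound] with t ht hb z hz
    have hsub : closedBall z (r / 4) ⊆ ball z₀ r := by
      intro w hw
      rw [mem_closedBall] at hw
      rw [mem_ball] at hz ⊢
      linarith [dist_triangle w z z₀]
    refine Complex.norm_deriv_le_of_forall_mem_sphere_norm_le hr4 ?_ ?_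
    · refine DifferentiableOn.diffContOnCl ?_
      rw [closure_ball _ hr4.ne']
      exact ht.mono hsub
    · intro w hw
      exact hb w (hsub (sphere_subset_closedBall hw))
  · exact hint.div_const _
  · filter_upwards [hderiv] with t ht z hz
    exact ht z (ball_subset_ball (by linarith) hz)

theorem exists_bound_near_of_continuousOn {F : ℂ → ℝ → ℂ} {U : Set ℂ} (hU : IsOpen U) {a b : ℝ}
    (hF : ContinuousOn (fun p : ℂ × ℝ => F p.1 p.2) (U ×ˢ Icc a b)) {z₀ : ℂ} (hz₀ : z₀ ∈ U) :
    ∃ r > 0, ball z₀ r ⊆ U ∧ ∃ C, ∀ z ∈ ball z₀ r, ∀ t ∈ Icc a b, ‖F z t‖ ≤ C := by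
  obtain ⟨r, hr, hrU⟩ := Metric.nhds_basis_closedBall.mem_iff.1 (hU.mem_nhds hz₀)
  have hK : IsCompact (closedBall z₀ r ×ˢ Icc a b) :=
    (isCompact_closedBall z₀ r).prod isCompact_Icc
  obtain ⟨C, hC⟩ := hK.exists_bound_of_continuousOn (hF.mono (prod_mono hrU le_rfl))
  exact ⟨r, hr, ball_subset_closedBall.trans hrU, C, fun z hz t ht =>
    hC (z, t) ⟨ball_subset_closedBall hz, ht⟩⟩

theorem hasDerivAt_intervalIntegral_of_differentiableOn {F : ℂ → ℝ → ℂ} {U : Set ℂ}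
    (hU : IsOpen U) {a b : ℝ} (hab : a ≤ b)
    (hF : ContinuousOn (fun p : ℂ × ℝ => F p.1 p.2) (U ×ˢ Icc a b))
    (hdiff : ∀ t ∈ Icc a b, DifferentiableOn ℂ (fun z => F z t) U) {z₀ : ℂ} (hz₀ : z₀ ∈ U) :
    HasDerivAt (fun z => ∫ t in a..b, F z t) (∫ t in a..b, deriv (fun z => F z t) z₀) z₀ := by
  obtain ⟨r, hr, hrU, C, hC⟩ := exists_bound_near_of_continuousOn hU hF hz₀
  simp_rw [intervalIntegral.integral_of_le hab, ← integral_Icc_eq_integral_Ioc]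
  refine hasDerivAt_integral_of_differentiableOn hr (bound := fun _ => C) (fun z hz => ?_) ?_ ?_ ?_
  · refine ContinuousOn.aestronglyMeasurable ?_ measurableSet_Icc
    exact hF.comp (f := fun t : ℝ => (z, t)) (s := Icc a b) (by fun_prop) fun t ht => ⟨hrU hz, ht⟩
  · filter_upwards [ae_restrict_mem measurableSet_Icc] with t ht using (hdiff t ht).mono hrU
  · filter_upwards [ae_restrict_mem measurableSet_Icc] with t ht z hz using hC z hz t ht
  · exact integrableOn_const (by simp)

theorem differentiableOn_intervalIntegral {F : ℂ → ℝ → ℂ} {U : Set ℂ}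
    (hU : IsOpen U) {a b : ℝ} (hab : a ≤ b)
    (hF : ContinuousOn (fun p : ℂ × ℝ => F p.1 p.2) (U ×ˢ Icc a b))
    (hdiff : ∀ t ∈ Icc a b, DifferentiableOn ℂ (fun z => F z t) U) :
    DifferentiableOn ℂ (fun z => ∫ t in a..b, F z t) U := fun _ hz =>
  (hasDerivAt_intervalIntegral_of_differentiableOn hU hab hF hdiff
    hz).differentiableAt.differentiableWithinAt

/-! ### Star domains, radial primitives and radial convolution -/

/-- `D` is star-shaped about the origin. -/
def IsStar (D : Set ℂ) : Prop := ∀ z ∈ D, ∀ t ∈ Icc (0 : ℝ) 1, (t : ℂ) * z ∈ D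

theorem IsStar.one_sub_mul_mem {D : Set ℂ} (hD : IsStar D) {z : ℂ} (hz : z ∈ D) {t : ℝ}
    (ht : t ∈ Icc (0 : ℝ) 1) : (1 - (t : ℂ)) * z ∈ D := by
  have := hD z hz (1 - t) ⟨by linarith [ht.2], by linarith [ht.1]⟩
  simpa using this

theorem IsStar.isPreconnected {D : Set ℂ} (hD : IsStar D) : IsPreconnected D := by
  refine isPreconnected_of_forall 0 fun z hz => ⟨(fun t : ℝ => (t : ℂ) * z) '' Icc 0 1, ?_, ?_, ?_, ?_⟩
  · rintro _ ⟨t, ht, rfl⟩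
    exact hD z hz t ht
  · exact ⟨0, by simp, by simp⟩
  · exact ⟨1, by simp, by simp⟩
  · exact isPreconnected_Icc.image _ (by fun_prop)

/-- A primitive of a holomorphic function along rays from the origin. -/
theorem hasDerivAt_radial_primitive {f : ℂ → ℂ} {D : Set ℂ} (hDo : IsOpen D) (hD : IsStar D)
    (hf : DifferentiableOn ℂ f D) {z : ℂ} (hz : z ∈ D) :
    HasDerivAt (fun z => z * ∫ t in (0 : ℝ)..1, f (t * z)) (f z) z := by
  have hmaps : MapsTo (fun p : ℂ × ℝ => (p.2 : ℂ) * p.1) (D ×ˢ Icc 0 1) D :=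
    fun p hp => hD p.1 hp.1 p.2 hp.2
  have h1 : HasDerivAt (fun z => ∫ t in (0 : ℝ)..1, f (t * z))
      (∫ t in (0 : ℝ)..1, deriv (fun z => f (t * z)) z) z := by
    refine hasDerivAt_intervalIntegral_of_differentiableOn hDo zero_le_one ?_ ?_ hz
    · exact hf.continuousOn.comp (by fun_prop) hmaps
    · exact fun t ht => hf.comp (by fun_prop) fun w hw => hD w hw t ht
  have h2 (t : ℝ) (ht : t ∈ Icc (0 : ℝ) 1) : HasDerivAt f (deriv f (t * z)) (t * z) :=
    (hf.differentiableAt (hDo.mem_nhds (hD z hz t ht))).hasDerivAt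
  have h3 (t : ℝ) (ht : t ∈ Icc (0 : ℝ) 1) :
      deriv (fun z => f (t * z)) z = t * deriv f (t * z) := by
    have := (h2 t ht).comp z ((hasDerivAt_id z).const_mul (t : ℂ))
    simpa [Function.comp_def, mul_comm] using this.deriv
  have hcf : ContinuousOn (fun t : ℝ => f (t * z)) (Icc 0 1) :=
    hf.continuousOn.comp (by fun_prop) fun t ht => hD z hz t ht
  have hcd : ContinuousOn (fun t : ℝ => deriv f (t * z)) (Icc 0 1) :=
    (hf.deriv hDo).continuousOn.comp (by fun_prop) fun t ht => hD z hz t ht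
  have hu : uIcc (0 : ℝ) 1 = Icc 0 1 := uIcc_of_le zero_le_one
  -- The integrand is the `t`-derivative of `t * f (t * z)`.
  have h4 : ∫ t in (0 : ℝ)..1, (f (t * z) + t * (z * deriv f (t * z))) = f z := by
    rw [intervalIntegral.integral_eq_sub_of_hasDerivAt (f := fun t : ℝ => (t : ℂ) * f (t * z))]
    · simp
    · intro t ht
      rw [hu] at ht
      have ht' : HasDerivAt (fun t : ℝ => (t : ℂ)) 1 t := Complex.ofRealCLM.hasDerivAt
      have := (h2 t ht).comp t (ht'.mul_const z)
      convert! ht'.mul this using 1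
      simp only [Function.comp_apply]
      ring
    · refine ContinuousOn.intervalIntegrable ?_
      rw [hu]
      exact hcf.add (Complex.continuous_ofReal.continuousOn.mul (continuousOn_const.mul hcd))
  have h5 := (hasDerivAt_id z).mul h1
  convert! h5 using 1
  rw [← h4, intervalIntegral.integral_add]
  · simp only [one_mul, id]
    congr 1
    rw [← intervalIntegral.integral_const_mul]
    refine intervalIntegral.integral_congr fun t ht => ?_
    rw [hu] at ht
    simp only [h3 t ht]; ring
  · refine ContinuousOn.intervalIntegrable ?_
    rwa [hu]
  · refine ContinuousOn.intervalIntegrable ?_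
    rw [hu]; fun_prop

/-- The convolution `∫₀ᶻ f(s) g(z - s) ds` along the segment from `0` to `z`. -/
noncomputable def rayConv (f g : ℂ → ℂ) (z : ℂ) : ℂ :=
  z * ∫ t in (0 : ℝ)..1, f (t * z) * g ((1 - t) * z)

theorem differentiableOn_rayConv {f g : ℂ → ℂ} {D : Set ℂ} (hDo : IsOpen D) (hD : IsStar D)
    (hf : DifferentiableOn ℂ f D) (hg : DifferentiableOn ℂ g D) :
    DifferentiableOn ℂ (rayConv f g) D := by
  refine differentiableOn_id.mul (differentiableOn_intervalIntegral hDo zero_le_one ?_ ?_)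
  · refine (hf.continuousOn.comp (by fun_prop) fun p hp => hD p.1 hp.1 p.2 hp.2).mul
      (hg.continuousOn.comp (by fun_prop) fun p hp => hD.one_sub_mul_mem hp.1 hp.2)
  · exact fun t ht => (hf.comp (by fun_prop) fun w hw => hD w hw t ht).mul
      (hg.comp (by fun_prop) fun w hw => hD.one_sub_mul_mem hw ht)

/-- The `(n + 1)`-fold convolution power of `b`. -/
noncomputable def convPow (b : ℂ → ℂ) : ℕ → ℂ → ℂ
  | 0 => b
  | n + 1 => rayConv (convPow b n) b

/-- The convolution exponential of `b` without its unit term. -/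
noncomputable def convExp (b : ℂ → ℂ) (z : ℂ) : ℂ := ∑' n : ℕ, convPow b n z / (n + 1).factorial

theorem differentiableOn_convPow {b : ℂ → ℂ} {D : Set ℂ} (hDo : IsOpen D) (hD : IsStar D)
    (hb : DifferentiableOn ℂ b D) (n : ℕ) : DifferentiableOn ℂ (convPow b n) D := by
  induction n with
  | zero => exact hb
  | succ n ih => exact differentiableOn_rayConv hDo hD ih hb

/-- An iterated convolution integrates over a simplex, whence the factorial. Only the values of `b`
on the segment from `0` to `z` enter, so the convolution exponential converges on any star domain
without global bounds. -/
theorem norm_convPow_le {b : ℂ → ℂ} {M : ℝ} (n : ℕ) {z : ℂ}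
    (hb : ∀ t ∈ Icc (0 : ℝ) 1, ‖b (t * z)‖ ≤ M) :
    ‖convPow b n z‖ ≤ M ^ (n + 1) * ‖z‖ ^ n / n.factorial := by
  have hM : 0 ≤ M := (norm_nonneg _).trans (hb 0 (by simp))
  induction n generalizing z with
  | zero => simpa [convPow] using hb 1 (by simp)
  | succ n ih =>
    have key : ‖∫ t in (0 : ℝ)..1, convPow b n (t * z) * b ((1 - t) * z)‖ ≤
        ∫ t in (0 : ℝ)..1, (M ^ (n + 1) * ‖z‖ ^ n / n.factorial * M) * t ^ n := by
      refine intervalIntegral.norm_integral_le_of_norm_le zero_le_one ?_ (by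
        apply Continuous.intervalIntegrable; fun_prop)
      filter_upwards with t ht
      have ht' : t ∈ Icc (0 : ℝ) 1 := ⟨ht.1.le, ht.2⟩
      have h1 := ih (z := t * z) (fun u hu => by
        have := hb (u * t) ⟨mul_nonneg hu.1 ht'.1, mul_le_one₀ hu.2 ht'.1 ht'.2⟩
        simpa [mul_assoc] using this)
      have h2 : ‖b ((1 - t) * z)‖ ≤ M := by
        have := hb (1 - t) ⟨by linarith [ht'.2], by linarith [ht'.1]⟩
        simpa using this
      rw [norm_mul]
      refine (mul_le_mul h1 h2 (norm_nonneg _) (by positivity)).trans (le_of_eq ?_)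
      rw [norm_mul, Complex.norm_real, Real.norm_of_nonneg ht'.1]
      ring
    rw [convPow, rayConv, norm_mul]
    refine (mul_le_mul_of_nonneg_left key (norm_nonneg _)).trans (le_of_eq ?_)
    rw [intervalIntegral.integral_const_mul, integral_pow]
    push_cast [Nat.factorial_succ]
    simp only [one_pow, ne_eq, Nat.add_eq_zero_iff, one_ne_zero, and_false, not_false_eq_true,
      zero_pow, sub_zero]
    field_simp
    ring

theorem norm_convPow_div_le {b : ℂ → ℂ} {M R : ℝ} (n : ℕ) {z : ℂ}
    (hb : ∀ t ∈ Icc (0 : ℝ) 1, ‖b (t * z)‖ ≤ M) (hz : ‖z‖ ≤ R) :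
    ‖convPow b n z / (n + 1).factorial‖ ≤ M * ((M * R) ^ n / n.factorial) := by
  have hM : 0 ≤ M := (norm_nonneg _).trans (hb 0 (by simp))
  rw [norm_div, Complex.norm_natCast]
  have h1 : ‖convPow b n z‖ ≤ M * ((M * R) ^ n / n.factorial) := by
    refine (norm_convPow_le n hb).trans ?_
    rw [pow_succ, mul_pow, mul_comm (M ^ n) M, mul_assoc M, mul_div_assoc]
    gcongr
  refine (div_le_self (norm_nonneg _) ?_).trans h1
  exact_mod_cast Nat.succ_le_of_lt (Nat.factorial_pos _)

theorem summable_convExp_bound (M R : ℝ) :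
    Summable fun n : ℕ => M * ((M * R) ^ n / n.factorial) :=
  (Real.summable_pow_div_factorial _).mul_left M

theorem summable_convExp {b : ℂ → ℂ} {D : Set ℂ} (hD : IsStar D)
    (hb : ContinuousOn b D) {z : ℂ} (hz : z ∈ D) :
    Summable fun n : ℕ => convPow b n z / (n + 1).factorial := by
  obtain ⟨M, hM⟩ := isCompact_Icc.exists_bound_of_continuousOn
    (hb.comp (f := fun t : ℝ => (t : ℂ) * z) (s := Icc 0 1) (by fun_prop) fun t ht => hD z hz t ht)
  exact (summable_convExp_bound M ‖z‖).of_norm_bounded fun n => norm_convPow_div_le n hM le_rfl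

theorem differentiableOn_convExp {b : ℂ → ℂ} {D : Set ℂ} (hDo : IsOpen D) (hD : IsStar D)
    (hb : DifferentiableOn ℂ b D) : DifferentiableOn ℂ (convExp b) D := by
  intro z₀ hz₀
  obtain ⟨r, hr, hrD, M, hM⟩ := exists_bound_near_of_continuousOn (a := 0) (b := 1)
    (F := fun z t => b (t * z)) hDo
    (hb.continuousOn.comp (by fun_prop) fun p hp => hD p.1 hp.1 p.2 hp.2) hz₀
  have : DifferentiableOn ℂ (convExp b) (ball z₀ r) := by
    refine Complex.differentiableOn_tsum_of_summable_norm (summable_convExp_bound M (‖z₀‖ + r))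
      (fun n => ((differentiableOn_convPow hDo hD hb n).mono hrD).div_const _) isOpen_ball
      fun n z hz => norm_convPow_div_le n (hM z hz) ?_
    have := norm_sub_norm_le z z₀
    rw [mem_ball, dist_eq_norm] at hz
    linarith
  exact (this.differentiableAt (ball_mem_nhds z₀ hr)).differentiableWithinAt

/-- Each of the `n + 1` factors and each of the `n` integrations contributes a sign, an odd number
in all. For an even kernel this relates the convolution exponentials of opposite exponents, and thus
the two sides of a cut. -/
theorem convPow_neg_of_even {b b' : ℂ → ℂ} (hb : ∀ z, b' z = -b (-z)) (n : ℕ) (z : ℂ) :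
    convPow b' n z = -convPow b n (-z) := by
  induction n generalizing z with
  | zero => exact hb z
  | succ n ih =>
    simp only [convPow, rayConv, ih, hb]
    simp

theorem convExp_neg_of_even {b b' : ℂ → ℂ} (hb : ∀ z, b' z = -b (-z)) (z : ℂ) :
    convExp b' z = -convExp b (-z) := by
  simp only [convExp, convPow_neg_of_even hb, neg_div, tsum_neg]

/-- Of the `n + 1` factors `c`, the `n` integrations absorb all but one as Jacobians. -/
theorem convPow_scale (b : ℂ → ℂ) (c : ℂ) (n : ℕ) (z : ℂ) :
    convPow (fun z => c * b (c * z)) n z = c * convPow b n (c * z) := by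
  induction n generalizing z with
  | zero => rfl
  | succ n ih =>
    simp only [convPow, rayConv, ih]
    rw [mul_assoc c z, mul_left_comm c z, mul_left_comm c z, ← intervalIntegral.integral_const_mul c,
      ← intervalIntegral.integral_const_mul c]
    congr 1
    refine intervalIntegral.integral_congr fun t _ => ?_
    simp only [mul_left_comm c]
    ring

theorem convExp_scale (b : ℂ → ℂ) (c : ℂ) (z : ℂ) :
    convExp (fun z => c * b (c * z)) z = c * convExp b (c * z) := by
  simp only [convExp, convPow_scale, mul_div_assoc, tsum_mul_left]

theorem convPow_conj {b : ℂ → ℂ} (hb : ∀ z, b ((starRingEnd ℂ) z) = (starRingEnd ℂ) (b z))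
    (n : ℕ) (z : ℂ) : convPow b n ((starRingEnd ℂ) z) = (starRingEnd ℂ) (convPow b n z) := by
  induction n generalizing z with
  | zero => exact hb z
  | succ n ih =>
    simp only [convPow, rayConv, map_mul]
    rw [intervalIntegral.integral_of_le zero_le_one, intervalIntegral.integral_of_le zero_le_one,
      ← integral_conj]
    simp [← ih, ← hb]

theorem convExp_conj {b : ℂ → ℂ} (hb : ∀ z, b ((starRingEnd ℂ) z) = (starRingEnd ℂ) (b z))
    (z : ℂ) : convExp b ((starRingEnd ℂ) z) = (starRingEnd ℂ) (convExp b z) := by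
  simp only [convExp, convPow_conj hb]
  rw [Complex.conj_tsum]
  simp

/-! ### Laplace transforms along the positive real axis -/

/-- The integrand of the Laplace transform of `f` at `ρ`. -/
noncomputable def laplaceIntegrand (f : ℂ → ℂ) (ρ : ℂ) (x : ℝ) : ℂ := f x * Complex.exp (-ρ * x)

/-- The Laplace transform of the restriction of `f` to the positive real axis. -/
noncomputable def laplace (f : ℂ → ℂ) (ρ : ℂ) : ℂ := ∫ x in Ioi (0 : ℝ), laplaceIntegrand f ρ x

theorem laplaceIntegrand_rayConv (f g : ℂ → ℂ) (ρ : ℂ) (x : ℝ) :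
    ∫ t in (0 : ℝ)..x, (ContinuousLinearMap.mul ℝ ℂ) (laplaceIntegrand f ρ t)
      (laplaceIntegrand g ρ (x - t)) = laplaceIntegrand (rayConv f g) ρ x := by
  have h1 (t : ℝ) : (ContinuousLinearMap.mul ℝ ℂ) (laplaceIntegrand f ρ t)
      (laplaceIntegrand g ρ (x - t)) = f t * g (x - t) * Complex.exp (-ρ * x) := by
    simp only [ContinuousLinearMap.mul_apply', laplaceIntegrand]
    rw [mul_mul_mul_comm, ← Complex.exp_add]
    push_cast
    ring_nf
  simp_rw [h1]
  rw [intervalIntegral.integral_mul_const, laplaceIntegrand, rayConv]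
  congr 1
  have := intervalIntegral.smul_integral_comp_mul_right (a := 0) (b := 1)
    (fun t : ℝ => f t * g (x - t)) x
  simp only [zero_mul, one_mul] at this
  rw [← this, Complex.real_smul]
  congr 1
  refine intervalIntegral.integral_congr fun t _ => ?_
  simp [sub_mul]

theorem integrableOn_laplaceIntegrand_rayConv {f g : ℂ → ℂ} {ρ : ℂ}
    (hf : IntegrableOn (laplaceIntegrand f ρ) (Ioi 0))
    (hg : IntegrableOn (laplaceIntegrand g ρ) (Ioi 0)) :
    IntegrableOn (laplaceIntegrand (rayConv f g) ρ) (Ioi 0) := by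
  have := integrable_posConvolution hf hg (ContinuousLinearMap.mul ℝ ℂ)
  unfold posConvolution at this
  rw [integrable_indicator_iff measurableSet_Ioi] at this
  simpa only [laplaceIntegrand_rayConv] using this

theorem laplace_rayConv {f g : ℂ → ℂ} {ρ : ℂ}
    (hf : IntegrableOn (laplaceIntegrand f ρ) (Ioi 0))
    (hg : IntegrableOn (laplaceIntegrand g ρ) (Ioi 0)) :
    laplace (rayConv f g) ρ = laplace f ρ * laplace g ρ := by
  have := integral_posConvolution hf hg (ContinuousLinearMap.mul ℝ ℂ)
  simp only [laplaceIntegrand_rayConv] at this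
  exact this

theorem norm_laplaceIntegrand (f : ℂ → ℂ) (ρ : ℂ) (x : ℝ) :
    ‖laplaceIntegrand f ρ x‖ = ‖f x‖ * Real.exp (-ρ.re * x) := by
  simp [laplaceIntegrand, Complex.norm_exp]

theorem integrableOn_pow_mul_exp_neg (n : ℕ) {β : ℝ} (hβ : 0 < β) :
    IntegrableOn (fun x : ℝ => x ^ n * Real.exp (-β * x)) (Ioi 0) := by
  have := integrableOn_rpow_mul_exp_neg_mul_rpow (s := n) (p := 1) (b := β)
    (by have : (0:ℝ) ≤ n := n.cast_nonneg
        linarith) one_pos hβ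
  simpa using this

theorem integral_pow_mul_exp_neg (n : ℕ) {β : ℝ} (hβ : 0 < β) :
    ∫ x in Ioi (0 : ℝ), x ^ n * Real.exp (-β * x) = n.factorial / β ^ (n + 1) := by
  have := Real.integral_rpow_mul_exp_neg_mul_Ioi (a := n + 1) (r := β) (by positivity) hβ
  simp only [add_sub_cancel_right, Real.rpow_natCast, Real.Gamma_nat_eq_factorial] at this
  rw [show (n : ℝ) + 1 = ((n + 1 : ℕ) : ℝ) by push_cast; ring, Real.rpow_natCast] at this
  simp only [neg_mul, this]
  rw [one_div, inv_pow]
  ring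

theorem IsStar.ofReal_Ici_subset {D : Set ℂ} {b : ℂ → ℂ} (hD : ∀ x : ℝ, 0 ≤ x → (x : ℂ) ∈ D)
    (hb : ContinuousOn b D) : ContinuousOn (fun x : ℝ => b x) (Ici 0) :=
  hb.comp (by fun_prop) fun x hx => hD x hx

section

variable {b : ℂ → ℂ} {D : Set ℂ} {M : ℝ}

theorem aestronglyMeasurable_laplaceIntegrand {f : ℂ → ℂ} (hpos : ∀ x : ℝ, 0 ≤ x → (x : ℂ) ∈ D)
    (hf : ContinuousOn f D) (ρ : ℂ) :
    AEStronglyMeasurable (laplaceIntegrand f ρ) (volume.restrict (Ioi 0)) := by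
  refine ContinuousOn.aestronglyMeasurable (ContinuousOn.mul ?_ (by fun_prop)) measurableSet_Ioi
  exact (IsStar.ofReal_Ici_subset hpos hf).mono Ioi_subset_Ici_self

theorem norm_laplaceIntegrand_convPow_le (hM : ∀ x : ℝ, 0 ≤ x → ‖b x‖ ≤ M) (n : ℕ) (ρ : ℂ)
    {x : ℝ} (hx : 0 < x) : ‖laplaceIntegrand (convPow b n) ρ x‖ ≤
      (M ^ (n + 1) / n.factorial) * (x ^ n * Real.exp (-ρ.re * x)) := by
  rw [norm_laplaceIntegrand, ← mul_assoc]
  gcongr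
  refine (norm_convPow_le (M := M) n fun t ht => ?_).trans (le_of_eq ?_)
  · simpa using hM (t * x) (mul_nonneg ht.1 hx.le)
  · rw [Complex.norm_real, Real.norm_of_nonneg hx.le]
    ring

theorem integrableOn_laplaceIntegrand_convPow (hDo : IsOpen D) (hD : IsStar D)
    (hpos : ∀ x : ℝ, 0 ≤ x → (x : ℂ) ∈ D) (hb : DifferentiableOn ℂ b D)
    (hM : ∀ x : ℝ, 0 ≤ x → ‖b x‖ ≤ M) (n : ℕ) {ρ : ℂ} (hρ : 0 < ρ.re) :
    IntegrableOn (laplaceIntegrand (convPow b n) ρ) (Ioi 0) := by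
  refine ((integrableOn_pow_mul_exp_neg n hρ).const_mul (M ^ (n + 1) / n.factorial)).mono'
    (aestronglyMeasurable_laplaceIntegrand hpos (differentiableOn_convPow hDo hD hb n).continuousOn
      ρ) ?_
  filter_upwards [ae_restrict_mem measurableSet_Ioi] with x hx using
    norm_laplaceIntegrand_convPow_le hM n ρ hx

theorem laplace_convPow (hDo : IsOpen D) (hD : IsStar D)
    (hpos : ∀ x : ℝ, 0 ≤ x → (x : ℂ) ∈ D) (hb : DifferentiableOn ℂ b D)
    (hM : ∀ x : ℝ, 0 ≤ x → ‖b x‖ ≤ M) (n : ℕ) {ρ : ℂ} (hρ : 0 < ρ.re) :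
    laplace (convPow b n) ρ = laplace b ρ ^ (n + 1) := by
  induction n with
  | zero => simp [convPow]
  | succ n ih =>
    rw [convPow, laplace_rayConv (g := b) (integrableOn_laplaceIntegrand_convPow hDo hD hpos hb hM n hρ)
      (integrableOn_laplaceIntegrand_convPow hDo hD hpos hb hM 0 hρ), ih, pow_succ _ (n + 1)]

theorem integral_norm_laplaceIntegrand_convPow_le (hDo : IsOpen D) (hD : IsStar D)
    (hpos : ∀ x : ℝ, 0 ≤ x → (x : ℂ) ∈ D) (hb : DifferentiableOn ℂ b D)
    (hM : ∀ x : ℝ, 0 ≤ x → ‖b x‖ ≤ M) (n : ℕ) {ρ : ℂ} (hρ : 0 < ρ.re) :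
    ∫ x in Ioi (0 : ℝ), ‖laplaceIntegrand (convPow b n) ρ x‖ ≤ (M / ρ.re) ^ (n + 1) := by
  refine (setIntegral_mono_on
    (integrableOn_laplaceIntegrand_convPow hDo hD hpos hb hM n hρ).norm
    ((integrableOn_pow_mul_exp_neg n hρ).const_mul (M ^ (n + 1) / n.factorial)) measurableSet_Ioi
    fun x hx => norm_laplaceIntegrand_convPow_le hM n ρ hx).trans (le_of_eq ?_)
  rw [integral_const_mul, integral_pow_mul_exp_neg n hρ, div_pow]
  field_simp

theorem integrable_tsum_of_summable_integral_norm {α : Type*} [MeasurableSpace α] {μ : Measure α}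
    {F : ℕ → α → ℂ} (hF : ∀ n, Integrable (F n) μ) (hs : Summable fun n => ∫ x, ‖F n x‖ ∂μ)
    (hm : AEStronglyMeasurable (fun x => ∑' n, F n x) μ) : Integrable (fun x => ∑' n, F n x) μ := by
  refine ⟨hm, ?_⟩
  calc ∫⁻ x, ‖∑' n, F n x‖ₑ ∂μ ≤ ∫⁻ x, ∑' n, ‖F n x‖ₑ ∂μ :=
        lintegral_mono fun x => enorm_tsum_le_tsum_enorm
    _ = ∑' n, ∫⁻ x, ‖F n x‖ₑ ∂μ := lintegral_tsum fun n => (hF n).1.enorm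
    _ = ∑' n, ENNReal.ofReal (∫ x, ‖F n x‖ ∂μ) := by
        simp only [ofReal_integral_norm_eq_lintegral_enorm (hF _)]
    _ = ENNReal.ofReal (∑' n, ∫ x, ‖F n x‖ ∂μ) :=
        (ENNReal.ofReal_tsum_of_nonneg (fun n => integral_nonneg fun x => norm_nonneg _) hs).symm
    _ < ⊤ := ENNReal.ofReal_lt_top

/-- The factorial in the convolution exponential makes the series of norms exponential, with terms
at most `(M / Re ρ)^(n+1) / (n+1)!`. Hence every `ρ` with positive real part is admitted, not only
those with `Re ρ > M`. -/
theorem laplaceIntegrand_convExp_hasSum (hDo : IsOpen D) (hD : IsStar D)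
    (hpos : ∀ x : ℝ, 0 ≤ x → (x : ℂ) ∈ D) (hb : DifferentiableOn ℂ b D)
    (hM : ∀ x : ℝ, 0 ≤ x → ‖b x‖ ≤ M) {ρ : ℂ} (hρ : 0 < ρ.re) :
    HasSum (fun n : ℕ => laplace b ρ ^ (n + 1) / (n + 1).factorial) (laplace (convExp b) ρ) ∧
      IntegrableOn (laplaceIntegrand (convExp b) ρ) (Ioi 0) := by
  have hM0 : 0 ≤ M := (norm_nonneg _).trans (hM 0 le_rfl)
  set F : ℕ → ℝ → ℂ := fun n x => laplaceIntegrand (convPow b n) ρ x / (n + 1).factorial with hF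
  have hFint (n : ℕ) : IntegrableOn (F n) (Ioi 0) :=
    (integrableOn_laplaceIntegrand_convPow hDo hD hpos hb hM n hρ).div_const _
  have hle (n : ℕ) : ∫ x in Ioi (0 : ℝ), ‖F n x‖ ≤ (M / ρ.re) ^ (n + 1) / (n + 1).factorial := by
    simp only [hF, norm_div, Complex.norm_natCast, integral_div]
    gcongr
    exact integral_norm_laplaceIntegrand_convPow_le hDo hD hpos hb hM n hρ
  have hsum : Summable fun n : ℕ => (M / ρ.re) ^ (n + 1) / (n + 1).factorial :=
    (summable_nat_add_iff 1).2 (Real.summable_pow_div_factorial (M / ρ.re))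
  have hs2 : Summable fun n => ∫ x in Ioi (0 : ℝ), ‖F n x‖ :=
    hsum.of_nonneg_of_le (fun n => integral_nonneg fun x => norm_nonneg _) hle
  have heq : EqOn (fun x => ∑' n, F n x) (laplaceIntegrand (convExp b) ρ) (Ioi 0) := by
    intro x hx
    simp only [hF, laplaceIntegrand, convExp, ← tsum_mul_right]
    exact tsum_congr fun n => by ring
  constructor
  · have h1 := hasSum_integral_of_summable_integral_norm hFint hs2
    rw [setIntegral_congr_fun measurableSet_Ioi heq] at h1
    refine h1.congr_fun fun n => ?_
    rw [integral_div, ← laplace_convPow hDo hD hpos hb hM n hρ, laplace]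
  · have h2 : IntegrableOn (fun x => ∑' n, F n x) (Ioi 0) := by
      refine integrable_tsum_of_summable_integral_norm hFint hs2 ?_
      exact (aestronglyMeasurable_laplaceIntegrand hpos
        (differentiableOn_convExp hDo hD hb).continuousOn ρ).congr
        ((ae_restrict_mem measurableSet_Ioi).mono fun x hx => (heq hx).symm)
    exact h2.congr_fun heq measurableSet_Ioi

theorem laplace_convExp (hDo : IsOpen D) (hD : IsStar D)
    (hpos : ∀ x : ℝ, 0 ≤ x → (x : ℂ) ∈ D) (hb : DifferentiableOn ℂ b D)
    (hM : ∀ x : ℝ, 0 ≤ x → ‖b x‖ ≤ M) {ρ : ℂ} (hρ : 0 < ρ.re) :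
    laplace (convExp b) ρ = Complex.exp (laplace b ρ) - 1 := by
  have h1 := (laplaceIntegrand_convExp_hasSum hDo hD hpos hb hM hρ).1
  have h2 : HasSum (fun n : ℕ => laplace b ρ ^ n / (n.factorial : ℂ))
      (Complex.exp (laplace b ρ)) := by
    rw [Complex.exp_eq_exp_ℂ]
    exact NormedSpace.expSeries_div_hasSum_exp _
  have h3 := (hasSum_nat_add_iff' 1).2 h2
  simp only [Finset.range_one, Finset.sum_singleton, pow_zero, Nat.factorial_zero, Nat.cast_one,
    div_one] at h3
  exact h1.unique h3

end

/-! ### Inversion of the Laplace transform -/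

/-- On a vertical line the Laplace transform is a Fourier transform of the damped function, so that
Fourier inversion becomes available. -/
theorem fourier_indicator_laplace (f : ℂ → ℂ) (β ξ : ℝ) :
    FourierTransform.fourier (indicator (Ioi (0 : ℝ)) (laplaceIntegrand f β)) ξ =
      laplace f (β + 2 * Real.pi * ξ * Complex.I) := by
  rw [Real.fourier_eq', laplace, ← integral_indicator measurableSet_Ioi]
  refine integral_congr_ae (Eventually.of_forall fun x => ?_)
  by_cases hx : x ∈ Ioi (0 : ℝ)
  · simp only [indicator_of_mem hx, laplaceIntegrand, smul_eq_mul]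
    rw [mul_left_comm, ← Complex.exp_add]
    congr 2
    simp
    ring
  · simp [indicator_of_notMem hx]

/-- Inversion of an absolutely integrable Laplace transform. -/
theorem laplace_inversion {f : ℂ → ℂ} {β x : ℝ} (hx : 0 < x)
    (hf : IntegrableOn (laplaceIntegrand f β) (Ioi 0))
    (hcont : ContinuousAt (fun x : ℝ => f x) x)
    (hint : Integrable fun y : ℝ => laplace f (β + y * Complex.I)) :
    2 * Real.pi * f x =
      ∫ y : ℝ, laplace f (β + y * Complex.I) * Complex.exp ((β + y * Complex.I) * x) := by
  have hpi : (0 : ℝ) < 2 * Real.pi := by positivity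
  have h1 : FourierTransform.fourier (indicator (Ioi (0 : ℝ)) (laplaceIntegrand f β)) =
      fun ξ : ℝ => laplace f (β + ((2 * Real.pi * ξ : ℝ) : ℂ) * Complex.I) := by
    ext ξ
    rw [fourier_indicator_laplace]
    push_cast
    rfl
  have h2 : Integrable (FourierTransform.fourier
      (indicator (Ioi (0 : ℝ)) (laplaceIntegrand f β))) := by
    rw [h1]
    exact hint.comp_mul_left' hpi.ne'
  have hca : ContinuousAt (indicator (Ioi (0 : ℝ)) (laplaceIntegrand f β)) x := by
    have : laplaceIntegrand f β =ᶠ[𝓝 x] indicator (Ioi (0 : ℝ)) (laplaceIntegrand f β) := by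
      filter_upwards [Ioi_mem_nhds hx] with t ht
      rw [indicator_of_mem ht]
    refine ContinuousAt.congr ?_ this
    exact hcont.mul (by fun_prop)
  have h3 := ((integrable_indicator_iff measurableSet_Ioi).2 hf).fourierInv_fourier_eq h2 hca
  rw [indicator_of_mem (mem_Ioi.2 hx), h1, Real.fourierInv_eq'] at h3
  have h4 := Measure.integral_comp_mul_left
    (fun y : ℝ => laplace f (β + y * Complex.I) * Complex.exp (y * Complex.I * x)) (2 * Real.pi)
  have h5 : ∫ ξ : ℝ, laplace f (β + ((2 * Real.pi * ξ : ℝ) : ℂ) * Complex.I) *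
      Complex.exp (((2 * Real.pi * ξ : ℝ) : ℂ) * Complex.I * x) = laplaceIntegrand f β x := by
    rw [← h3]
    refine integral_congr_ae (Eventually.of_forall fun ξ => ?_)
    simp only [smul_eq_mul]
    rw [mul_comm]
    congr 2
    simp
    ring
  rw [h5, laplaceIntegrand, Complex.real_smul, abs_of_pos (inv_pos.2 hpi)] at h4
  have h6 : ∫ y : ℝ, laplace f (β + y * Complex.I) * Complex.exp ((β + y * Complex.I) * x) =
      Complex.exp (β * x) *
        ∫ y : ℝ, laplace f (β + y * Complex.I) * Complex.exp (y * Complex.I * x) := by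
    rw [← integral_const_mul]
    refine integral_congr_ae (Eventually.of_forall fun y => ?_)
    simp only [add_mul, Complex.exp_add]
    ring
  have h7 : ∫ y : ℝ, laplace f (β + y * Complex.I) * Complex.exp (y * Complex.I * x) =
      2 * Real.pi * (f x * Complex.exp (-β * x)) := by
    rw [h4]
    push_cast
    rw [← mul_assoc, mul_inv_cancel₀ (by exact_mod_cast hpi.ne'), one_mul]
  rw [h6, h7, neg_mul, Complex.exp_neg]
  field_simp [Complex.exp_ne_zero]

/-- A function on the positive axis is determined by its Laplace transform. -/
theorem eq_of_laplace_eq {f g : ℂ → ℂ} {β x : ℝ} (hx : 0 < x)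
    (hf : IntegrableOn (laplaceIntegrand f β) (Ioi 0))
    (hg : IntegrableOn (laplaceIntegrand g β) (Ioi 0))
    (hfc : ContinuousAt (fun x : ℝ => f x) x) (hgc : ContinuousAt (fun x : ℝ => g x) x)
    (h : ∀ ρ : ℂ, ρ.re = β → laplace f ρ = laplace g ρ) : f x = g x := by
  have key (ρ : ℂ) (hρ : ρ.re = β) : laplace (fun z => f z - g z) ρ = 0 := by
    have hint (f : ℂ → ℂ) (hf : IntegrableOn (laplaceIntegrand f β) (Ioi 0)) :
        IntegrableOn (laplaceIntegrand f ρ) (Ioi 0) := by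
      have h1 : laplaceIntegrand f ρ =
          fun x : ℝ => Complex.exp (-(ρ - β) * x) * laplaceIntegrand f β x := by
        ext x
        rw [laplaceIntegrand, laplaceIntegrand, mul_left_comm, ← Complex.exp_add]
        ring_nf
      rw [h1]
      refine hf.bdd_mul (c := 1) (Continuous.aestronglyMeasurable (by fun_prop))
        (Eventually.of_forall fun x => ?_)
      rw [Complex.norm_exp]
      simp [hρ]
    have h2 := integral_sub (hint f hf) (hint g hg)
    have h3 := h ρ hρ
    rw [laplace, laplace] at h3
    rw [h3, sub_self] at h2
    rw [laplace, ← h2]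
    congr 1 with x
    simp [laplaceIntegrand, sub_mul]
  -- The transform of the difference vanishes on the line, hence is trivially integrable there, and
  -- inversion applies.
  have := laplace_inversion (f := fun z => f z - g z) (β := β) hx ((hf.sub hg).congr_fun (fun x _ => by
    simp [laplaceIntegrand, sub_mul]) measurableSet_Ioi) (hfc.sub hgc) (by
      simp [key])
  simp only [key, Complex.add_re, Complex.ofReal_re, Complex.mul_re, Complex.I_re, mul_zero,
    Complex.ofReal_im, Complex.I_im, mul_one, sub_self, add_zero, zero_mul, integral_zero] at this
  have hpi : (2 * Real.pi : ℂ) ≠ 0 := by exact_mod_cast (by positivity : (2 * Real.pi : ℝ) ≠ 0)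
  exact sub_eq_zero.1 ((mul_eq_zero.1 this).resolve_left hpi)

/-! ### The periodic Bernoulli kernel and Binet's function -/

/-- The periodic function `{t} (1 - {t}) / 2`. -/
noncomputable def sawSquare (t : ℝ) : ℝ := Int.fract t * (1 - Int.fract t) / 2

theorem sawSquare_nonneg (t : ℝ) : 0 ≤ sawSquare t :=
  div_nonneg (mul_nonneg (Int.fract_nonneg t) (by linarith [Int.fract_lt_one t])) zero_le_two

theorem sawSquare_le (t : ℝ) : sawSquare t ≤ 1 / 8 := by
  unfold sawSquare
  nlinarith [sq_nonneg (Int.fract t - 1 / 2)]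

theorem norm_sawSquare_le (t : ℝ) : ‖(sawSquare t : ℂ)‖ ≤ 1 / 8 := by
  rw [Complex.norm_real, Real.norm_of_nonneg (sawSquare_nonneg t)]
  exact sawSquare_le t

theorem measurable_sawSquare : Measurable sawSquare := by
  unfold sawSquare
  fun_prop

theorem sawSquare_add_one (t : ℝ) : sawSquare (t + 1) = sawSquare t := by
  simp [sawSquare]

/-- The numbers `(2 π (k + 1))²`. -/
noncomputable def freqSq (k : ℕ) : ℝ := (2 * Real.pi * (k + 1)) ^ 2

theorem freqSq_pos (k : ℕ) : 0 < freqSq k := by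
  unfold freqSq; positivity

theorem summable_inv_freqSq : Summable fun k => (freqSq k)⁻¹ := by
  have h1 := (summable_nat_add_iff (f := fun n : ℕ => 1 / (n : ℝ) ^ 2) 1).2
    (Real.summable_one_div_nat_pow.2 one_lt_two)
  refine (h1.mul_left (1 / (2 * Real.pi) ^ 2)).congr fun k => ?_
  unfold freqSq
  push_cast
  field_simp

/-- This is the Fourier series of the second Bernoulli polynomial at `0` minus the same series at
the fractional part of `t`. -/
theorem hasSum_sawSquare (t : ℝ) :
    HasSum (fun k : ℕ => 2 / freqSq k * (1 - Real.cos (2 * Real.pi * (k + 1) * t)))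
      (sawSquare t) := by
  have key (x : ℝ) (hx : x ∈ Icc (0 : ℝ) 1) :
      HasSum (fun n : ℕ => 1 / (n : ℝ) ^ 2 * Real.cos (2 * Real.pi * n * x))
        (Real.pi ^ 2 * (x ^ 2 - x + 1 / 6)) := by
    have := hasSum_one_div_nat_pow_mul_cos one_ne_zero hx
    convert! this using 1
    simp only [mul_one, Polynomial.bernoulli, Finset.sum_range_succ, Finset.range_zero,
      Finset.sum_empty, Polynomial.map_add, Polynomial.map_monomial, Polynomial.eval_add,
      Polynomial.eval_monomial, bernoulli_zero, bernoulli_one, bernoulli_two]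
    simp [Nat.choose]
    norm_num
    ring
  have hfr : Int.fract t ∈ Icc (0 : ℝ) 1 := ⟨Int.fract_nonneg t, (Int.fract_lt_one t).le⟩
  have h1 := (key 0 ⟨le_rfl, zero_le_one⟩).sub (key (Int.fract t) hfr)
  -- The dropped term `n = 0` is zero, because `1 / 0 = 0` by convention.
  have h2 := (hasSum_nat_add_iff' 1).2 (h1.mul_left (1 / (2 * Real.pi ^ 2)))
  convert! h2 using 1
  · ext k
    have hcos : Real.cos (2 * Real.pi * (k + 1) * t) =
        Real.cos (2 * Real.pi * ((k + 1 : ℕ) : ℝ) * Int.fract t) := by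
      have : 2 * Real.pi * (k + 1) * t = 2 * Real.pi * ((k + 1 : ℕ) : ℝ) * Int.fract t +
          (((k + 1) * ⌊t⌋ : ℤ) : ℝ) * (2 * Real.pi) := by
        conv_lhs => rw [← Int.floor_add_fract t]
        push_cast
        ring
      rw [this, Real.cos_add_int_mul_two_pi]
    rw [hcos]
    unfold freqSq
    push_cast
    simp only [mul_zero, Real.cos_zero]
    field_simp
  · unfold sawSquare
    simp
    field_simp
    ring

/-- The meromorphic function `∑ 2 / (x² + (2 π k)²)`, the Borel transform of Binet's function. -/
noncomputable def binetKernel (x : ℂ) : ℂ := ∑' k : ℕ, 2 / (x ^ 2 + freqSq k)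

theorem integral_exp_neg_mul {x : ℂ} (hx : 0 < x.re) :
    ∫ t in Ioi (0 : ℝ), Complex.exp (-x * t) = 1 / x := by
  rw [integral_exp_mul_complex_Ioi (by simpa using hx)]
  simp [neg_div_neg_eq]

theorem integrableOn_exp_neg_mul {x : ℂ} (hx : 0 < x.re) :
    IntegrableOn (fun t : ℝ => Complex.exp (-x * t)) (Ioi 0) :=
  integrableOn_exp_mul_complex_Ioi (by simpa using hx) 0

theorem integral_one_sub_cos_mul_exp {x : ℂ} (hx : 0 < x.re) (c : ℝ) :
    ∫ t in Ioi (0 : ℝ), (1 - Real.cos (c * t) : ℂ) * Complex.exp (-x * t) =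
      c ^ 2 / (x * (x ^ 2 + c ^ 2)) := by
  have hp : 0 < (x - c * Complex.I).re := by simpa using hx
  have hm : 0 < (x + c * Complex.I).re := by simpa using hx
  have h0 : x ≠ 0 := by rintro rfl; simp at hx
  have hp0 : x - c * Complex.I ≠ 0 := by intro h; rw [h] at hp; simp at hp
  have hm0 : x + c * Complex.I ≠ 0 := by intro h; rw [h] at hm; simp at hm
  have h1 (t : ℝ) : (1 - Real.cos (c * t) : ℂ) * Complex.exp (-x * t) =
      Complex.exp (-x * t) - ((1 / 2) * Complex.exp (-(x - c * Complex.I) * t) +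
        (1 / 2) * Complex.exp (-(x + c * Complex.I) * t)) := by
    have e1 : Complex.exp (-(x - c * Complex.I) * t) =
        Complex.exp (-x * t) * Complex.exp ((c * t : ℂ) * Complex.I) := by
      rw [← Complex.exp_add]; ring_nf
    have e2 : Complex.exp (-(x + c * Complex.I) * t) =
        Complex.exp (-x * t) * Complex.exp (-(c * t : ℂ) * Complex.I) := by
      rw [← Complex.exp_add]; ring_nf
    rw [e1, e2]
    push_cast
    rw [Complex.cos]
    ring
  simp_rw [h1]
  have hadd : IntegrableOn (fun t : ℝ => (1 / 2) * Complex.exp (-(x - c * Complex.I) * t) +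
      (1 / 2) * Complex.exp (-(x + c * Complex.I) * t)) (Ioi 0) :=
    ((integrableOn_exp_neg_mul hp).const_mul _).add ((integrableOn_exp_neg_mul hm).const_mul _)
  rw [integral_sub (integrableOn_exp_neg_mul hx) hadd, integral_add
    ((integrableOn_exp_neg_mul hp).const_mul _) ((integrableOn_exp_neg_mul hm).const_mul _),
    integral_const_mul, integral_const_mul, integral_exp_neg_mul hx, integral_exp_neg_mul hp,
    integral_exp_neg_mul hm]
  have h2 : x ^ 2 + c ^ 2 = (x - c * Complex.I) * (x + c * Complex.I) := by
    ring_nf; simp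
  rw [h2]
  field_simp
  ring_nf
  simp

/-- Termwise integration of the Fourier series: the frequency `c` contributes `c² / (x (x² + c²))`,
and the weight `2 / c²` cancels the numerator. Exchanging this integral with a second Laplace
transform later produces Binet's function. -/
theorem binetKernel_eq_integral {x : ℂ} (hx : 0 < x.re) :
    binetKernel x = x * ∫ t in Ioi (0 : ℝ), sawSquare t * Complex.exp (-x * t) := by
  have h0 : x ≠ 0 := by rintro rfl; simp at hx
  set F : ℕ → ℝ → ℂ := fun k t =>
    2 / freqSq k * ((1 - Real.cos ((2 * Real.pi * (k + 1) : ℝ) * t) : ℂ) * Complex.exp (-x * t))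
    with hF
  have hb (k : ℕ) (t : ℝ) : ‖(1 - Real.cos ((2 * Real.pi * (k + 1) : ℝ) * t) : ℂ)‖ ≤ 2 := by
    rw [← Complex.ofReal_one, ← Complex.ofReal_sub, Complex.norm_real, Real.norm_eq_abs, abs_le]
    constructor <;> linarith [Real.cos_le_one ((2 * Real.pi * (k + 1) : ℝ) * t),
      Real.neg_one_le_cos ((2 * Real.pi * (k + 1) : ℝ) * t)]
  have hI := integrableOn_exp_neg_mul hx
  have hFi (k : ℕ) : IntegrableOn (F k) (Ioi 0) := by
    refine Integrable.const_mul ?_ _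
    exact hI.bdd_mul (c := 2) (Continuous.aestronglyMeasurable (by fun_prop))
      (Eventually.of_forall (hb k))
  have hs : Summable fun k => ∫ t in Ioi (0 : ℝ), ‖F k t‖ := by
    refine (summable_inv_freqSq.mul_right
      (4 * ∫ t in Ioi (0 : ℝ), ‖Complex.exp (-x * t)‖)).of_nonneg_of_le
      (fun k => integral_nonneg fun t => norm_nonneg _) fun k => ?_
    rw [← integral_const_mul, ← integral_const_mul]
    refine integral_mono (hFi k).norm ((hI.norm.const_mul _).const_mul _) fun t => ?_
    simp only [hF, norm_mul, norm_div, Complex.norm_real, Complex.norm_ofNat,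
      Real.norm_of_nonneg (freqSq_pos k).le]
    have := mul_le_mul_of_nonneg_right (hb k t) (norm_nonneg (Complex.exp (-x * t)))
    have h2 : 0 ≤ 2 / freqSq k := div_nonneg zero_le_two (freqSq_pos k).le
    refine (mul_le_mul_of_nonneg_left this h2).trans (le_of_eq ?_)
    field_simp [(freqSq_pos k).ne']
    ring
  have h1 := hasSum_integral_of_summable_integral_norm hFi hs
  have h2 (t : ℝ) : ∑' k, F k t = sawSquare t * Complex.exp (-x * t) := by
    have := (Complex.hasSum_ofReal.2 (hasSum_sawSquare t)).mul_right (Complex.exp (-x * t))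
    rw [← this.tsum_eq]
    refine tsum_congr fun k => ?_
    simp only [hF]
    push_cast
    ring
  simp_rw [h2] at h1
  rw [← (h1.mul_left x).tsum_eq, binetKernel]
  refine tsum_congr fun k => ?_
  rw [integral_const_mul, integral_one_sub_cos_mul_exp hx]
  have h3 : ((2 * Real.pi * (k + 1) : ℝ) : ℂ) ^ 2 = freqSq k := by
    rw [← Complex.ofReal_pow, freqSq]
  have h4 : (freqSq k : ℂ) ≠ 0 := by exact_mod_cast (freqSq_pos k).ne'
  rw [h3]
  -- This case cannot occur for `0 < x.re`, but division by zero makes both sides vanish, so it need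
  -- not be excluded.
  by_cases h5 : x ^ 2 + (freqSq k : ℂ) = 0
  · simp [h5]
  · field_simp

/-- The plane without the two cuts on the imaginary axis starting from `± 2 π i`. -/
def slitDomain : Set ℂ := {x | x.re ≠ 0 ∨ |x.im| < 2 * Real.pi}

theorem isOpen_slitDomain : IsOpen slitDomain := by
  refine IsOpen.union (isOpen_ne_fun Complex.continuous_re continuous_const) ?_
  exact isOpen_lt (continuous_abs.comp Complex.continuous_im) continuous_const

theorem isStar_slitDomain : IsStar slitDomain := by
  rintro x (hx | hx) t ht
  · rcases ht.1.eq_or_lt with h | h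
    · right; simp [← h, Real.pi_pos]
    · left; simpa using ⟨h.ne', hx⟩
  · right
    simp only [Complex.mul_im, Complex.ofReal_re, Complex.ofReal_im, zero_mul, add_zero, abs_mul,
      abs_of_nonneg ht.1]
    nlinarith [ht.1, ht.2, abs_nonneg x.im]

/-- Factor `x² + c²` into `(x - ic)(x + ic)`. If `c ≥ 2R`, each factor is at least `c / 2`;
otherwise `c` is bounded by `2R` and each factor is at least the distance `d` to the cuts. The bound
is uniform in `c`, which gives locally uniform convergence of the kernel. -/
theorem norm_sq_add_sq_ge {x : ℂ} {d R : ℝ} (hd : 0 < d) (hx : ball x d ⊆ slitDomain)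
    (hR : ‖x‖ ≤ R) {c : ℝ} (hc : 2 * Real.pi ≤ c) :
    (min (1 / 2) (d / (2 * R + 1))) ^ 2 * c ^ 2 ≤ ‖x ^ 2 + (c : ℂ) ^ 2‖ := by
  have hR0 : 0 ≤ R := (norm_nonneg x).trans hR
  have hc0 : 0 < c := by linarith [Real.pi_pos]
  have key (e : ℝ) (he : |e| = c) :
      min (1 / 2) (d / (2 * R + 1)) * c ≤ ‖x - e * Complex.I‖ := by
    have hm : (e * Complex.I : ℂ) ∉ slitDomain := by
      simp [slitDomain, he, hc]
    have h1 : d ≤ ‖x - e * Complex.I‖ := by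
      by_contra! h
      exact hm (hx (by rwa [mem_ball, dist_comm, dist_eq_norm]))
    have h2 : c - R ≤ ‖x - e * Complex.I‖ := by
      have := norm_sub_norm_le (e * Complex.I : ℂ) x
      rw [norm_sub_rev] at this
      simp [he] at this
      linarith
    rcases le_total (2 * R) c with h | h
    · refine (mul_le_mul_of_nonneg_right (min_le_left _ _) hc0.le).trans ?_
      linarith
    · refine (mul_le_mul_of_nonneg_right (min_le_right _ _) hc0.le).trans (le_trans ?_ h1)
      rw [div_mul_eq_mul_div, div_le_iff₀ (by positivity)]
      nlinarith
  have h2 : x ^ 2 + (c : ℂ) ^ 2 = (x - c * Complex.I) * (x - (-c : ℝ) * Complex.I) := by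
    push_cast; ring_nf; simp
  rw [h2, norm_mul]
  have := mul_le_mul (key c (abs_of_pos hc0)) (key (-c) (by rw [abs_neg, abs_of_pos hc0]))
    (by positivity) (norm_nonneg _)
  refine le_trans (le_of_eq ?_) this
  ring

theorem two_pi_le_freq (k : ℕ) : 2 * Real.pi ≤ 2 * Real.pi * (k + 1) :=
  le_mul_of_one_le_right (by positivity) (by linarith [(Nat.cast_nonneg k : (0 : ℝ) ≤ k)])

theorem differentiableOn_binetKernel : DifferentiableOn ℂ binetKernel slitDomain := by
  intro x₀ hx₀
  obtain ⟨r, hr, hrD⟩ := Metric.isOpen_iff.1 isOpen_slitDomain x₀ hx₀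
  have hr2 : 0 < r / 2 := by positivity
  set δ : ℝ := (min (1 / 2) (r / 2 / (2 * (‖x₀‖ + r) + 1))) ^ 2 with hδ
  have hδ0 : 0 < δ := by positivity
  have hlow (x : ℂ) (hx : x ∈ ball x₀ (r / 2)) (k : ℕ) :
      δ * freqSq k ≤ ‖x ^ 2 + (freqSq k : ℂ)‖ := by
    rw [mem_ball] at hx
    have h1 : ball x (r / 2) ⊆ slitDomain := fun y hy => hrD (by
      rw [mem_ball] at hy ⊢; linarith [dist_triangle y x x₀])
    have h2 : ‖x‖ ≤ ‖x₀‖ + r := by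
      have := norm_sub_norm_le x x₀
      rw [dist_eq_norm] at hx
      linarith
    have := norm_sq_add_sq_ge hr2 h1 h2 (two_pi_le_freq k)
    rw [← Complex.ofReal_pow] at this
    exact this
  have hne (x : ℂ) (hx : x ∈ ball x₀ (r / 2)) (k : ℕ) : x ^ 2 + (freqSq k : ℂ) ≠ 0 :=
    norm_pos_iff.1 ((mul_pos hδ0 (freqSq_pos k)).trans_le (hlow x hx k))
  have : DifferentiableOn ℂ binetKernel (ball x₀ (r / 2)) := by
    refine Complex.differentiableOn_tsum_of_summable_norm
      (summable_inv_freqSq.mul_left (2 / δ)) (fun k => ?_) isOpen_ball fun k x hx => ?_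
    · exact (differentiableOn_const _).div (by fun_prop) fun x hx => hne x hx k
    · rw [norm_div, Complex.norm_ofNat, ← div_eq_mul_inv, div_div]
      exact div_le_div_of_nonneg_left zero_le_two (mul_pos hδ0 (freqSq_pos k)) (hlow x hx k)
  exact (this.differentiableAt (ball_mem_nhds x₀ hr2)).differentiableWithinAt

theorem binetKernel_neg (x : ℂ) : binetKernel (-x) = binetKernel x := by
  simp [binetKernel]

theorem binetKernel_conj (x : ℂ) :
    binetKernel ((starRingEnd ℂ) x) = (starRingEnd ℂ) (binetKernel x) := by
  simp [binetKernel, Complex.conj_tsum, Complex.conj_ofNat]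

section

variable {c : ℂ}

/-- This identity serves twice: as a lower bound for the denominators along a ray, and, since `c / W
= c W̄ / |W|²`, as positivity of every term of `c B(cx)`. -/
theorem re_mul_conj_ray (c : ℂ) (x F : ℝ) :
    (c * (starRingEnd ℂ) ((c * x) ^ 2 + F)).re = c.re * (Complex.normSq c * x ^ 2 + F) := by
  simp [Complex.normSq_apply, pow_two]
  ring

theorem norm_ray_ge (hc : 0 < c.re) (x : ℝ) {F : ℝ} (_hF : 0 < F) :
    c.re / ‖c‖ * F ≤ ‖(c * x) ^ 2 + (F : ℂ)‖ := by
  have hc0 : 0 < ‖c‖ := hc.trans_le (Complex.re_le_norm c)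
  have h1 := Complex.re_le_norm (c * (starRingEnd ℂ) ((c * x) ^ 2 + F))
  rw [re_mul_conj_ray, norm_mul, Complex.norm_conj] at h1
  rw [div_mul_eq_mul_div, div_le_iff₀ hc0, mul_comm _ ‖c‖]
  refine le_trans ?_ h1
  have := mul_nonneg (Complex.normSq_nonneg c) (sq_nonneg x)
  nlinarith

theorem norm_ray_term_le (hc : 0 < c.re) (x : ℝ) (k : ℕ) :
    ‖(2 : ℂ) / ((c * x) ^ 2 + freqSq k)‖ ≤ 2 * ‖c‖ / c.re * (freqSq k)⁻¹ := by
  have hc0 : 0 < ‖c‖ := hc.trans_le (Complex.re_le_norm c)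
  rw [norm_div, Complex.norm_ofNat]
  refine (div_le_div_of_nonneg_left zero_le_two
    (mul_pos (div_pos hc hc0) (freqSq_pos k)) (norm_ray_ge hc x (freqSq_pos k))).trans (le_of_eq ?_)
  field_simp [(freqSq_pos k).ne']

theorem summable_ray (hc : 0 < c.re) (x : ℝ) :
    Summable fun k => (2 : ℂ) / ((c * x) ^ 2 + freqSq k) :=
  (summable_inv_freqSq.mul_left (2 * ‖c‖ / c.re)).of_norm_bounded (norm_ray_term_le hc x)

theorem exists_bound_binetKernel_ray (hc : 0 < c.re) :
    ∃ M, ∀ x : ℝ, ‖binetKernel (c * x)‖ ≤ M :=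
  ⟨_, fun x => tsum_of_norm_bounded (summable_inv_freqSq.mul_left (2 * ‖c‖ / c.re)).hasSum
    (norm_ray_term_le hc x)⟩

theorem re_binetKernel_ray_pos (hc : 0 < c.re) (x : ℝ) : 0 < (c * binetKernel (c * x)).re := by
  have h1 := ((summable_ray hc x).hasSum.mul_left c)
  have h2 := Complex.hasSum_re h1
  have hpos (k : ℕ) : 0 < (c * (2 / ((c * x) ^ 2 + (freqSq k : ℂ)))).re := by
    have hw : 0 < ‖(c * x) ^ 2 + (freqSq k : ℂ)‖ :=
      (mul_pos (div_pos hc (hc.trans_le (Complex.re_le_norm c))) (freqSq_pos k)).trans_le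
        (norm_ray_ge hc x (freqSq_pos k))
    have h3 : c * (2 / ((c * x) ^ 2 + (freqSq k : ℂ))) =
        ((2 / Complex.normSq ((c * x) ^ 2 + (freqSq k : ℂ)) : ℝ) : ℂ) *
          (c * (starRingEnd ℂ) ((c * x) ^ 2 + freqSq k)) := by
      rw [div_eq_mul_inv, Complex.inv_def]
      push_cast
      ring
    rw [h3, Complex.re_ofReal_mul, re_mul_conj_ray]
    have h4 : 0 < Complex.normSq ((c * x) ^ 2 + (freqSq k : ℂ)) := by
      rw [Complex.normSq_eq_norm_sq]; positivity
    have := mul_nonneg (Complex.normSq_nonneg c) (sq_nonneg x)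
    have := freqSq_pos k
    positivity
  rw [← tsum_mul_left] at h2
  rw [binetKernel, ← tsum_mul_left, ← h2.tsum_eq]
  exact h2.summable.tsum_pos (fun k => (hpos k).le) 0 (hpos 0)

end

/-! ### Analyticity, decay and difference equation of Binet's function -/

/-- Binet's function, the remainder in Stirling's formula for `log Γ`. -/
noncomputable def binet (v : ℂ) : ℂ := ∫ t in Ioi (0 : ℝ), sawSquare t / (v + t) ^ 2

/-- A locally uniform lower bound: for small `t` by the distance of `v₀` to the negative axis, for
large `t` by `t - ‖v₀‖`. It dominates the integrand of `binet` by a multiple of `(1 + t)⁻²`. -/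
theorem exists_norm_add_ge {v₀ : ℂ} (hv₀ : v₀ ∈ Complex.slitPlane) :
    ∃ r > 0, ∀ v ∈ ball v₀ r, ∀ t : ℝ, 0 ≤ t → r * (1 + t) ≤ ‖v + t‖ := by
  obtain ⟨d, hd, hd'⟩ : ∃ d > 0, ∀ t : ℝ, 0 ≤ t → d ≤ ‖v₀ + t‖ := by
    rcases hv₀ with h | h
    · refine ⟨v₀.re, h, fun t ht => ?_⟩
      have := Complex.re_le_norm (v₀ + t)
      simp at this
      linarith
    · refine ⟨|v₀.im|, abs_pos.2 h, fun t ht => ?_⟩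
      simpa using Complex.abs_im_le_norm (v₀ + t)
  set c : ℝ := min (1 / 2) (d / (2 * ‖v₀‖ + 2)) with hc
  have hc0 : 0 < c := by positivity
  have key (t : ℝ) (ht : 0 ≤ t) : c * (1 + t) ≤ ‖v₀ + t‖ := by
    rcases le_total (2 * ‖v₀‖ + 1) t with h | h
    · have h1 : t - ‖v₀‖ ≤ ‖v₀ + t‖ := by
        have := norm_sub_norm_le (t : ℂ) (-v₀)
        rw [norm_neg, Complex.norm_real, Real.norm_of_nonneg ht, sub_neg_eq_add, add_comm] at this
        exact this
      refine (mul_le_mul_of_nonneg_right (min_le_left _ _) (by linarith)).trans ?_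
      linarith
    · refine (mul_le_mul_of_nonneg_right (min_le_right _ _) (by linarith)).trans
        (le_trans ?_ (hd' t ht))
      rw [div_mul_eq_mul_div, div_le_iff₀ (by positivity)]
      nlinarith
  refine ⟨c / 2, by positivity, fun v hv t ht => ?_⟩
  have h1 := norm_sub_norm_le (v₀ + t) (v₀ - v)
  rw [mem_ball, dist_eq_norm, norm_sub_rev] at hv
  rw [show v₀ + t - (v₀ - v) = v + t by ring] at h1
  have := key t ht
  nlinarith

theorem add_mem_slitPlane {v : ℂ} (hv : v ∈ Complex.slitPlane) {t : ℝ} (ht : 0 ≤ t) :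
    v + t ∈ Complex.slitPlane := by
  rcases hv with h | h
  · left; simp; linarith
  · right; simpa using h

theorem integrableOn_inv_add_sq {b : ℝ} (hb : 0 < b) :
    IntegrableOn (fun t : ℝ => ((b + t) ^ 2)⁻¹) (Ioi 0) ∧
      ∫ t in Ioi (0 : ℝ), ((b + t) ^ 2)⁻¹ = b⁻¹ := by
  have hder (t : ℝ) (ht : t ∈ Ici (0 : ℝ)) :
      HasDerivAt (fun t : ℝ => -(b + t)⁻¹) (((b + t) ^ 2)⁻¹) t := by
    have hne : b + t ≠ 0 := by have := mem_Ici.1 ht; positivity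
    have := (((hasDerivAt_id t).const_add b).inv hne).neg
    convert! this using 1
    simp [neg_div]
  have hlim : Tendsto (fun t : ℝ => -(b + t)⁻¹) atTop (𝓝 0) := by
    rw [← neg_zero]
    exact (tendsto_inv_atTop_zero.comp (tendsto_atTop_add_const_left _ b tendsto_id)).neg
  have hnn (t : ℝ) (_ : t ∈ Ioi (0 : ℝ)) : 0 ≤ ((b + t) ^ 2)⁻¹ := by positivity
  refine ⟨integrableOn_Ioi_deriv_of_nonneg' hder hnn hlim, ?_⟩
  rw [integral_Ioi_of_hasDerivAt_of_nonneg' hder hnn hlim]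
  simp

theorem aestronglyMeasurable_binet (v : ℂ) (μ : Measure ℝ) :
    AEStronglyMeasurable (fun t : ℝ => (sawSquare t : ℂ) / (v + t) ^ 2) μ := by
  refine Measurable.aestronglyMeasurable ?_
  have := measurable_sawSquare
  fun_prop

theorem differentiableOn_binet : DifferentiableOn ℂ binet Complex.slitPlane := by
  intro v₀ hv₀
  obtain ⟨r, hr, hlow⟩ := exists_norm_add_ge hv₀
  refine (hasDerivAt_integral_of_differentiableOn hr
    (bound := fun t => (1 / 8) / r ^ 2 * ((1 + t) ^ 2)⁻¹)
    (fun z _ => aestronglyMeasurable_binet z _) ?_ ?_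
    ((integrableOn_inv_add_sq one_pos).1.const_mul _)).differentiableAt.differentiableWithinAt
  · filter_upwards [ae_restrict_mem measurableSet_Ioi] with t ht
    refine (differentiableOn_const _).div (by fun_prop) fun v hv => pow_ne_zero 2 ?_
    have : 0 < r * (1 + t) := mul_pos hr (by linarith [mem_Ioi.1 ht])
    exact norm_pos_iff.1 (this.trans_le (hlow v hv t ht.le))
  · filter_upwards [ae_restrict_mem measurableSet_Ioi] with t ht v hv
    have h0 : 0 < r * (1 + t) := mul_pos hr (by linarith [mem_Ioi.1 ht])
    rw [norm_div, norm_pow]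
    have h1 : (r * (1 + t)) ^ 2 ≤ ‖v + t‖ ^ 2 := by gcongr; exact hlow v hv t ht.le
    refine (div_le_div₀ (by norm_num) (norm_sawSquare_le t) (by positivity) h1).trans (le_of_eq ?_)
    rw [mul_pow]
    field_simp

theorem integrableOn_binet {v : ℂ} (hv : v ∈ Complex.slitPlane) :
    IntegrableOn (fun t : ℝ => (sawSquare t : ℂ) / (v + t) ^ 2) (Ioi 0) := by
  obtain ⟨r, hr, hlow⟩ := exists_norm_add_ge hv
  refine ((integrableOn_inv_add_sq one_pos).1.const_mul ((1 / 8) / r ^ 2)).mono'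
    (aestronglyMeasurable_binet v _) ?_
  filter_upwards [ae_restrict_mem measurableSet_Ioi] with t ht
  have h0 : 0 < r * (1 + t) := mul_pos hr (by linarith [mem_Ioi.1 ht])
  rw [norm_div, norm_pow]
  have h1 : (r * (1 + t)) ^ 2 ≤ ‖v + t‖ ^ 2 := by
    gcongr; exact hlow v (mem_ball_self hr) t ht.le
  refine (div_le_div₀ (by norm_num) (norm_sawSquare_le t) (by positivity) h1).trans (le_of_eq ?_)
  rw [mul_pow]
  field_simp

theorem norm_binet_le {v : ℂ} (hv : 0 ≤ v.re) (hv0 : v ≠ 0) : ‖binet v‖ ≤ 1 / (4 * ‖v‖) := by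
  have hn : 0 < ‖v‖ := norm_pos_iff.2 hv0
  have h1 : ‖binet v‖ ≤ ∫ t in Ioi (0 : ℝ), (1 / 4) * ((‖v‖ + t) ^ 2)⁻¹ := by
    refine norm_integral_le_of_norm_le ((integrableOn_inv_add_sq hn).1.const_mul _) ?_
    filter_upwards [ae_restrict_mem measurableSet_Ioi] with t ht
    have ht0 : 0 < t := ht
    -- In the closed right half plane the cross term `2 t Re v` is nonnegative, so `‖v + t‖² ≥ ‖v‖²
    -- + t²`.
    have h2 : (‖v‖ + t) ^ 2 / 2 ≤ ‖v + t‖ ^ 2 := by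
      have e1 : ‖v + t‖ ^ 2 = ‖v‖ ^ 2 + 2 * t * v.re + t ^ 2 := by
        rw [← Complex.normSq_eq_norm_sq, ← Complex.normSq_eq_norm_sq, Complex.normSq_apply,
          Complex.normSq_apply]
        simp
        ring
      have := mul_nonneg ht0.le hv
      nlinarith [sq_nonneg (‖v‖ - t)]
    rw [norm_div, norm_pow]
    refine (div_le_div₀ (by norm_num) (norm_sawSquare_le t) (by positivity) h2).trans (le_of_eq ?_)
    field_simp
    norm_num
  rw [integral_const_mul, (integrableOn_inv_add_sq hn).2] at h1
  refine h1.trans (le_of_eq ?_)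
  field_simp

theorem binet_conj (v : ℂ) : binet ((starRingEnd ℂ) v) = (starRingEnd ℂ) (binet v) := by
  rw [binet, binet, ← integral_conj]
  simp

/-- By periodicity of `sawSquare`, the shift `v ↦ v + 1` removes the integral over the unit
interval, where the integrand is rational. This is the functional equation of `Γ` in logarithmic
form. -/
theorem binet_sub_binet_add_one {v : ℂ} (hv : v ∈ Complex.slitPlane) :
    binet v - binet (v + 1) =
      (v + 1 / 2) * (Complex.log (v + 1) - Complex.log v) - 1 := by
  have hne (t : ℝ) (ht : 0 ≤ t) : v + t ≠ 0 := Complex.slitPlane_ne_zero (add_mem_slitPlane hv ht)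
  have h1 : binet (v + 1) = ∫ t in Ioi (1 : ℝ), (sawSquare t : ℂ) / (v + t) ^ 2 := by
    have := (measurePreserving_add_right volume (1 : ℝ)).setIntegral_preimage_emb
      (measurableEmbedding_addRight 1) (fun t : ℝ => (sawSquare t : ℂ) / (v + t) ^ 2) (Ioi 1)
    rw [← this, binet]
    simp only [preimage_add_const_Ioi, sub_self, sawSquare_add_one]
    push_cast
    simp only [add_assoc, add_comm (1 : ℂ)]
  rw [h1, binet, intervalIntegral.integral_Ioi_sub_Ioi (integrableOn_binet hv) zero_le_one]
  -- Partial fractions in powers of `v + t`, using `sawSquare t = t (1 - t) / 2` on the closed unit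
  -- interval.
  have h2 : ∫ t in (0 : ℝ)..1, (sawSquare t : ℂ) / (v + t) ^ 2 =
      ∫ t in (0 : ℝ)..1, (-(1 / 2) + (1 / 2 + v) / (v + t) - v * (1 + v) / (2 * (v + t) ^ 2)) := by
    refine intervalIntegral.integral_congr fun t ht => ?_
    rw [uIcc_of_le zero_le_one] at ht
    have hP : sawSquare t = t * (1 - t) / 2 := by
      rcases ht.2.eq_or_lt with h | h
      · simp [h, sawSquare]
      · rw [sawSquare, Int.fract_eq_self.2 ⟨ht.1, h⟩]
    have := hne t ht.1
    simp only [hP]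
    push_cast
    field_simp
    ring
  have hd (t : ℝ) (ht : t ∈ uIcc (0 : ℝ) 1) : HasDerivAt
      (fun t : ℝ => -(1 / 2) * (v + t) + (1 / 2 + v) * Complex.log (v + t) +
        v * (1 + v) / 2 * (v + t)⁻¹)
      (-(1 / 2) + (1 / 2 + v) / (v + t) - v * (1 + v) / (2 * (v + t) ^ 2)) t := by
    rw [uIcc_of_le zero_le_one] at ht
    have h0 : HasDerivAt (fun t : ℝ => v + (t : ℂ)) 1 t :=
      Complex.ofRealCLM.hasDerivAt.const_add v
    have e := ((h0.const_mul (-(1 / 2))).add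
      ((h0.clog_real (add_mem_slitPlane hv ht.1)).const_mul (1 / 2 + v))).add
      ((h0.inv (hne t ht.1)).const_mul (v * (1 + v) / 2))
    convert! e using 1
    have := hne t ht.1
    field_simp
    ring
  rw [h2, intervalIntegral.integral_eq_sub_of_hasDerivAt hd]
  · have h3 := hne 0 le_rfl
    have h4 := hne 1 zero_le_one
    push_cast at h3 h4 ⊢
    rw [add_zero] at h3 ⊢
    field_simp
    ring
  · refine ContinuousOn.intervalIntegrable ?_
    rw [uIcc_of_le zero_le_one]
    refine ContinuousOn.sub (continuousOn_const.add (continuousOn_const.div (by fun_prop)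
      fun t ht => hne t ht.1)) (continuousOn_const.div (by fun_prop) fun t ht => ?_)
    exact mul_ne_zero two_ne_zero (pow_ne_zero 2 (hne t ht.1))

/-! ### Stirling's formula with Binet's remainder -/

/-- Stirling's approximation of `Γ` with its remainder, up to the factor `√(2 π)`. -/
noncomputable def stirlingGamma (v : ℂ) : ℂ :=
  Complex.exp ((v - 1 / 2) * Complex.log v - v + binet v)

theorem stirlingGamma_add_one {v : ℂ} (hv : v ∈ Complex.slitPlane) :
    stirlingGamma (v + 1) = v * stirlingGamma v := by
  have h := binet_sub_binet_add_one hv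
  have h0 : v = Complex.exp (Complex.log v) := (Complex.exp_log (Complex.slitPlane_ne_zero hv)).symm
  rw [stirlingGamma, stirlingGamma]
  conv_rhs => rw [mul_comm]; rhs; rw [h0]
  rw [← Complex.exp_add]
  congr 1
  rw [show binet (v + 1) = binet v - ((v + 1 / 2) * (Complex.log (v + 1) - Complex.log v) - 1) by
    rw [← h]; ring]
  ring

theorem stirlingGamma_add_nat {v : ℂ} (hv : v ∈ Complex.slitPlane) (n : ℕ) :
    stirlingGamma (v + n) = (∏ j ∈ Finset.range n, (v + j)) * stirlingGamma v := by
  induction n with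
  | zero => simp
  | succ n ih =>
    have := stirlingGamma_add_one (add_mem_slitPlane hv (t := n) n.cast_nonneg)
    push_cast at this ⊢
    rw [← add_assoc, this, ih, Finset.prod_range_succ]
    ring

theorem stirlingGamma_nat (n : ℕ) :
    stirlingGamma (n + 1) = n.factorial * stirlingGamma 1 := by
  have := stirlingGamma_add_nat Complex.one_mem_slitPlane n
  rw [add_comm, this]
  congr 1
  rw [← Finset.prod_range_add_one_eq_factorial]
  push_cast
  exact Finset.prod_congr rfl fun j _ => add_comm _ _

theorem tendsto_binet_add_nat (v : ℂ) :
    Tendsto (fun n : ℕ => binet (v + n)) atTop (𝓝 0) := by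
  have h1 : Tendsto (fun n : ℕ => (n : ℝ) + v.re) atTop atTop :=
    tendsto_atTop_add_const_right _ _ tendsto_natCast_atTop_atTop
  have h2 : Tendsto (fun n : ℕ => 1 / (4 * ((n : ℝ) + v.re))) atTop (𝓝 0) := by
    refine tendsto_const_nhds.div_atTop (h1.const_mul_atTop (by norm_num))
  refine squeeze_zero_norm' ?_ h2
  filter_upwards [h1.eventually_gt_atTop 0] with n hn
  have h3 : (v + n).re = n + v.re := by simp [add_comm]
  have h4 := Complex.re_le_norm (v + n)
  have h5 : v + n ≠ 0 := by intro h; rw [h] at h3; simp at h3; linarith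
  refine (norm_binet_le (by rw [h3]; exact hn.le) h5).trans ?_
  rw [h3] at h4
  gcongr

theorem tendsto_stirlingGamma_ratio (v : ℂ) :
    Tendsto (fun n : ℕ => stirlingGamma (v + (n + 1 : ℕ)) /
      ((n : ℂ) ^ v * stirlingGamma (n + 1))) atTop (𝓝 1) := by
  -- Then `v + n + 1 = (n + 1)(1 + g n)`. In the logarithm of the ratio, `n log (1 + g n)` tends to
  -- `v` and cancels `-v`, while all other terms tend to zero.
  set g : ℕ → ℂ := fun n => v / (n + 1) with hg
  have hgm : Tendsto (fun n : ℕ => (n : ℂ) * g n) atTop (𝓝 v) := by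
    have h1 := (tendsto_natCast_div_add_atTop (𝕜 := ℂ) 1).const_mul v
    rw [mul_one] at h1
    refine h1.congr fun n => ?_
    simp only [hg]; ring
  have hg0 : Tendsto g atTop (𝓝 0) := by
    have := (tendsto_one_div_add_atTop_nhds_zero_nat (𝕜 := ℂ)).const_mul v
    rw [mul_zero] at this
    exact this.congr fun n => by simp only [hg]; ring
  have hlog := Complex.tendsto_nat_mul_log_one_add_of_tendsto hgm
  have hlog0 : Tendsto (fun n => Complex.log (1 + g n)) atTop (𝓝 0) := by
    have h1 : Tendsto (fun n => 1 + g n) atTop (𝓝 1) := by simpa using hg0.const_add 1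
    have := (continuousAt_clog Complex.one_mem_slitPlane).tendsto.comp h1
    simpa [Function.comp_def] using this
  have hlogn : Tendsto (fun n : ℕ => (Real.log (n + 1) - Real.log n : ℝ)) atTop (𝓝 0) := by
    have := Real.tendsto_log_nat_add_one_sub_log
    simpa using this
  have hE : Tendsto (fun n : ℕ => (n * Complex.log (1 + g n) + (v + 1 / 2) * Complex.log (1 + g n) +
      v * ((Real.log (n + 1) - Real.log n : ℝ) : ℂ) - v + binet (v + (n + 1 : ℕ)) -
        binet (1 + n))) atTop
      (𝓝 (v + (v + 1 / 2) * 0 + v * ((0 : ℝ) : ℂ) - v + 0 - 0)) := by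
    refine ((((hlog.add (hlog0.const_mul _)).add
      (((Complex.continuous_ofReal.tendsto 0).comp hlogn).const_mul v)).sub_const v).add ?_).sub
      (tendsto_binet_add_nat 1)
    exact (tendsto_add_atTop_iff_nat (f := fun n : ℕ => binet (v + n)) 1).2
      (tendsto_binet_add_nat v)
  have hE1 := (Complex.continuous_exp.tendsto _).comp hE
  rw [show v + (v + 1 / 2) * 0 + v * ((0 : ℝ) : ℂ) - v + 0 - 0 = 0 by simp, Complex.exp_zero] at hE1
  refine hE1.congr' ?_
  have hne : ∀ᶠ n in atTop, 1 + g n ≠ 0 := by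
    have h1 : Tendsto (fun n => 1 + g n) atTop (𝓝 1) := by simpa using hg0.const_add 1
    exact h1.eventually_ne one_ne_zero
  filter_upwards [hne, eventually_gt_atTop 0] with n hn hn0
  have hn1 : (0 : ℝ) < n + 1 := by positivity
  have hn2 : (n : ℂ) ≠ 0 := by exact_mod_cast hn0.ne'
  have hn3 : (n : ℂ) + 1 ≠ 0 := by exact_mod_cast hn1.ne'
  have e1 : v + (n + 1 : ℕ) = ((n + 1 : ℝ) : ℂ) * (1 + g n) := by
    simp only [hg]; push_cast; field_simp; ring
  have e2 : Complex.log (v + (n + 1 : ℕ)) = Real.log (n + 1) + Complex.log (1 + g n) := by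
    rw [e1, Complex.log_ofReal_mul hn1 hn]
  have e3 : Complex.log (n + 1) = Real.log (n + 1) := by
    rw [Complex.ofReal_log hn1.le]; push_cast; rfl
  have e4 : Complex.log n = Real.log n := by
    rw [Complex.ofReal_log n.cast_nonneg]; push_cast; rfl
  rw [stirlingGamma, stirlingGamma, Complex.cpow_def_of_ne_zero hn2, ← Complex.exp_add,
    ← Complex.exp_sub, Function.comp_apply, e2, e3, e4, add_comm (1 : ℂ) (n : ℂ)]
  congr 1
  push_cast
  ring

/-- Both sides satisfy the same functional equation. Solving it `n + 1` times expresses `GammaSeq v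
n` as the left side divided by the ratio of `tendsto_stirlingGamma_ratio`, which tends to `1`. -/
theorem Gamma_mul_stirlingGamma_one {v : ℂ} (hv : v ∈ Complex.slitPlane) :
    stirlingGamma v / stirlingGamma 1 = Complex.Gamma v := by
  refine tendsto_nhds_unique ?_ (Complex.GammaSeq_tendsto_Gamma v)
  have h1 := (tendsto_stirlingGamma_ratio v).const_mul (stirlingGamma v / stirlingGamma 1)
  have hs (w : ℂ) : stirlingGamma w ≠ 0 := Complex.exp_ne_zero _
  have hne (j : ℕ) : v + j ≠ 0 := by
    exact_mod_cast Complex.slitPlane_ne_zero (add_mem_slitPlane hv (t := j) j.cast_nonneg)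
  have h2 : Tendsto (fun n : ℕ => (stirlingGamma v / stirlingGamma 1) *
      (stirlingGamma (v + (n + 1 : ℕ)) / ((n : ℂ) ^ v * stirlingGamma (n + 1)))⁻¹)
      atTop (𝓝 (stirlingGamma v / stirlingGamma 1)) := by
    simpa using ((tendsto_stirlingGamma_ratio v).inv₀ one_ne_zero).const_mul
      (stirlingGamma v / stirlingGamma 1)
  refine h2.congr fun n => ?_
  have hp : ∏ j ∈ Finset.range (n + 1), (v + j) ≠ 0 := Finset.prod_ne_zero_iff.2 fun j _ => hne j
  rw [stirlingGamma_add_nat hv, stirlingGamma_nat, Complex.GammaSeq]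
  field_simp [hs v, hs 1]

/-- The constant is fixed at the integers: `Stirling.stirlingSeq` tends to `√π`, and by the
functional equation it equals `exp (binet n)` divided by `√2 * stirlingGamma 1`. -/
theorem stirlingGamma_one : stirlingGamma 1 = ((Real.sqrt (2 * Real.pi) : ℝ) : ℂ)⁻¹ := by
  have hs : stirlingGamma 1 ≠ 0 := Complex.exp_ne_zero _
  have h1 : Tendsto (fun n : ℕ => (Stirling.stirlingSeq n : ℂ)) atTop (𝓝 (Real.sqrt Real.pi)) :=
    (Complex.continuous_ofReal.tendsto _).comp Stirling.tendsto_stirlingSeq_sqrt_pi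
  have h2 : Tendsto (fun n : ℕ => Complex.exp (binet (0 + n)) / (Real.sqrt 2 * stirlingGamma 1))
      atTop (𝓝 (Complex.exp 0 / (Real.sqrt 2 * stirlingGamma 1))) :=
    ((Complex.continuous_exp.tendsto 0).comp (tendsto_binet_add_nat 0)).div_const _
  have h3 : ∀ᶠ n : ℕ in atTop, Complex.exp (binet (0 + n)) / (Real.sqrt 2 * stirlingGamma 1) =
      (Stirling.stirlingSeq n : ℂ) := by
    filter_upwards [eventually_gt_atTop 0] with n hn
    have hn0 : (0 : ℝ) < n := by exact_mod_cast hn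
    have e4 : Complex.log n = Real.log n := by
      rw [Complex.ofReal_log n.cast_nonneg]; push_cast; rfl
    have hf : (n.factorial : ℂ) = n * stirlingGamma n / stirlingGamma 1 := by
      rw [eq_div_iff hs, ← stirlingGamma_nat, stirlingGamma_add_one]
      left; simpa using hn
    have e5 : (((n / Real.exp 1) ^ n : ℝ) : ℂ) =
        Complex.exp ((n : ℂ) * (Real.log n : ℂ) - n) := by
      rw [Complex.exp_sub, mul_comm (n : ℂ), ← Complex.ofReal_natCast, ← Complex.ofReal_mul,
        ← Complex.ofReal_exp, ← Complex.ofReal_exp, ← Complex.ofReal_div, div_pow,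
        Real.exp_one_pow, mul_comm, Real.exp_nat_mul, Real.exp_log hn0]
    have e6 : (n : ℂ) = Complex.exp ((1 / 2 : ℂ) * Real.log n) * (Real.sqrt n : ℂ) := by
      have : Real.sqrt n = Real.exp (1 / 2 * Real.log n) := by
        rw [one_div_mul_eq_div, ← Real.log_sqrt hn0.le, Real.exp_log (Real.sqrt_pos.2 hn0)]
      have h7 : (1 / 2 : ℂ) * Real.log n = ((1 / 2 * Real.log n : ℝ) : ℂ) := by push_cast; rfl
      rw [h7, ← Complex.ofReal_exp, ← this, ← Complex.ofReal_mul, Real.mul_self_sqrt hn0.le]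
      simp
    have hsq : (Real.sqrt n : ℂ) ≠ 0 := by exact_mod_cast (Real.sqrt_pos.2 hn0).ne'
    have hs2 : (Real.sqrt 2 : ℂ) ≠ 0 := by exact_mod_cast (Real.sqrt_pos.2 two_pos).ne'
    rw [Stirling.stirlingSeq, Complex.ofReal_div, Complex.ofReal_mul, e5, Complex.ofReal_natCast, hf,
      Real.sqrt_mul zero_le_two, Complex.ofReal_mul]
    conv_rhs => lhs; lhs; lhs; rw [e6]
    have e8 : stirlingGamma n =
        Complex.exp ((n - 1 / 2 : ℂ) * Real.log n - n + binet n) := by rw [stirlingGamma, e4]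
    rw [e8, zero_add]
    have e7 : (n - 1 / 2 : ℂ) * Real.log n - n + binet n =
        ((n : ℂ) * Real.log n - n) + (binet n - (1 / 2 : ℂ) * Real.log n) := by ring
    rw [e7, Complex.exp_add _ (binet n - _), Complex.exp_sub (binet n)]
    field_simp [Complex.exp_ne_zero]
  have h4 := tendsto_nhds_unique (h2.congr' h3) h1
  have hs2 : (Real.sqrt 2 : ℂ) ≠ 0 := by exact_mod_cast (Real.sqrt_pos.2 two_pos).ne'
  rw [Complex.exp_zero, div_eq_iff (mul_ne_zero hs2 hs)] at h4
  rw [Real.sqrt_mul zero_le_two, Complex.ofReal_mul]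
  refine eq_inv_of_mul_eq_one_right ?_
  linear_combination -h4

/-- Stirling's formula with Binet's remainder. -/
theorem Gamma_eq_stirling {v : ℂ} (hv : v ∈ Complex.slitPlane) :
    Complex.Gamma v = Real.sqrt (2 * Real.pi) *
      Complex.exp ((v - 1 / 2) * Complex.log v - v + binet v) := by
  rw [← Gamma_mul_stirlingGamma_one hv, stirlingGamma_one, div_inv_eq_mul, mul_comm, stirlingGamma]

/-! ### Reflection formula and Laplace representation of Binet's function -/

theorem neg_mem_slitPlane_of_im_ne_zero {v : ℂ} (hv : v.im ≠ 0) : -v ∈ Complex.slitPlane := by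
  right; simpa using hv

/-- The reflection formula for Binet's function. -/
theorem exp_binet_mul_exp_binet_neg {v : ℂ} (hv : 0 < v.im) :
    Complex.exp (binet v) * Complex.exp (binet (-v)) *
      (1 - Complex.exp (2 * Real.pi * Complex.I * v)) = 1 := by
  have hv0 : v ≠ 0 := by rintro rfl; simp at hv
  have hpi : (Real.pi : ℂ) ≠ 0 := by exact_mod_cast Real.pi_ne_zero
  -- The branch jump of the logarithm, for `v` in the upper half plane, decides that `exp (2πiv)`
  -- and not its inverse appears.
  have hlog : Complex.log (-v) = Complex.log v - Real.pi * Complex.I := by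
    rw [Complex.log, Complex.log, norm_neg, Complex.arg_neg_eq_arg_sub_pi_of_im_pos hv]
    push_cast; ring
  have h1 := Gamma_eq_stirling (v := v) (Or.inr hv.ne')
  have h2 := Gamma_eq_stirling (neg_mem_slitPlane_of_im_ne_zero hv.ne')
  have h3 := Complex.Gamma_mul_Gamma_one_sub v
  have h4 : Complex.Gamma (1 - v) = -v * Complex.Gamma (-v) := by
    rw [sub_eq_neg_add]
    exact Complex.Gamma_add_one _ (neg_ne_zero.2 hv0)
  have hq : Complex.exp (2 * Real.pi * Complex.I * v) ≠ 1 := by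
    intro h
    have := congrArg norm h
    rw [Complex.norm_exp, norm_one, Real.exp_eq_one_iff] at this
    simp [Real.pi_ne_zero] at this
    exact hv.ne' this
  have hsq : ((Real.sqrt (2 * Real.pi) : ℝ) : ℂ) * (Real.sqrt (2 * Real.pi) : ℝ) = 2 * Real.pi := by
    rw [← Complex.ofReal_mul, Real.mul_self_sqrt (by positivity)]; push_cast; rfl
  have hs2 : Complex.sin (Real.pi * v) = Complex.exp (-(Real.pi * v * Complex.I)) *
      (1 - Complex.exp (2 * Real.pi * Complex.I * v)) * Complex.I / 2 := by
    rw [Complex.sin, mul_sub, ← Complex.exp_add]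
    ring_nf
  have hs : Complex.sin (Real.pi * v) ≠ 0 := by
    rw [hs2]
    exact div_ne_zero (mul_ne_zero (mul_ne_zero (Complex.exp_ne_zero _)
      (sub_ne_zero.2 hq.symm)) Complex.I_ne_zero) two_ne_zero
  -- The Stirling exponents add up to `-log v + πiv + πi/2`, besides the two Binet terms.
  have h5 : Complex.exp ((v - 1 / 2) * Complex.log v - v + binet v) *
      Complex.exp ((-v - 1 / 2) * Complex.log (-v) - -v + binet (-v)) =
      Complex.exp (binet v) * Complex.exp (binet (-v)) * (Complex.exp (Real.pi * v * Complex.I) *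
        Complex.I / v) := by
    have hI : Complex.exp ((1 / 2) * (Real.pi * Complex.I)) = Complex.I := by
      rw [show (1 / 2 : ℂ) * (Real.pi * Complex.I) = Real.pi / 2 * Complex.I by ring,
        Complex.exp_pi_div_two_mul_I]
    have hlv : (Complex.exp (Complex.log v))⁻¹ = v⁻¹ := by rw [Complex.exp_log hv0]
    rw [div_eq_mul_inv _ v, ← hlv, ← Complex.exp_neg]
    have hI2 (X : ℂ) : X * Complex.I = X * Complex.exp ((1 / 2) * (Real.pi * Complex.I)) := by rw [hI]
    rw [hI2 (Complex.exp _)]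
    simp only [← Complex.exp_add, hlog]
    congr 1
    ring
  rw [h4, h1, h2] at h3
  have h6 : -v * (2 * Real.pi) * (Complex.exp (binet v) * Complex.exp (binet (-v)) *
      (Complex.exp (Real.pi * v * Complex.I) * Complex.I / v)) =
      Real.pi / Complex.sin (Real.pi * v) := by
    rw [← h3, ← h5, ← hsq]; ring
  rw [eq_div_iff hs, hs2] at h6
  have hee : Complex.exp (Real.pi * v * Complex.I) * Complex.exp (-(Real.pi * v * Complex.I)) = 1 := by
    rw [← Complex.exp_add]; simp
  have h7 : Real.pi * (Complex.exp (binet v) * Complex.exp (binet (-v)) *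
      (1 - Complex.exp (2 * Real.pi * Complex.I * v))) *
      (Complex.exp (Real.pi * v * Complex.I) * Complex.exp (-(Real.pi * v * Complex.I))) = Real.pi := by
    conv_rhs => rw [← h6]
    field_simp
    rw [Complex.I_sq]; ring
  rw [hee, mul_one] at h7
  exact mul_left_cancel₀ hpi (h7.trans (mul_one _).symm)

/-- The function `x` is the convolution square of the constant `1`, whose transform is `1 / a`. -/
theorem integral_mul_exp_neg_mul {a : ℂ} (ha : 0 < a.re) :
    ∫ x in Ioi (0 : ℝ), (x : ℂ) * Complex.exp (-a * x) = 1 / a ^ 2 := by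
  have hint : IntegrableOn (laplaceIntegrand (fun _ => 1) a) (Ioi 0) := by
    simpa [laplaceIntegrand, IntegrableOn, funext_iff] using
      (integrableOn_exp_neg_mul ha).congr_fun (g := laplaceIntegrand (fun _ => 1) a)
        (fun x _ => by simp [laplaceIntegrand]) measurableSet_Ioi
  have h1 : laplace (fun _ => 1) a = 1 / a := by
    simpa [laplace, laplaceIntegrand] using integral_exp_neg_mul ha
  have h := laplace_rayConv hint hint
  have h2 : rayConv (fun _ => 1) (fun _ => 1) = fun z => z := by
    ext z
    simp [rayConv]
  rw [h1, h2] at h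
  rw [laplace] at h
  simp only [laplaceIntegrand] at h
  rw [h]
  ring

/-- The Laplace transform of the Borel transform along any ray in the right half plane. -/
theorem laplace_binetKernel {c ρ : ℂ} (hc : 0 < c.re) (hρ : 0 < ρ.re) :
    laplace (fun z => c * binetKernel (c * z)) ρ = binet (ρ / c) := by
  have hc0 : c ≠ 0 := by rintro rfl; simp at hc
  set F : ℝ → ℝ → ℂ := fun x t => c ^ 2 * sawSquare t * (x * Complex.exp (-(c * t + ρ) * x)) with hF
  have hre (t : ℝ) : (c * t + ρ).re = c.re * t + ρ.re := by simp
  have hpos (t : ℝ) (ht : 0 < t) : 0 < (c * t + ρ).re := by rw [hre]; positivity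
  have h1 : EqOn (laplaceIntegrand (fun z => c * binetKernel (c * z)) ρ)
      (fun x => ∫ t in Ioi (0 : ℝ), F x t) (Ioi 0) := by
    intro x hx
    have hx0 : 0 < x := hx
    simp only [laplaceIntegrand]
    rw [binetKernel_eq_integral (by simpa using mul_pos hc hx0), ← mul_assoc, ← integral_const_mul,
      ← integral_mul_const]
    refine integral_congr_ae (Eventually.of_forall fun t => ?_)
    simp only [hF]
    have : Complex.exp (-(c * t + ρ) * x) =
        Complex.exp (-(c * x) * t) * Complex.exp (-ρ * x) := by
      rw [← Complex.exp_add]; ring_nf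
    rw [this]
    ring
  have hn (t : ℝ) (x : ℝ) : ‖F x t‖ =
      ‖c‖ ^ 2 * sawSquare t * (|x| * Real.exp (-(c.re * t + ρ.re) * x)) := by
    simp only [hF, norm_mul, norm_pow, Complex.norm_real, Real.norm_eq_abs,
      abs_of_nonneg (sawSquare_nonneg t), Complex.norm_exp]
    simp
  have hint2 (t : ℝ) (ht : 0 < t) :
      IntegrableOn (fun x : ℝ => |x| * Real.exp (-(c.re * t + ρ.re) * x)) (Ioi 0) := by
    have := integrableOn_pow_mul_exp_neg 1 (β := c.re * t + ρ.re) (by positivity)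
    refine this.congr_fun (fun x hx => ?_) measurableSet_Ioi
    simp [abs_of_pos (mem_Ioi.1 hx)]
  have hmeas : Measurable (Function.uncurry F) := by
    have := measurable_sawSquare
    simp only [hF, Function.uncurry_def]
    fun_prop
  -- Fubini: integrating the norm in `x` first leaves a multiple of `sawSquare t / (Re c * t + Re
  -- ρ)²`, which is integrable in `t`.
  have hFi : Integrable (Function.uncurry F)
      ((volume.restrict (Ioi (0 : ℝ))).prod (volume.restrict (Ioi (0 : ℝ)))) := by
    rw [integrable_prod_iff' hmeas.aestronglyMeasurable]
    constructor
    · filter_upwards [ae_restrict_mem measurableSet_Ioi] with t ht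
      refine (integrable_norm_iff (hmeas.comp
        (measurable_prodMk_right (y := t))).aestronglyMeasurable).1 ?_
      simp only [Function.comp_apply]
      simp only [Function.uncurry_apply_pair, hn]
      exact (hint2 t ht).const_mul _
    · have hb := (integrableOn_inv_add_sq (div_pos hρ hc)).1.const_mul (‖c‖ ^ 2 / c.re ^ 2)
      refine hb.mono' ?_ ?_
      · exact (hmeas.aestronglyMeasurable (μ := ((volume.restrict (Ioi (0 : ℝ))).prod
          (volume.restrict (Ioi (0 : ℝ)))))).norm.prod_swap.integral_prod_right'
      · filter_upwards [ae_restrict_mem measurableSet_Ioi] with t ht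
        have ht0 : 0 < t := ht
        have hb0 : 0 < c.re * t + ρ.re := by positivity
        simp only [Function.uncurry_apply_pair, hn]
        rw [integral_const_mul, setIntegral_congr_fun measurableSet_Ioi
          (g := fun x : ℝ => x ^ 1 * Real.exp (-(c.re * t + ρ.re) * x)) (fun x hx => by
            simp [abs_of_pos (mem_Ioi.1 hx)]), integral_pow_mul_exp_neg 1 hb0]
        have hs0 := sawSquare_nonneg t
        rw [Real.norm_of_nonneg (by positivity)]
        have e1 : (ρ.re / c.re + t) = (c.re * t + ρ.re) / c.re := by field_simp; ring
        rw [e1, div_pow, inv_div]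
        have : sawSquare t ≤ 1 := (sawSquare_le t).trans (by norm_num)
        simp only [Nat.factorial_one, Nat.cast_one]
        have h9 : ‖c‖ ^ 2 / c.re ^ 2 * (c.re ^ 2 / (c.re * t + ρ.re) ^ 2) =
          ‖c‖ ^ 2 * 1 * (1 / (c.re * t + ρ.re) ^ (1 + 1)) := by field_simp
        rw [h9]
        gcongr
  rw [laplace, setIntegral_congr_fun measurableSet_Ioi h1, integral_integral_swap hFi, binet]
  refine setIntegral_congr_fun measurableSet_Ioi fun t ht => ?_
  simp only [hF]
  rw [integral_const_mul, integral_mul_exp_neg_mul (hpos t ht)]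
  have h0 : c * t + ρ ≠ 0 := by
    intro h; have := hpos t ht; rw [h] at this; simp at this
  have e1 : ρ / c + t = (c * t + ρ) / c := by field_simp; ring
  rw [e1]
  field_simp

/-! ### The convolution exponential of the Binet kernel -/

/-- The Borel transform of `exp (κ J) - 1`, where `J` is Binet's function. -/
noncomputable def borel (κ : ℤ) : ℂ → ℂ := convExp fun x => κ * binetKernel x

theorem differentiableOn_borel (κ : ℤ) : DifferentiableOn ℂ (borel κ) slitDomain :=
  differentiableOn_convExp isOpen_slitDomain isStar_slitDomain
    (differentiableOn_binetKernel.const_mul _)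

theorem borel_neg (κ : ℤ) (x : ℂ) : borel (-κ) x = -borel κ (-x) :=
  convExp_neg_of_even (fun z => by simp [binetKernel_neg]) x

theorem borel_conj (κ : ℤ) (x : ℂ) :
    borel κ ((starRingEnd ℂ) x) = (starRingEnd ℂ) (borel κ x) :=
  convExp_conj (fun z => by simp [binetKernel_conj]) x

theorem isOpen_ray_slitDomain (c : ℂ) : IsOpen {z | c * z ∈ slitDomain} :=
  isOpen_slitDomain.preimage (continuous_const_mul c)

theorem isStar_ray_slitDomain (c : ℂ) : IsStar {z | c * z ∈ slitDomain} := fun z hz t ht => by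
  have := isStar_slitDomain (c * z) hz t ht
  rwa [mul_left_comm] at this

theorem ofReal_mem_ray_slitDomain {c : ℂ} (hc : 0 < c.re) (x : ℝ) (hx : 0 ≤ x) :
    (x : ℂ) ∈ {z | c * z ∈ slitDomain} := by
  rcases hx.eq_or_lt with h | h
  · right; simp [← h, Real.pi_pos]
  · left; simpa using ⟨hc.ne', h.ne'⟩

theorem differentiableOn_ray {f : ℂ → ℂ} (hf : DifferentiableOn ℂ f slitDomain) (c : ℂ) :
    DifferentiableOn ℂ (fun z => c * f (c * z)) {z | c * z ∈ slitDomain} :=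
  (hf.comp (f := fun z => c * z) (by fun_prop) fun _ hz => hz).const_mul c

theorem borel_ray (κ : ℤ) (c z : ℂ) :
    c * borel κ (c * z) = convExp (fun z => κ * (c * binetKernel (c * z))) z := by
  rw [borel, ← convExp_scale]
  congr 1
  ext z
  ring

theorem laplace_borel_ray (κ : ℤ) {c ρ : ℂ} (hc : 0 < c.re) (hρ : 0 < ρ.re) :
    IntegrableOn (laplaceIntegrand (fun z => c * borel κ (c * z)) ρ) (Ioi 0) ∧
      laplace (fun z => c * borel κ (c * z)) ρ = Complex.exp (κ * binet (ρ / c)) - 1 := by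
  obtain ⟨M, hM⟩ := exists_bound_binetKernel_ray hc
  have hb : DifferentiableOn ℂ (fun z => (κ : ℂ) * (c * binetKernel (c * z)))
      {z | c * z ∈ slitDomain} := (differentiableOn_ray differentiableOn_binetKernel c).const_mul _
  have hM' (x : ℝ) (_ : 0 ≤ x) :
      ‖(κ : ℂ) * (c * binetKernel (c * x))‖ ≤ ‖(κ : ℂ)‖ * (‖c‖ * M) := by
    rw [norm_mul, norm_mul]
    gcongr
    exact hM x
  simp only [borel_ray]
  refine ⟨(laplaceIntegrand_convExp_hasSum (isOpen_ray_slitDomain c) (isStar_ray_slitDomain c)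
    (ofReal_mem_ray_slitDomain hc) hb hM' hρ).2, ?_⟩
  rw [laplace_convExp (isOpen_ray_slitDomain c) (isStar_ray_slitDomain c)
    (ofReal_mem_ray_slitDomain hc) hb hM' hρ]
  have : laplace (fun z => (κ : ℂ) * (c * binetKernel (c * z))) ρ = κ * binet (ρ / c) := by
    rw [← laplace_binetKernel hc hρ, laplace, laplace, ← integral_const_mul]
    refine integral_congr_ae (Eventually.of_forall fun x => ?_)
    simp only [laplaceIntegrand]
    ring
  rw [this]

theorem laplace_borel (κ : ℤ) {ρ : ℂ} (hρ : 0 < ρ.re) :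
    IntegrableOn (laplaceIntegrand (borel κ) ρ) (Ioi 0) ∧
      laplace (borel κ) ρ = Complex.exp (κ * binet ρ) - 1 := by
  simpa using laplace_borel_ray κ (c := 1) (by simp) hρ

/-! ### Bounds for `exp (κ J) - 1` -/

/-- The function `exp (κ J) - 1`. -/
noncomputable def expBinet (κ : ℤ) (v : ℂ) : ℂ := Complex.exp (κ * binet v) - 1

theorem differentiableOn_expBinet (κ : ℤ) : DifferentiableOn ℂ (expBinet κ) Complex.slitPlane :=
  ((differentiableOn_binet.const_mul _).cexp).sub_const _

theorem expBinet_conj (κ : ℤ) (v : ℂ) :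
    expBinet κ ((starRingEnd ℂ) v) = (starRingEnd ℂ) (expBinet κ v) := by
  simp [expBinet, binet_conj, ← Complex.exp_conj]

theorem exists_norm_expBinet_le (κ : ℤ) :
    ∃ C, 0 ≤ C ∧ ∀ v : ℂ, 0 ≤ v.re → 1 ≤ ‖v‖ → ‖expBinet κ v‖ ≤ C / ‖v‖ := by
  refine ⟨‖(κ : ℂ)‖ * Real.exp ‖(κ : ℂ)‖, by positivity, fun v hv hv1 => ?_⟩
  have hv0 : 0 < ‖v‖ := by linarith
  have h1 : ‖(κ : ℂ) * binet v‖ ≤ ‖(κ : ℂ)‖ / ‖v‖ := by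
    rw [norm_mul, div_eq_mul_inv]
    gcongr
    refine (norm_binet_le hv (norm_pos_iff.1 hv0)).trans ?_
    rw [one_div]
    gcongr
    linarith
  have h2 : ‖(κ : ℂ)‖ / ‖v‖ ≤ ‖(κ : ℂ)‖ := div_le_self (norm_nonneg _) hv1
  have h3 := Complex.norm_exp_sub_sum_le_norm_mul_exp (κ * binet v) 1
  simp only [Finset.range_one, Finset.sum_singleton, pow_zero, Nat.factorial_zero, Nat.cast_one,
    div_one, pow_one] at h3
  refine h3.trans ?_
  rw [mul_div_right_comm]
  exact mul_le_mul h1 (Real.exp_le_exp.2 (h1.trans h2)) (Real.exp_pos _).le (by positivity)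

/-- The reflection formula raised to the power `κ`. It carries the left half plane, where no decay
of `J` is known yet, to the right one; the factor `(1 - q) ^ (-κ)` is the origin of all poles of
`borel κ`. -/
theorem exp_binet_reflect (κ : ℤ) {v : ℂ} (hv : 0 < v.im) :
    Complex.exp (κ * binet v) = Complex.exp ((-κ : ℤ) * binet (-v)) *
      (1 - Complex.exp (2 * Real.pi * Complex.I * v)) ^ (-κ) := by
  have h := exp_binet_mul_exp_binet_neg hv
  have h1 : Complex.exp (binet v) = (Complex.exp (binet (-v)) *
      (1 - Complex.exp (2 * Real.pi * Complex.I * v)))⁻¹ := by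
    refine eq_inv_of_mul_eq_one_left ?_
    rw [← mul_assoc, h]
  rw [Complex.exp_int_mul, Complex.exp_int_mul, h1, inv_zpow', mul_zpow]

theorem exists_norm_one_sub_zpow_le (κ : ℤ) :
    ∃ C, 0 ≤ C ∧ ∀ w : ℂ, ‖w‖ ≤ 1 / 2 → ‖(1 - w) ^ κ - 1‖ ≤ C * ‖w‖ := by
  have hne (w : ℂ) (hw : ‖w‖ < 1) : 1 - w ≠ 0 := by
    intro h
    rw [← sub_eq_zero.1 h] at hw
    simp at hw
  have hd : DifferentiableOn ℂ (fun w : ℂ => (1 - w) ^ κ) (ball 0 1) := fun w hw =>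
    (((differentiableAt_const _).sub differentiableAt_id).zpow
      (Or.inl (hne w (by simpa using hw)))).differentiableWithinAt
  have hsub : closedBall (0 : ℂ) (1 / 2) ⊆ ball 0 1 := closedBall_subset_ball (by norm_num)
  obtain ⟨C, hC⟩ := (isCompact_closedBall (0 : ℂ) (1 / 2)).exists_bound_of_continuousOn
    ((hd.deriv isOpen_ball).continuousOn.mono hsub)
  refine ⟨C, (norm_nonneg _).trans (hC 0 (by simp)), fun w hw => ?_⟩
  have := (convex_closedBall (0 : ℂ) (1 / 2)).norm_image_sub_le_of_norm_deriv_le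
    (fun x hx => hd.differentiableAt (isOpen_ball.mem_nhds (hsub hx))) hC
    (by simp : (0 : ℂ) ∈ _) (by simpa using hw : w ∈ _)
  simpa using this

theorem norm_exp_two_pi_I_mul (v : ℂ) :
    ‖Complex.exp (2 * Real.pi * Complex.I * v)‖ = Real.exp (-(2 * Real.pi * v.im)) := by
  rw [Complex.norm_exp]
  simp

theorem exp_neg_two_pi_mul_le {y : ℝ} (hy : 1 ≤ y) : Real.exp (-(2 * Real.pi * y)) ≤ 1 / (2 * y) := by
  rw [Real.exp_neg, one_div]
  have h1 := Real.add_one_le_exp (2 * Real.pi * y)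
  have h2 := Real.pi_gt_three
  refine inv_anti₀ (by linarith) ?_
  nlinarith

/-- On the right this is the decay of `J`. On the left the reflection formula applies, and `‖q‖ =
exp (-2π Im v)` is itself `O(1 / Im v)`. The bound allows contours to be moved to the left above the
real axis. -/
theorem exists_norm_expBinet_le_im (κ : ℤ) :
    ∃ C, 0 ≤ C ∧ ∀ v : ℂ, 1 ≤ v.im → ‖expBinet κ v‖ ≤ C / v.im := by
  obtain ⟨C₁, hC₁0, hC₁⟩ := exists_norm_expBinet_le κ
  obtain ⟨C₂, hC₂0, hC₂⟩ := exists_norm_expBinet_le (-κ)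
  obtain ⟨C₃, hC₃0, hC₃⟩ := exists_norm_one_sub_zpow_le (-κ)
  refine ⟨C₁ + (C₂ * (1 + C₃) + C₃), by positivity, fun v hv => ?_⟩
  have hv0 : 0 < v.im := by linarith
  have hvn : v.im ≤ ‖v‖ := (le_abs_self _).trans (Complex.abs_im_le_norm v)
  rcases le_total 0 v.re with h | h
  · refine (hC₁ v h (hv.trans hvn)).trans ?_
    gcongr
    linarith [mul_nonneg hC₂0 (add_nonneg zero_le_one hC₃0)]
  · set q := Complex.exp (2 * Real.pi * Complex.I * v) with hq
    have hq1 : ‖q‖ ≤ 1 / (2 * v.im) := by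
      rw [hq, norm_exp_two_pi_I_mul]
      exact exp_neg_two_pi_mul_le hv
    have hq3 : ‖q‖ ≤ 1 / v.im := hq1.trans (by gcongr; linarith)
    have hq2 : ‖q‖ ≤ 1 / 2 := hq1.trans (by gcongr; linarith)
    have e1 : expBinet κ v = expBinet (-κ) (-v) * (1 + ((1 - q) ^ (-κ) - 1)) +
        ((1 - q) ^ (-κ) - 1) := by
      rw [expBinet, exp_binet_reflect κ hv0, expBinet]
      ring
    have h2 : ‖expBinet (-κ) (-v)‖ ≤ C₂ / v.im := by
      refine (hC₂ (-v) (by simpa using h) (by simpa using hv.trans hvn)).trans ?_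
      rw [norm_neg]
      gcongr
    have h3 : ‖(1 - q) ^ (-κ) - 1‖ ≤ C₃ / v.im := by
      refine (hC₃ q hq2).trans ?_
      rw [div_eq_mul_one_div]
      gcongr
    have h4 : ‖(1 - q) ^ (-κ) - 1‖ ≤ C₃ := h3.trans (div_le_self hC₃0 hv)
    rw [e1]
    calc _ ≤ ‖expBinet (-κ) (-v)‖ * (1 + ‖(1 - q) ^ (-κ) - 1‖) + ‖(1 - q) ^ (-κ) - 1‖ := by
          refine (norm_add_le _ _).trans ?_
          rw [norm_mul]
          gcongr
          refine (norm_add_le _ _).trans ?_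
          rw [norm_one]
      _ ≤ C₂ / v.im * (1 + C₃) + C₃ / v.im := by gcongr
      _ = (C₂ * (1 + C₃) + C₃) / v.im := by ring
      _ ≤ _ := div_le_div_of_nonneg_right (le_add_of_nonneg_left hC₁0) hv0.le

/-! ### Rotation of contours in a quadrant -/

/-- Cauchy's theorem on the square `[0, T]²`. The top side is at most `C T exp (-δ T)` and the right
side at most `C / (1 + T)`, so both disappear as `T` grows. -/
theorem integral_quadrant {g : ℂ → ℂ} {C δ : ℝ} (hδ : 0 < δ)
    (hg : DifferentiableOn ℂ g {s | 0 ≤ s.re ∧ 0 ≤ s.im})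
    (hb : ∀ a b : ℝ, 0 ≤ a → 0 ≤ b →
      ‖g (a + b * Complex.I)‖ ≤ C * Real.exp (-δ * b) * ((1 + a) ^ 2)⁻¹) :
    IntegrableOn (fun a : ℝ => g a) (Ioi 0) ∧
      ∫ a in Ioi (0 : ℝ), g a = Complex.I * ∫ b in Ioi (0 : ℝ), g (b * Complex.I) := by
  have hC : 0 ≤ C := by
    have := (norm_nonneg _).trans (hb 0 0 le_rfl le_rfl)
    simpa using this
  have hcr : ContinuousOn (fun a : ℝ => g a) (Ici 0) :=
    hg.continuousOn.comp (by fun_prop) fun a ha => by simpa using ha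
  have hci : ContinuousOn (fun b : ℝ => g (b * Complex.I)) (Ici 0) :=
    hg.continuousOn.comp (by fun_prop) fun a ha => by simpa using ha
  have hir : IntegrableOn (fun a : ℝ => g a) (Ioi 0) := by
    refine ((integrableOn_inv_add_sq one_pos).1.const_mul C).mono'
      ((hcr.mono Ioi_subset_Ici_self).aestronglyMeasurable measurableSet_Ioi) ?_
    filter_upwards [ae_restrict_mem measurableSet_Ioi] with a ha
    simpa using hb a 0 (mem_Ioi.1 ha).le le_rfl
  have hii : IntegrableOn (fun b : ℝ => g (b * Complex.I)) (Ioi 0) := by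
    refine ((integrableOn_exp_mul_Ioi (neg_neg_of_pos hδ) 0).const_mul C).mono'
      ((hci.mono Ioi_subset_Ici_self).aestronglyMeasurable measurableSet_Ioi) ?_
    filter_upwards [ae_restrict_mem measurableSet_Ioi] with b hb'
    simpa using hb 0 b le_rfl (mem_Ioi.1 hb').le
  refine ⟨hir, ?_⟩
  have hrect (T : ℝ) (hT : 0 ≤ T) : (∫ a in (0 : ℝ)..T, g a) -
      Complex.I * ∫ b in (0 : ℝ)..T, g (b * Complex.I) =
      (∫ a in (0 : ℝ)..T, g (a + T * Complex.I)) -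
        Complex.I * ∫ b in (0 : ℝ)..T, g (T + b * Complex.I) := by
    have := Complex.integral_boundary_rect_eq_zero_of_differentiableOn g 0 (T + T * Complex.I)
      (hg.mono fun s hs => by
        rw [Complex.mem_reProdIm] at hs
        simp only [Complex.zero_re, Complex.zero_im, Complex.add_re, Complex.ofReal_re,
          Complex.mul_re, Complex.I_re, mul_zero, Complex.ofReal_im, Complex.I_im, mul_one,
          sub_self, add_zero, Complex.add_im, Complex.mul_im, zero_add, uIcc_of_le hT] at hs
        exact ⟨hs.1.1, hs.2.1⟩)
    simp at this
    linear_combination this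
  have hlim1 : Tendsto (fun T : ℝ => (∫ a in (0 : ℝ)..T, g a) -
      Complex.I * ∫ b in (0 : ℝ)..T, g (b * Complex.I)) atTop
      (𝓝 ((∫ a in Ioi (0 : ℝ), g a) - Complex.I * ∫ b in Ioi (0 : ℝ), g (b * Complex.I))) :=
    (intervalIntegral_tendsto_integral_Ioi 0 hir tendsto_id).sub
      ((intervalIntegral_tendsto_integral_Ioi 0 hii tendsto_id).const_mul _)
  have hlim2 : Tendsto (fun T : ℝ => (∫ a in (0 : ℝ)..T, g (a + T * Complex.I)) -
        Complex.I * ∫ b in (0 : ℝ)..T, g (T + b * Complex.I)) atTop (𝓝 0) := by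
    have hz : Tendsto (fun T : ℝ => C * (T * Real.exp (-δ * T)) + C * (1 + T)⁻¹) atTop (𝓝 0) := by
      have e1 : Tendsto (fun T : ℝ => T * Real.exp (-δ * T)) atTop (𝓝 0) := by
        have := tendsto_rpow_mul_exp_neg_mul_atTop_nhds_zero 1 δ hδ
        simpa using this
      have e2 : Tendsto (fun T : ℝ => (1 + T)⁻¹) atTop (𝓝 0) :=
        tendsto_inv_atTop_zero.comp (tendsto_atTop_add_const_left _ 1 tendsto_id)
      simpa using (e1.const_mul C).add (e2.const_mul C)
    refine squeeze_zero_norm' ?_ hz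
    filter_upwards [eventually_ge_atTop 0] with T hT
    refine (norm_sub_le _ _).trans (add_le_add ?_ ?_)
    · have := intervalIntegral.norm_integral_le_of_norm_le_const (a := 0) (b := T)
        (f := fun a : ℝ => g (a + T * Complex.I)) (C := C * Real.exp (-δ * T)) (fun a ha => by
          rw [uIoc_of_le hT] at ha
          refine (hb a T ha.1.le hT).trans (mul_le_of_le_one_right (by positivity) ?_)
          refine inv_le_one_of_one_le₀ ?_
          nlinarith [ha.1])
      refine this.trans (le_of_eq ?_)
      rw [sub_zero, abs_of_nonneg hT]; ring
    · rw [norm_mul, Complex.norm_I, one_mul]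
      have := intervalIntegral.norm_integral_le_of_norm_le_const (a := 0) (b := T)
        (f := fun b : ℝ => g (T + b * Complex.I)) (C := C * ((1 + T) ^ 2)⁻¹) (fun b hb' => by
          rw [uIoc_of_le hT] at hb'
          refine (hb T b hT hb'.1.le).trans ?_
          gcongr
          refine mul_le_of_le_one_right hC (Real.exp_le_one_iff.2 ?_)
          nlinarith [hb'.1])
      refine this.trans ?_
      rw [sub_zero, abs_of_nonneg hT, mul_assoc]
      gcongr
      rw [inv_mul_le_iff₀ (by positivity), pow_two, mul_assoc, mul_inv_cancel₀ (by positivity)]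
      linarith
  have h3 := tendsto_nhds_unique hlim1 (hlim2.congr' (by
    filter_upwards [eventually_ge_atTop 0] with T hT using (hrect T hT).symm))
  exact sub_eq_zero.1 h3

/-! ### Laplace integrals along horizontal half-lines -/

theorem hasDerivAt_halfLine {m : ℝ → ℂ} {C : ℝ}
    (hm : AEStronglyMeasurable m (volume.restrict (Ioi 0))) (hmC : ∀ a, 0 < a → ‖m a‖ ≤ C)
    (w : ℂ) {x : ℂ} (hx : 0 < x.re) :
    HasDerivAt (fun x => ∫ a in Ioi (0 : ℝ), m a * Complex.exp ((w - a) * x))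
      (∫ a in Ioi (0 : ℝ), m a * (w - a) * Complex.exp ((w - a) * x)) x := by
  have hr : 0 < x.re / 2 := by positivity
  have hC : 0 ≤ C := (norm_nonneg _).trans (hmC 1 one_pos)
  have h := hasDerivAt_integral_of_differentiableOn (μ := volume.restrict (Ioi (0 : ℝ)))
    (F := fun x a => m a * Complex.exp ((w - a) * x)) (z₀ := x) hr
    (bound := fun a => C * Real.exp (‖w‖ * (‖x‖ + x.re / 2)) * Real.exp (-(x.re / 2) * a)) ?_ ?_ ?_ ?_
  · convert! h using 1
    refine integral_congr_ae (Eventually.of_forall fun a => ?_)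
    have hd : HasDerivAt (fun z : ℂ => m a * Complex.exp ((w - a) * z))
        (m a * (Complex.exp ((w - a) * x) * ((w - a) * 1))) x :=
      (((hasDerivAt_id x).const_mul (w - (a : ℂ))).cexp).const_mul (m a)
    simp only [hd.deriv]
    ring
  · exact fun z _ => hm.mul (Continuous.aestronglyMeasurable (by fun_prop))
  · exact Eventually.of_forall fun a => by fun_prop
  · filter_upwards [ae_restrict_mem measurableSet_Ioi] with a ha z hz
    have ha0 : 0 < a := ha
    rw [norm_mul, mul_assoc C, ← Real.exp_add, Complex.norm_exp]
    refine mul_le_mul (hmC a ha0) (Real.exp_le_exp.2 ?_) (Real.exp_pos _).le hC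
    rw [mem_ball, dist_eq_norm] at hz
    have h1 : ‖z‖ ≤ ‖x‖ + x.re / 2 := by linarith [norm_sub_norm_le z x]
    have h2 : x.re / 2 ≤ z.re := by
      have := (Complex.abs_re_le_norm (z - x)).trans hz.le
      rw [Complex.sub_re, abs_le] at this
      linarith
    have h3 : (w * z).re ≤ ‖w‖ * (‖x‖ + x.re / 2) := by
      refine (Complex.re_le_norm _).trans ?_
      rw [norm_mul]; gcongr
    have h4 : ((w - a) * z).re = (w * z).re - a * z.re := by simp; ring
    rw [h4]
    nlinarith
  · exact (integrableOn_exp_mul_Ioi (by linarith) 0).const_mul _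

theorem mem_slitPlane_of_im_eq_one {v : ℂ} (hv : v.im = 1) : v ∈ Complex.slitPlane := by
  right; simp [hv]

theorem continuous_expBinet_line (κ : ℤ) (w : ℂ) (hw : w.im = 1) :
    Continuous fun a : ℝ => expBinet κ (w - a) := by
  rw [← continuousOn_univ]
  exact (differentiableOn_expBinet κ).continuousOn.comp (by fun_prop) fun a _ =>
    mem_slitPlane_of_im_eq_one (by simp [hw])

/-- The contribution of the half-line `{w - a : a > 0}` to the inversion integral. -/
noncomputable def lineIntegral (κ : ℤ) (w x : ℂ) : ℂ :=
  ∫ a in Ioi (0 : ℝ), expBinet κ (w - a) * Complex.exp ((w - a) * x)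

theorem expBinet_line_bound (κ : ℤ) {w : ℂ} (hw : w.im = 1) :
    ∃ C, ∀ a : ℝ, ‖expBinet κ (w - a)‖ ≤ C := by
  obtain ⟨C, -, hC⟩ := exists_norm_expBinet_le_im κ
  refine ⟨C, fun a => ?_⟩
  have := hC (w - a) (by simp [hw])
  simpa [hw] using this

theorem eqOn_of_eq_ofReal {U : Set ℂ} (hUo : IsOpen U) (hU : IsPreconnected U)
    (hpos : ∀ x : ℝ, 0 < x → (x : ℂ) ∈ U) {f g : ℂ → ℂ} (hf : DifferentiableOn ℂ f U)
    (hg : DifferentiableOn ℂ g U) (h : ∀ x : ℝ, 0 < x → f x = g x) : EqOn f g U := by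
  refine (hf.analyticOnNhd hUo).eqOn_of_preconnected_of_frequently_eq (hg.analyticOnNhd hUo) hU
    (hpos 1 one_pos) ?_
  have h2 : Tendsto (fun n : ℕ => ((1 + 1 / ((n : ℝ) + 1) : ℝ) : ℂ)) atTop (𝓝[≠] ((1 : ℝ) : ℂ)) := by
    refine tendsto_nhdsWithin_iff.2 ⟨?_, Eventually.of_forall fun n => ?_⟩
    · refine (Complex.continuous_ofReal.tendsto 1).comp ?_
      simpa using (tendsto_one_div_add_atTop_nhds_zero_nat (𝕜 := ℝ)).const_add 1
    · have : (0 : ℝ) < 1 / ((n : ℝ) + 1) := by positivity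
      simp only [mem_compl_iff, mem_singleton_iff, Complex.ofReal_inj]
      linarith
  exact h2.frequently (Frequently.of_forall fun n => h _ (by positivity))

theorem isOpen_rightHalfPlane : IsOpen {x : ℂ | 0 < x.re} :=
  isOpen_lt continuous_const Complex.continuous_re

theorem isPreconnected_rightHalfPlane : IsPreconnected {x : ℂ | 0 < x.re} :=
  (convex_halfSpace_re_gt 0).isPreconnected

theorem rightHalfPlane_subset_slitDomain : {x : ℂ | 0 < x.re} ⊆ slitDomain := fun _ hx =>
  Or.inl (ne_of_gt hx)

/-! ### The inversion integral and its rotation to horizontal half-lines -/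

theorem integral_Ioi_one_eq (G : ℝ → ℂ) :
    ∫ y in Ioi (1 : ℝ), G y = ∫ b in Ioi (0 : ℝ), G (1 + b) := by
  have := (measurePreserving_add_left volume (1 : ℝ)).setIntegral_preimage_emb
    (measurableEmbedding_addLeft 1) G (Ioi 1)
  rw [← this]
  simp

theorem one_le_norm_one_add_mul_I (y : ℝ) : 1 ≤ ‖(1 : ℂ) + y * Complex.I‖ := by
  have := Complex.re_le_norm ((1 : ℂ) + y * Complex.I)
  simpa using this

theorem sq_norm_one_add_mul_I (y : ℝ) : ‖(1 : ℂ) + y * Complex.I‖ ^ 2 = 1 + y ^ 2 := by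
  rw [← Complex.normSq_eq_norm_sq, Complex.normSq_apply]
  simp
  ring

theorem continuous_expBinet_vertical (κ : ℤ) :
    Continuous fun y : ℝ => expBinet κ (1 + y * Complex.I) := by
  rw [← continuousOn_univ]
  exact (differentiableOn_expBinet κ).continuousOn.comp (by fun_prop) fun y _ => by
    left; simp

theorem integrable_expBinet_div (κ : ℤ) :
    Integrable fun y : ℝ => expBinet κ (1 + y * Complex.I) / (1 + y * Complex.I) := by
  obtain ⟨C, hC0, hC⟩ := exists_norm_expBinet_le κ
  refine (integrable_inv_one_add_sq.const_mul C).mono' ?_ (Eventually.of_forall fun y => ?_)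
  · refine ((continuous_expBinet_vertical κ).div (by fun_prop) fun y => ?_).aestronglyMeasurable
    exact norm_pos_iff.1 (one_pos.trans_le (one_le_norm_one_add_mul_I y))
  · have h1 := hC (1 + y * Complex.I) (by simp) (one_le_norm_one_add_mul_I y)
    have h0 := one_le_norm_one_add_mul_I y
    rw [norm_div, ← sq_norm_one_add_mul_I, pow_two, mul_inv, ← mul_assoc, ← div_eq_mul_inv,
      ← div_eq_mul_inv]
    gcongr

/-- The antiderivative of `borel κ` vanishing at the origin, by inversion of its Laplace
transform. -/
theorem borel_primitive_eq_integral (κ : ℤ) {x : ℝ} (hx : 0 < x) :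
    2 * Real.pi * ((x : ℂ) * ∫ t in (0 : ℝ)..1, borel κ (t * x)) =
      ∫ y : ℝ, expBinet κ (1 + y * Complex.I) / (1 + y * Complex.I) *
        Complex.exp ((1 + y * Complex.I) * x) := by
  -- The available bound for `exp (κ J) - 1` is only `O(1 / |v|)`, which is not integrable on a
  -- vertical line. Convolution with `1` divides the transform by `v` and makes the inversion
  -- integral absolutely convergent.
  set f : ℂ → ℂ := rayConv (borel κ) (fun _ => 1) with hf
  have hf1 (x : ℂ) : f x = x * ∫ t in (0 : ℝ)..1, borel κ (t * x) := by simp [hf, rayConv]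
  have hone {v : ℂ} (hv : 0 < v.re) : IntegrableOn (laplaceIntegrand (fun _ => 1) v) (Ioi 0) ∧
      laplace (fun _ => 1) v = 1 / v := by
    constructor
    · exact (integrableOn_exp_neg_mul hv).congr_fun (g := laplaceIntegrand (fun _ => 1) v)
        (fun x _ => by simp [laplaceIntegrand]) measurableSet_Ioi
    · simpa [laplace, laplaceIntegrand] using integral_exp_neg_mul hv
  have hlap {v : ℂ} (hv : 0 < v.re) : laplace f v = expBinet κ v / v := by
    rw [hf, laplace_rayConv (laplace_borel κ hv).1 (hone hv).1, (hone hv).2, (laplace_borel κ hv).2,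
      expBinet]
    ring
  have hdiff : DifferentiableOn ℂ f slitDomain :=
    differentiableOn_rayConv isOpen_slitDomain isStar_slitDomain (differentiableOn_borel κ)
      (differentiableOn_const _)
  have hlap' (y : ℝ) : laplace f (((1 : ℝ) : ℂ) + y * Complex.I) =
      expBinet κ (1 + y * Complex.I) / (1 + y * Complex.I) := by
    rw [hlap (by simp)]
    simp
  have hxm : (x : ℂ) ∈ slitDomain := Or.inl (by simpa using hx.ne')
  have := laplace_inversion (f := f) (β := 1) hx
    (integrableOn_laplaceIntegrand_rayConv (laplace_borel κ (by simp)).1 (hone (by simp)).1)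
    ((hdiff.differentiableAt (isOpen_slitDomain.mem_nhds hxm)).continuousAt.comp (by fun_prop))
    (by simpa only [hlap'] using integrable_expBinet_div κ)
  rw [← hf1, this]
  simp only [hlap']
  simp

/-- The integrand of the inversion integral for the antiderivative. -/
noncomputable def invIntegrand (κ : ℤ) (x v : ℂ) : ℂ := expBinet κ v / v * Complex.exp (v * x)

theorem invIntegrand_conj (κ : ℤ) (x v : ℂ) :
    invIntegrand κ ((starRingEnd ℂ) x) ((starRingEnd ℂ) v) =
      (starRingEnd ℂ) (invIntegrand κ x v) := by
  simp [invIntegrand, expBinet_conj, ← Complex.exp_conj]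

/-- The map `s ↦ 1 + i + is` takes the first quadrant to `Re v ≤ 1`, `Im v ≥ 1`. There `exp (v x)`
decays to the left and `expBinet κ v / v` quadratically upwards, which are the hypotheses of
`integral_quadrant`. -/
theorem integral_vertical_eq_horizontal (κ : ℤ) {x : ℝ} (hx : 0 < x) :
    ∫ y in Ioi (1 : ℝ), invIntegrand κ x (1 + y * Complex.I) =
      Complex.I * ∫ a in Ioi (0 : ℝ), invIntegrand κ x (1 + Complex.I - a) := by
  obtain ⟨C, hC0, hC⟩ := exists_norm_expBinet_le_im κ
  set g : ℂ → ℂ := fun s => invIntegrand κ x (1 + Complex.I + Complex.I * s) with hg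
  have him (s : ℂ) : (1 + Complex.I + Complex.I * s).im = 1 + s.re := by simp
  have hre (s : ℂ) : (1 + Complex.I + Complex.I * s).re = 1 - s.im := by simp; ring
  have hd : DifferentiableOn ℂ g {s | 0 ≤ s.re ∧ 0 ≤ s.im} := by
    have hm (s : ℂ) (hs : s ∈ {s : ℂ | 0 ≤ s.re ∧ 0 ≤ s.im}) :
        (1 + Complex.I + Complex.I * s) ∈ Complex.slitPlane := by
      right; rw [him]; linarith [hs.1]
    refine DifferentiableOn.mul (DifferentiableOn.div ?_ (by fun_prop) fun s hs => ?_)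
      (by fun_prop)
    · exact (differentiableOn_expBinet κ).comp (by fun_prop) hm
    · exact Complex.slitPlane_ne_zero (hm s hs)
  have hb (a b : ℝ) (ha : 0 ≤ a) (_ : 0 ≤ b) : ‖g (a + b * Complex.I)‖ ≤
      (C * Real.exp x) * Real.exp (-x * b) * ((1 + a) ^ 2)⁻¹ := by
    set v : ℂ := 1 + Complex.I + Complex.I * (a + b * Complex.I) with hv
    have h1 : v.im = 1 + a := by rw [hv, him]; simp
    have h2 : v.re = 1 - b := by rw [hv, hre]; simp
    have h3 := hC v (by rw [h1]; linarith)
    have h4 : 1 + a ≤ ‖v‖ := by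
      rw [← h1]; exact (le_abs_self _).trans (Complex.abs_im_le_norm v)
    have h5 : ‖Complex.exp (v * x)‖ = Real.exp x * Real.exp (-x * b) := by
      rw [Complex.norm_exp, Complex.re_mul_ofReal, h2, ← Real.exp_add]
      ring_nf
    rw [h1] at h3
    simp only [hg, invIntegrand, norm_mul, norm_div]
    rw [← hv, h5]
    have h6 : ‖expBinet κ v‖ / ‖v‖ ≤ C / (1 + a) / (1 + a) := by gcongr
    refine (mul_le_mul_of_nonneg_right h6 (by positivity)).trans (le_of_eq ?_)
    field_simp
  have := (integral_quadrant hx hd hb).2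
  rw [integral_Ioi_one_eq]
  have e1 (b : ℝ) : invIntegrand κ x (1 + ((1 + b : ℝ) : ℂ) * Complex.I) = g b := by
    simp only [hg]
    congr 1
    push_cast
    ring
  have e2 (a : ℝ) : invIntegrand κ x (1 + Complex.I - a) = g (a * Complex.I) := by
    simp only [hg]
    congr 1
    ring_nf
    simp
    ring
  simp_rw [e1, e2]
  exact this

/-- The vertical line is cut at heights `±1`. The upper piece is rotated, and the lower one is its
conjugate. Conjugating `x` as well, though it is real here, makes the last term holomorphic in `x`
when the formula is extended. -/
theorem borel_primitive_eq (κ : ℤ) {x : ℝ} (hx : 0 < x) :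
    2 * Real.pi * ((x : ℂ) * ∫ t in (0 : ℝ)..1, borel κ (t * x)) =
      (∫ y in (-1 : ℝ)..1, invIntegrand κ x (1 + y * Complex.I)) +
        Complex.I * (∫ a in Ioi (0 : ℝ), invIntegrand κ x (1 + Complex.I - a)) +
        (starRingEnd ℂ) (Complex.I *
          ∫ a in Ioi (0 : ℝ), invIntegrand κ ((starRingEnd ℂ) x) (1 + Complex.I - a)) := by
  have hint : Integrable fun y : ℝ => invIntegrand κ x (1 + y * Complex.I) := by
    refine (integrable_expBinet_div κ).mul_bdd (c := Real.exp x)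
      (Continuous.aestronglyMeasurable (by fun_prop)) (Eventually.of_forall fun y => ?_)
    rw [Complex.norm_exp, Complex.re_mul_ofReal]
    simp
  rw [borel_primitive_eq_integral κ hx, Complex.conj_ofReal, ← integral_vertical_eq_horizontal κ hx]
  have h1 : ∫ y in Iic (-1 : ℝ), invIntegrand κ x (1 + y * Complex.I) =
      (starRingEnd ℂ) (∫ y in Ioi (1 : ℝ), invIntegrand κ x (1 + y * Complex.I)) := by
    rw [← integral_conj]
    have := integral_comp_neg_Ioi (1 : ℝ)
      (fun y : ℝ => invIntegrand κ x (1 + y * Complex.I))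
    rw [← this]
    refine integral_congr_ae (Eventually.of_forall fun y => ?_)
    simp only [← invIntegrand_conj]
    simp
  have h2 := intervalIntegral.integral_Iic_add_Ioi (b := (-1 : ℝ)) hint.integrableOn
    hint.integrableOn
  have h3 := intervalIntegral.integral_interval_add_Ioi (a := (-1 : ℝ)) (b := 1)
    hint.integrableOn hint.integrableOn
  rw [h1] at h2
  change ∫ y : ℝ, invIntegrand κ x (1 + y * Complex.I) = _
  rw [← h2, ← h3]
  ring

theorem hasDerivAt_invIntegrand (κ : ℤ) {v : ℂ} (hv : v ≠ 0) (x : ℂ) :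
    HasDerivAt (fun x => invIntegrand κ x v) (expBinet κ v * Complex.exp (v * x)) x := by
  have := (((hasDerivAt_id x).const_mul v).cexp).const_mul (expBinet κ v / v)
  convert! this using 1
  simp only [id]
  field_simp

theorem one_add_mul_I_ne_zero (y : ℝ) : (1 : ℂ) + y * Complex.I ≠ 0 :=
  norm_pos_iff.1 (one_pos.trans_le (one_le_norm_one_add_mul_I y))

theorem hasDerivAt_vertical_segment (κ : ℤ) (x : ℂ) :
    HasDerivAt (fun x => ∫ y in (-1 : ℝ)..1, invIntegrand κ x (1 + y * Complex.I))
      (∫ y in (-1 : ℝ)..1, expBinet κ (1 + y * Complex.I) *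
        Complex.exp ((1 + y * Complex.I) * x)) x := by
  have := hasDerivAt_intervalIntegral_of_differentiableOn (a := -1) (b := 1)
    (F := fun x y => invIntegrand κ x (1 + y * Complex.I)) isOpen_univ (by norm_num) (z₀ := x)
    (Continuous.continuousOn ?_) (fun t _ => ?_) (mem_univ x)
  · convert! this using 1
    refine intervalIntegral.integral_congr fun y _ => ?_
    exact (hasDerivAt_invIntegrand κ (one_add_mul_I_ne_zero y) x).deriv.symm
  · have h1 := (continuous_expBinet_vertical κ).comp (continuous_snd (X := ℂ))
    refine (h1.div (by fun_prop) fun p => one_add_mul_I_ne_zero _).mul (by fun_prop)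
  · exact fun z _ => (hasDerivAt_invIntegrand κ
      (one_add_mul_I_ne_zero t) z).differentiableAt.differentiableWithinAt

theorem line_ne_zero (a : ℝ) : 1 + Complex.I - a ≠ 0 := fun h => by
  have := congrArg Complex.im h
  simp at this

theorem hasDerivAt_horizontal (κ : ℤ) {x : ℂ} (hx : 0 < x.re) :
    HasDerivAt (fun x => ∫ a in Ioi (0 : ℝ), invIntegrand κ x (1 + Complex.I - a))
      (lineIntegral κ (1 + Complex.I) x) x := by
  have hw : (1 + Complex.I).im = 1 := by simp
  obtain ⟨C, hC⟩ := expBinet_line_bound κ hw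
  have hc : Continuous fun a : ℝ => expBinet κ (1 + Complex.I - a) / (1 + Complex.I - a) :=
    (continuous_expBinet_line κ _ hw).div (by fun_prop) line_ne_zero
  have := hasDerivAt_halfLine (C := C) hc.aestronglyMeasurable (fun a _ => ?_) (1 + Complex.I) hx
  · convert! this using 1
    refine integral_congr_ae (Eventually.of_forall fun a => ?_)
    simp only
    rw [div_mul_cancel₀ _ (line_ne_zero a)]
  · rw [norm_div]
    refine (div_le_self (norm_nonneg _) ?_).trans (hC a)
    have := (le_abs_self _).trans (Complex.abs_im_le_norm (1 + Complex.I - a))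
    simpa using this

theorem conj_mem_rightHalfPlane {x : ℂ} (hx : 0 < x.re) : 0 < ((starRingEnd ℂ) x).re := by simpa

/-- The formula for the primitive extends from `x > 0` to `Re x > 0` by the identity theorem and is
then differentiated. After the rotation `exp ((w - a) x)` gives convergence by itself, so the
auxiliary denominator `v` can be removed. -/
theorem borel_eq_contour (κ : ℤ) {x : ℂ} (hx : 0 < x.re) :
    2 * Real.pi * borel κ x =
      (∫ y in (-1 : ℝ)..1, expBinet κ (1 + y * Complex.I) *
        Complex.exp ((1 + y * Complex.I) * x)) +
        Complex.I * lineIntegral κ (1 + Complex.I) x +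
        (starRingEnd ℂ) (Complex.I * lineIntegral κ (1 + Complex.I) ((starRingEnd ℂ) x)) := by
  set U : Set ℂ := {x : ℂ | 0 < x.re}
  have hL (x : ℂ) (hx : x ∈ slitDomain) : HasDerivAt
      (fun x : ℂ => 2 * Real.pi * (x * ∫ t in (0 : ℝ)..1, borel κ (t * x)))
      (2 * Real.pi * borel κ x) x :=
    (hasDerivAt_radial_primitive isOpen_slitDomain isStar_slitDomain (differentiableOn_borel κ)
      hx).const_mul (2 * Real.pi : ℂ)
  have hC (x : ℂ) (hx : 0 < x.re) : HasDerivAt (fun x => (starRingEnd ℂ) (Complex.I *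
      ∫ a in Ioi (0 : ℝ), invIntegrand κ ((starRingEnd ℂ) x) (1 + Complex.I - a)))
      ((starRingEnd ℂ) (Complex.I * lineIntegral κ (1 + Complex.I) ((starRingEnd ℂ) x))) x := by
    have := ((hasDerivAt_horizontal κ (conj_mem_rightHalfPlane hx)).const_mul Complex.I).conj_conj
    rwa [Complex.conj_conj] at this
  have hR (x : ℂ) (hx : 0 < x.re) := ((hasDerivAt_vertical_segment κ x).add
    ((hasDerivAt_horizontal κ hx).const_mul Complex.I)).add (hC x hx)
  have heq := eqOn_of_eq_ofReal isOpen_rightHalfPlane isPreconnected_rightHalfPlane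
    (fun x hx => by simpa using hx)
    (fun x hx => (hL x (rightHalfPlane_subset_slitDomain hx)).differentiableAt.differentiableWithinAt)
    (fun x hx => (hR x hx).differentiableAt.differentiableWithinAt)
    (fun x hx => borel_primitive_eq κ hx)
  have h1 := (hL x (rightHalfPlane_subset_slitDomain hx)).deriv
  have h2 := (heq.eventuallyEq_of_mem (isOpen_rightHalfPlane.mem_nhds hx)).deriv_eq
  have h3 := hR x hx
  rw [← h1, h2]
  exact h3.deriv

theorem integrableOn_lineIntegral (κ : ℤ) {w x : ℂ} (hw : w.im = 1) (hx : 0 < x.re) :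
    IntegrableOn (fun a : ℝ => expBinet κ (w - a) * Complex.exp ((w - a) * x)) (Ioi 0) := by
  obtain ⟨C, hC⟩ := expBinet_line_bound κ hw
  refine Integrable.bdd_mul (c := C) ?_
    (continuous_expBinet_line κ w hw).aestronglyMeasurable (Eventually.of_forall hC)
  have h : IntegrableOn (fun a : ℝ => Complex.exp (w * x) * Complex.exp (-x * a)) (Ioi 0) :=
    (integrableOn_exp_neg_mul hx).const_mul (Complex.exp (w * x))
  refine h.congr_fun (fun a _ => ?_) measurableSet_Ioi
  simp only
  rw [← Complex.exp_add]
  ring_nf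

/-- The starting point is moved to `-1 + i`, so that on the remaining half-line `-v` has real part
at least `1` and the reflection formula is useful. The segment passed over contributes an entire
function of `x`. -/
theorem lineIntegral_split (κ : ℤ) {x : ℂ} (hx : 0 < x.re) :
    lineIntegral κ (1 + Complex.I) x =
      (∫ a in (0 : ℝ)..2, expBinet κ (1 + Complex.I - a) * Complex.exp ((1 + Complex.I - a) * x)) +
        lineIntegral κ (-1 + Complex.I) x := by
  have hint := integrableOn_lineIntegral κ (w := 1 + Complex.I) (by simp) hx
  rw [lineIntegral, ← intervalIntegral.integral_interval_add_Ioi (b := 2) hint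
    (hint.mono_set (Ioi_subset_Ioi zero_le_two))]
  congr 1
  have := (measurePreserving_add_left volume (2 : ℝ)).setIntegral_preimage_emb
    (measurableEmbedding_addLeft 2) (fun a : ℝ => expBinet κ (1 + Complex.I - a) *
      Complex.exp ((1 + Complex.I - a) * x)) (Ioi 2)
  rw [← this, lineIntegral]
  simp only [preimage_const_add_Ioi, sub_self]
  refine integral_congr_ae (Eventually.of_forall fun a => ?_)
  push_cast
  ring_nf

/-- `borel κ` in the right half plane, up to an entire function, is given by two half-line
integrals. -/
theorem exists_borel_eq_lineIntegral (κ : ℤ) : ∃ V : ℂ → ℂ, Differentiable ℂ V ∧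
    ∀ x : ℂ, 0 < x.re → 2 * Real.pi * borel κ x = V x +
      Complex.I * lineIntegral κ (-1 + Complex.I) x +
      (starRingEnd ℂ) (Complex.I * lineIntegral κ (-1 + Complex.I) ((starRingEnd ℂ) x)) := by
  set S : ℂ → ℂ := fun x => Complex.I * ∫ a in (0 : ℝ)..2, expBinet κ (1 + Complex.I - a) *
    Complex.exp ((1 + Complex.I - a) * x)
  have hS : Differentiable ℂ S := by
    rw [← differentiableOn_univ]
    refine (differentiableOn_intervalIntegral isOpen_univ zero_le_two (Continuous.continuousOn ?_)
      fun t _ => by fun_prop).const_mul _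
    exact ((continuous_expBinet_line κ (1 + Complex.I) (by simp)).comp
      (continuous_snd (X := ℂ))).mul (by fun_prop)
  have hT : Differentiable ℂ fun x => ∫ y in (-1 : ℝ)..1, expBinet κ (1 + y * Complex.I) *
      Complex.exp ((1 + y * Complex.I) * x) := by
    rw [← differentiableOn_univ]
    refine differentiableOn_intervalIntegral isOpen_univ (by norm_num) (Continuous.continuousOn ?_)
      fun t _ => by fun_prop
    exact ((continuous_expBinet_vertical κ).comp (continuous_snd (X := ℂ))).mul (by fun_prop)
  have hS' : Differentiable ℂ fun x => (starRingEnd ℂ) (S ((starRingEnd ℂ) x)) := fun x =>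
    (hS _).conj_conj (x := (starRingEnd ℂ) x) |> fun h => by simpa [Function.comp_def] using h
  refine ⟨_, (hT.add hS).add hS', fun x hx => ?_⟩
  rw [borel_eq_contour κ hx, lineIntegral_split κ hx,
    lineIntegral_split κ (conj_mem_rightHalfPlane hx)]
  simp only [S, map_mul, map_add, mul_add, Pi.add_apply]
  ring

/-! ### Half-line integrals and their rotations -/

/-- The Laplace-type integral of `G` along the half-line `w + [0, ∞)`. -/
noncomputable def tail (G : ℂ → ℂ) (w x : ℂ) : ℂ :=
  ∫ a in Ioi (0 : ℝ), G (w + a) * Complex.exp (-(w + a) * x)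

/-- The Laplace-type integral of `G` along the half-line `w + i [0, ∞)`. -/
noncomputable def tailUp (G : ℂ → ℂ) (w x : ℂ) : ℂ :=
  Complex.I * ∫ b in Ioi (0 : ℝ), G (w + b * Complex.I) * Complex.exp (-(w + b * Complex.I) * x)

/-- The function `u ↦ conj (G (conj u))`. -/
noncomputable def reflect (G : ℂ → ℂ) (u : ℂ) : ℂ := (starRingEnd ℂ) (G ((starRingEnd ℂ) u))

/-- The Laplace-type integral of `G` along the half-line `w - i [0, ∞)`. -/
noncomputable def tailDown (G : ℂ → ℂ) (w x : ℂ) : ℂ :=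
  (starRingEnd ℂ) (tailUp (reflect G) ((starRingEnd ℂ) w) ((starRingEnd ℂ) x))

theorem differentiableAt_reflect {G : ℂ → ℂ} {u : ℂ}
    (hG : DifferentiableAt ℂ G ((starRingEnd ℂ) u)) : DifferentiableAt ℂ (reflect G) u := by
  have := hG.conj_conj
  rwa [Complex.conj_conj] at this

theorem tail_eq_reflect (G : ℂ → ℂ) (w x : ℂ) :
    tail G w x = (starRingEnd ℂ) (tail (reflect G) ((starRingEnd ℂ) w) ((starRingEnd ℂ) x)) := by
  rw [tail, tail, ← integral_conj]
  refine integral_congr_ae (Eventually.of_forall fun a => ?_)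
  simp [reflect, ← Complex.exp_conj]

theorem exp_neg_mul_le_inv_sq {ξ : ℝ} (hξ : 0 < ξ) :
    ∃ K, 0 ≤ K ∧ ∀ a, 0 ≤ a → Real.exp (-a * ξ) ≤ K * ((1 + a) ^ 2)⁻¹ := by
  set k := min 1 (ξ / 2)
  have hk : 0 < k := lt_min one_pos (by positivity)
  refine ⟨(k ^ 2)⁻¹, by positivity, fun a ha => ?_⟩
  have h1 : k * (1 + a) ≤ Real.exp (a * ξ / 2) := by
    have := Real.add_one_le_exp (a * ξ / 2)
    have h2 : k ≤ 1 := min_le_left _ _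
    have h3 : k ≤ ξ / 2 := min_le_right _ _
    nlinarith
  rw [← mul_inv, ← mul_pow, neg_mul, Real.exp_neg]
  refine inv_anti₀ (by positivity) ?_
  calc (k * (1 + a)) ^ 2 ≤ Real.exp (a * ξ / 2) ^ 2 := by gcongr
    _ = Real.exp (a * ξ) := by rw [← Real.exp_nat_mul]; congr 1; push_cast; ring

theorem norm_exp_neg_add_mul (w x : ℂ) (a b : ℝ) :
    ‖Complex.exp (-(w + (a + b * Complex.I)) * x)‖ =
      Real.exp (-(w * x).re) * Real.exp (-a * x.re) * Real.exp (x.im * b) := by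
  rw [Complex.norm_exp, ← Real.exp_add, ← Real.exp_add]
  congr 1
  simp
  ring

/-- The direction of rotation is dictated by the sign of `Im x`. The point is that `tailUp`
converges for all `x` with `Im x < 0`, whatever the real part, and so continues `tail` across the
imaginary axis. -/
theorem tail_eq_tailUp {G : ℂ → ℂ} {w x : ℂ} {C : ℝ}
    (hG : ∀ u : ℂ, w.re ≤ u.re → w.im ≤ u.im → DifferentiableAt ℂ G u)
    (hC : ∀ u : ℂ, w.re ≤ u.re → w.im ≤ u.im → ‖G u‖ ≤ C) (hx : 0 < x.re) (hx' : x.im < 0) :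
    tail G w x = tailUp G w x := by
  obtain ⟨K, hK0, hK⟩ := exp_neg_mul_le_inv_sq hx
  have hC0 : 0 ≤ C := (norm_nonneg _).trans (hC w le_rfl le_rfl)
  refine (integral_quadrant (g := fun s => G (w + s) * Complex.exp (-(w + s) * x))
    (C := C * Real.exp (-(w * x).re) * K) (δ := -x.im) (by linarith) (fun s hs => ?_)
    fun a b ha hb => ?_).2
  · have h1 : DifferentiableAt ℂ (fun s => G (w + s)) s :=
      (hG (w + s) (by simpa using hs.1) (by simpa using hs.2)).comp s (by fun_prop)
    exact (h1.mul (by fun_prop)).differentiableWithinAt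
  · rw [norm_mul, norm_exp_neg_add_mul, neg_neg]
    have h1 := hC (w + (a + b * Complex.I)) (by simpa using ha) (by simpa using hb)
    calc _ ≤ C * (Real.exp (-(w * x).re) * (K * ((1 + a) ^ 2)⁻¹) * Real.exp (x.im * b)) := by
          gcongr
          exact hK a ha
      _ = _ := by ring

theorem tail_eq_tailDown {G : ℂ → ℂ} {w x : ℂ} {C : ℝ}
    (hG : ∀ u : ℂ, w.re ≤ u.re → u.im ≤ w.im → DifferentiableAt ℂ G u)
    (hC : ∀ u : ℂ, w.re ≤ u.re → u.im ≤ w.im → ‖G u‖ ≤ C) (hx : 0 < x.re) (hx' : 0 < x.im) :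
    tail G w x = tailDown G w x := by
  rw [tail_eq_reflect, tailDown]
  congr 1
  refine tail_eq_tailUp (C := C) (fun u h1 h2 => differentiableAt_reflect (hG _ ?_ ?_))
    (fun u h1 h2 => ?_) (by simpa) (by simpa)
  · simpa using h1
  · simp at h2 ⊢; linarith
  · rw [reflect, Complex.norm_conj]
    refine hC _ (by simpa using h1) ?_
    simp at h2 ⊢; linarith

theorem continuous_comp_vertical {G : ℂ → ℂ} {w : ℂ}
    (hG : ∀ u : ℂ, w.re ≤ u.re → w.im ≤ u.im → DifferentiableAt ℂ G u) :
    ContinuousOn (fun b : ℝ => G (w + b * Complex.I)) (Ici 0) := fun b hb =>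
  (ContinuousAt.comp (f := fun b : ℝ => w + b * Complex.I)
    (hG _ (by simp) (by simpa using hb)).continuousAt (by fun_prop)).continuousWithinAt

theorem differentiableAt_tailUp {G : ℂ → ℂ} {w x : ℂ} {C : ℝ}
    (hG : ∀ u : ℂ, w.re ≤ u.re → w.im ≤ u.im → DifferentiableAt ℂ G u)
    (hC : ∀ u : ℂ, w.re ≤ u.re → w.im ≤ u.im → ‖G u‖ ≤ C) (hx' : x.im < 0) :
    DifferentiableAt ℂ (tailUp G w) x := by
  have h := (hasDerivAt_halfLine (m := fun b : ℝ => G (w + b * Complex.I)) (C := C)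
    (((continuous_comp_vertical hG).mono Ioi_subset_Ici_self).aestronglyMeasurable
      measurableSet_Ioi)
    (fun b hb => hC _ (by simp) (by simpa using hb.le)) (w * Complex.I)
    (x := Complex.I * x) (by simpa using hx')).differentiableAt
  -- In the variable `i x`, whose real part is `-Im x > 0`, the integral along the vertical
  -- half-line is an ordinary half-line Laplace integral.
  have h2 : DifferentiableAt ℂ (fun x : ℂ => ∫ b in Ioi (0 : ℝ), G (w + b * Complex.I) *
      Complex.exp ((w * Complex.I - b) * (Complex.I * x))) x :=
    h.comp x (by fun_prop : DifferentiableAt ℂ (fun x => Complex.I * x) x)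
  convert! h2.const_mul Complex.I using 1
  ext y
  rw [tailUp]
  congr 2
  ext b
  congr 2
  linear_combination (-w * y) * Complex.I_sq

theorem norm_tailUp_le {G : ℂ → ℂ} {w x : ℂ} {C : ℝ}
    (hC : ∀ u : ℂ, w.re ≤ u.re → w.im ≤ u.im → ‖G u‖ ≤ C) (hx' : x.im < 0) :
    ‖tailUp G w x‖ ≤ C * Real.exp (-(w * x).re) / (-x.im) := by
  have hC0 : 0 ≤ C := (norm_nonneg _).trans (hC w le_rfl le_rfl)
  rw [tailUp, norm_mul, Complex.norm_I, one_mul]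
  have hi := (integrableOn_exp_mul_Ioi hx' 0).const_mul (C * Real.exp (-(w * x).re))
  refine (norm_integral_le_of_norm_le hi ?_).trans (le_of_eq ?_)
  · filter_upwards [ae_restrict_mem measurableSet_Ioi] with b hb
    have := norm_exp_neg_add_mul w x 0 b
    simp only [Complex.ofReal_zero, zero_add, neg_zero, zero_mul, Real.exp_zero, mul_one] at this
    rw [norm_mul, this, mul_assoc]
    gcongr
    exact hC _ (by simp) (by simpa using (mem_Ioi.1 hb).le)
  · rw [integral_const_mul, integral_exp_mul_Ioi hx' 0]
    simp only [mul_zero, Real.exp_zero]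
    field_simp

theorem differentiableAt_tailDown {G : ℂ → ℂ} {w x : ℂ} {C : ℝ}
    (hG : ∀ u : ℂ, w.re ≤ u.re → u.im ≤ w.im → DifferentiableAt ℂ G u)
    (hC : ∀ u : ℂ, w.re ≤ u.re → u.im ≤ w.im → ‖G u‖ ≤ C) (hx' : 0 < x.im) :
    DifferentiableAt ℂ (tailDown G w) x := by
  refine differentiableAt_reflect (G := tailUp (reflect G) ((starRingEnd ℂ) w))
    (differentiableAt_tailUp (C := C) (fun u h1 h2 => differentiableAt_reflect (hG _ ?_ ?_))
      (fun u h1 h2 => ?_) (by simpa))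
  · simpa using h1
  · simp at h2 ⊢; linarith
  · rw [reflect, Complex.norm_conj]
    refine hC _ (by simpa using h1) ?_
    simp at h2 ⊢; linarith

theorem norm_tailDown_le {G : ℂ → ℂ} {w x : ℂ} {C : ℝ}
    (hC : ∀ u : ℂ, w.re ≤ u.re → u.im ≤ w.im → ‖G u‖ ≤ C) (hx' : 0 < x.im) :
    ‖tailDown G w x‖ ≤ C * Real.exp (-(w * x).re) / x.im := by
  rw [tailDown, Complex.norm_conj]
  refine (norm_tailUp_le (C := C) (fun u h1 h2 => ?_) (by simpa)).trans (le_of_eq ?_)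
  · rw [reflect, Complex.norm_conj]
    refine hC _ (by simpa using h1) ?_
    simp at h2 ⊢; linarith
  · rw [← map_mul, Complex.conj_re, Complex.conj_im, neg_neg]

theorem integrableOn_tail {G : ℂ → ℂ} {w x : ℂ} {C : ℝ}
    (hG : ContinuousOn (fun a : ℝ => G (w + a)) (Ici 0)) (hC : ∀ a : ℝ, 0 ≤ a → ‖G (w + a)‖ ≤ C)
    (hx : 0 < x.re) :
    IntegrableOn (fun a : ℝ => G (w + a) * Complex.exp (-(w + a) * x)) (Ioi 0) := by
  have h : IntegrableOn (fun a : ℝ => Complex.exp (-(w * x)) * Complex.exp (-x * a)) (Ioi 0) :=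
    (integrableOn_exp_neg_mul hx).const_mul _
  refine Integrable.bdd_mul (c := C) (h.congr_fun (fun a _ => ?_) measurableSet_Ioi)
    ((hG.mono Ioi_subset_Ici_self).aestronglyMeasurable measurableSet_Ioi) ?_
  · simp only
    rw [← Complex.exp_add]
    ring_nf
  · filter_upwards [ae_restrict_mem measurableSet_Ioi] with a ha using hC a (mem_Ioi.1 ha).le

/-- The only half-line integral in the expansion that produces a pole. -/
theorem tail_one {w x : ℂ} (hx : 0 < x.re) :
    tail (fun _ => 1) w x = Complex.exp (-(w * x)) / x := by
  have : (fun a : ℝ => (1 : ℂ) * Complex.exp (-(w + a) * x)) = fun a : ℝ =>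
      Complex.exp (-(w * x)) * Complex.exp (-x * a) := by
    ext a
    rw [← Complex.exp_add, one_mul]
    ring_nf
  rw [tail, this, integral_const_mul, integral_exp_neg_mul hx]
  ring

/-- Origin of the logarithm: up to `a = 1 / ξ` the exponential is dropped and `1 / (1 + a)`
integrated; beyond, `1 / (1 + a) ≤ ξ` and the exponential gives at most `1`. -/
theorem integral_exp_div_one_add_le {ξ : ℝ} (hξ : 0 < ξ) :
    IntegrableOn (fun a : ℝ => Real.exp (-ξ * a) / (1 + a)) (Ioi 0) ∧
      ∫ a in Ioi (0 : ℝ), Real.exp (-ξ * a) / (1 + a) ≤ 1 + Real.log (1 + 1 / ξ) := by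
  have hc : ContinuousOn (fun a : ℝ => Real.exp (-ξ * a) / (1 + a)) (Ici 0) :=
    ContinuousOn.div (by fun_prop) (by fun_prop) fun a ha => by
      have : (0 : ℝ) ≤ a := ha
      positivity
  have hint : IntegrableOn (fun a : ℝ => Real.exp (-ξ * a) / (1 + a)) (Ioi 0) := by
    refine (integrableOn_exp_mul_Ioi (neg_neg_of_pos hξ) 0).mono'
      ((hc.mono Ioi_subset_Ici_self).aestronglyMeasurable measurableSet_Ioi) ?_
    filter_upwards [ae_restrict_mem measurableSet_Ioi] with a ha
    have : (0 : ℝ) < a := ha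
    rw [Real.norm_of_nonneg (by positivity)]
    exact div_le_self (Real.exp_pos _).le (by linarith)
  refine ⟨hint, ?_⟩
  have hT : 0 < 1 / ξ := by positivity
  rw [← intervalIntegral.integral_interval_add_Ioi (b := 1 / ξ) hint
    (hint.mono_set (Ioi_subset_Ioi hT.le)), add_comm]
  refine add_le_add ?_ ?_
  · have h1 : ∫ a in Ioi (1 / ξ), Real.exp (-ξ * a) / (1 + a) ≤
        ∫ a in Ioi (1 / ξ), ξ * Real.exp (-ξ * a) := by
      refine setIntegral_mono_on (hint.mono_set (Ioi_subset_Ioi hT.le))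
        ((integrableOn_exp_mul_Ioi (neg_neg_of_pos hξ) (1 / ξ)).const_mul ξ) measurableSet_Ioi
        fun a ha => ?_
      have h2 : 1 / ξ < a := ha
      have h3 : 1 ≤ ξ * (1 + a) := by
        rw [div_lt_iff₀ hξ] at h2
        nlinarith
      have h4 : 0 < 1 + a := by linarith
      rw [div_le_iff₀ h4]
      nlinarith [Real.exp_pos (-ξ * a)]
    refine h1.trans ?_
    rw [integral_const_mul, integral_exp_mul_Ioi (neg_neg_of_pos hξ)]
    have : ξ * (-Real.exp (-ξ * (1 / ξ)) / -ξ) = Real.exp (-1) := by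
      field_simp
    rw [this]
    exact Real.exp_le_one_iff.2 (by norm_num)
  · have h1 : ∫ a in (0 : ℝ)..(1 / ξ), Real.exp (-ξ * a) / (1 + a) ≤
        ∫ a in (0 : ℝ)..(1 / ξ), (1 + a)⁻¹ := by
      refine intervalIntegral.integral_mono_on hT.le ?_ ?_ fun a ha => ?_
      · exact (hc.mono fun a ha => by rw [uIcc_of_le hT.le] at ha; exact ha.1).intervalIntegrable
      · refine ContinuousOn.intervalIntegrable (ContinuousOn.inv₀ (by fun_prop) fun a ha => ?_)
        rw [uIcc_of_le hT.le] at ha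
        have := ha.1
        positivity
      · have := ha.1
        rw [div_eq_mul_inv]
        refine mul_le_of_le_one_left (by positivity) (Real.exp_le_one_iff.2 ?_)
        nlinarith
    refine h1.trans (le_of_eq ?_)
    have h2 := intervalIntegral.integral_comp_add_left (a := 0) (b := 1 / ξ) (fun a : ℝ => a⁻¹) 1
    rw [h2, add_zero, integral_inv_of_pos one_pos (by positivity), div_one]

/-! ### Expansion of the half-line integrals and analytic extension across the cuts -/

/-- The real numbers `c j` are the Taylor coefficients at zero of `(1 - q) ^ (-κ)`, with remainders
that are analytic in the unit disc. -/
def IsReflectionCoeff (κ : ℤ) (c : ℕ → ℝ) : Prop :=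
  ∀ M : ℕ, ∃ r : ℂ → ℂ, DifferentiableOn ℂ r (ball 0 1) ∧ ∀ q ∈ ball (0 : ℂ) 1,
    (1 - q) ^ (-κ) = (∑ j ∈ Finset.range M, (c j : ℂ) * q ^ j) + q ^ M * r q

theorem IsReflectionCoeff.zero_eq_one {κ : ℤ} {c : ℕ → ℝ} (hc : IsReflectionCoeff κ c) :
    c 0 = 1 := by
  obtain ⟨r, -, h⟩ := hc 1
  have := h 0 (by simp)
  simp at this
  exact_mod_cast this.symm

theorem isReflectionCoeff_three : IsReflectionCoeff 3 fun j => (Nat.choose (j + 2) 2 : ℝ) := by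
  have hne (q : ℂ) (hq : q ∈ ball (0 : ℂ) 1) : 1 - q ≠ 0 := by
    intro h
    rw [← sub_eq_zero.1 h] at hq
    simp at hq
  intro M
  -- This is the tail of the binomial series of `(1 - q) ^ (-3)` from degree `M` on, divided by `q ^
  -- M`, in closed form; it is verified by induction on `M`.
  refine ⟨fun q => ((M + 2) * (M + 1) / 2 - M * (M + 2) * q + (M + 1) * M / 2 * q ^ 2) /
    (1 - q) ^ 3, ?_, fun q hq => ?_⟩
  · exact DifferentiableOn.div (by fun_prop) (by fun_prop) fun q hq => pow_ne_zero _ (hne q hq)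
  · have h1 := hne q hq
    have h2 : (1 - q) ^ (-3 : ℤ) = 1 / (1 - q) ^ 3 := by
      rw [zpow_neg, one_div]; norm_cast
    rw [h2]
    induction M with
    | zero => simp
    | succ M ih =>
      rw [ih, Finset.sum_range_succ]
      push_cast [Nat.cast_choose_two]
      field_simp
      ring

/-- Here the series is the polynomial `(1 - q)^3`, so each remainder is its upper part divided by `q
^ M`, and zero from `M = 4` on. -/
theorem isReflectionCoeff_neg_three :
    IsReflectionCoeff (-3) fun j => (-1 : ℝ) ^ j * (Nat.choose 3 j : ℝ) := by
  have hz (q : ℂ) : (1 - q) ^ (-(-3 : ℤ)) = (1 - q) ^ 3 := by rw [neg_neg]; norm_cast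
  intro M
  simp only [hz]
  match M with
  | 0 => exact ⟨fun q => (1 - q) ^ 3, by fun_prop, fun q _ => by simp⟩
  | 1 =>
    refine ⟨fun q => -3 + 3 * q - q ^ 2, by fun_prop, fun q _ => ?_⟩
    simp
    ring
  | 2 =>
    refine ⟨fun q => 3 - q, by fun_prop, fun q _ => ?_⟩
    simp [Finset.sum_range_succ]
    ring
  | 3 =>
    refine ⟨fun q => -1, by fun_prop, fun q _ => ?_⟩
    simp [Finset.sum_range_succ, Nat.choose]
    ring
  | M + 4 =>
    refine ⟨fun q => 0, by fun_prop, fun q _ => ?_⟩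
    have : ∑ j ∈ Finset.range (M + 4), (((-1 : ℝ) ^ j * (Nat.choose 3 j : ℝ) : ℝ) : ℂ) * q ^ j =
        ∑ j ∈ Finset.range 4, (((-1 : ℝ) ^ j * (Nat.choose 3 j : ℝ) : ℝ) : ℂ) * q ^ j := by
      refine (Finset.sum_subset (Finset.range_mono (by omega)) fun j _ hj => ?_).symm
      rw [Nat.choose_eq_zero_of_lt (by simp at hj; omega)]
      simp
    rw [this]
    simp [Finset.sum_range_succ, Nat.choose]
    ring

theorem norm_expBinet_le_of_one_le_re (κ : ℤ) : ∃ C, 0 ≤ C ∧ ∀ u : ℂ, (1 - Complex.I).re ≤ u.re →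
    ‖expBinet κ u‖ ≤ C / u.re ∧ ‖expBinet κ u‖ ≤ C := by
  obtain ⟨C, hC0, hC⟩ := exists_norm_expBinet_le κ
  refine ⟨C, hC0, fun u hu => ?_⟩
  have h1 : 1 ≤ u.re := by simpa using hu
  have h2 : u.re ≤ ‖u‖ := Complex.re_le_norm u
  have h3 : ‖expBinet κ u‖ ≤ C / u.re := by
    refine (hC u (by linarith) (h1.trans h2)).trans ?_
    gcongr
  exact ⟨h3, h3.trans (div_le_self hC0 h1)⟩

theorem differentiableAt_expBinet (κ : ℤ) {u : ℂ} (hu : (1 - Complex.I).re ≤ u.re) :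
    DifferentiableAt ℂ (expBinet κ) u := by
  refine (differentiableOn_expBinet κ).differentiableAt (Complex.isOpen_slitPlane.mem_nhds ?_)
  left
  have h1 : 1 ≤ u.re := by simpa using hu
  linarith

/-- Below the line `Im u = -1` the quantity `q = exp (-2πiu)` stays in the disc of radius `1 / 2`,
on which `r` is bounded. No such bound holds upwards, so these tails are rotated downwards only. -/
theorem exists_remainder (κ : ℤ) {r : ℂ → ℂ} (hr : DifferentiableOn ℂ r (ball 0 1)) :
    (∀ u : ℂ, (1 - Complex.I).re ≤ u.re → u.im ≤ (1 - Complex.I).im → DifferentiableAt ℂ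
      (fun u => (1 + expBinet κ u) * r (Complex.exp (2 * Real.pi * Complex.I * (-u)))) u) ∧
    ∃ C, ∀ u : ℂ, (1 - Complex.I).re ≤ u.re → u.im ≤ (1 - Complex.I).im →
      ‖(1 + expBinet κ u) * r (Complex.exp (2 * Real.pi * Complex.I * (-u)))‖ ≤ C := by
  have hq (u : ℂ) (hu : u.im ≤ (1 - Complex.I).im) :
      ‖Complex.exp (2 * Real.pi * Complex.I * (-u))‖ ≤ 1 / 2 := by
    have h : u.im ≤ -1 := by simpa using hu
    rw [norm_exp_two_pi_I_mul, Complex.neg_im]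
    refine (exp_neg_two_pi_mul_le (by linarith)).trans ?_
    rw [one_div, one_div]
    refine inv_anti₀ two_pos (by linarith)
  have hsub : closedBall (0 : ℂ) (1 / 2) ⊆ ball 0 1 := closedBall_subset_ball (by norm_num)
  constructor
  · intro u h1 h2
    have h3 : DifferentiableAt ℂ r (Complex.exp (2 * Real.pi * Complex.I * (-u))) :=
      hr.differentiableAt (isOpen_ball.mem_nhds (hsub (by simpa using hq u h2)))
    exact ((differentiableAt_const _).add (differentiableAt_expBinet κ h1)).mul
      (h3.comp (f := fun u => Complex.exp (2 * Real.pi * Complex.I * (-u))) u (by fun_prop))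
  · obtain ⟨C, hC0, hC⟩ := norm_expBinet_le_of_one_le_re κ
    obtain ⟨C', hC'⟩ := (isCompact_closedBall (0 : ℂ) (1 / 2)).exists_bound_of_continuousOn
      (hr.continuousOn.mono hsub)
    refine ⟨(1 + C) * C', fun u h1 h2 => ?_⟩
    rw [norm_mul]
    refine mul_le_mul ((norm_add_le _ _).trans ?_) (hC' _ (by simpa using hq u h2))
      (norm_nonneg _) (by positivity)
    rw [norm_one]
    linarith [(hC u h1).2]

theorem sum_range_succ_eq_add_sum_Icc {α : Type*} [AddCommMonoid α] (f : ℕ → α) (M : ℕ) :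
    ∑ j ∈ Finset.range (M + 1), f j = f 0 + ∑ j ∈ Finset.Icc 1 M, f j := by
  induction M with
  | zero => simp
  | succ M ih =>
    rw [Finset.sum_range_succ, ih, Finset.sum_Icc_succ_top (by omega), add_assoc]

/-- The integrand on the half-line, rewritten with the reflection formula and expanded in powers of
`exp (-2πiu)`. -/
theorem lineIntegral_expansion {κ : ℤ} {c : ℕ → ℝ} (hc : IsReflectionCoeff κ c) (M : ℕ) :
    ∃ (G : ℂ → ℂ) (C : ℝ),
      (∀ u : ℂ, (1 - Complex.I).re ≤ u.re → u.im ≤ (1 - Complex.I).im → DifferentiableAt ℂ G u) ∧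
      (∀ u : ℂ, (1 - Complex.I).re ≤ u.re → u.im ≤ (1 - Complex.I).im → ‖G u‖ ≤ C) ∧
      ∀ x : ℂ, 0 < x.re → lineIntegral κ (-1 + Complex.I) x =
        (∑ j ∈ Finset.range (M + 1), (c j : ℂ) *
          tail (expBinet (-κ)) (1 - Complex.I) (x + 2 * Real.pi * Complex.I * j)) +
        (∑ j ∈ Finset.Icc 1 M, (c j : ℂ) *
          (Complex.exp (-((1 - Complex.I) * (x + 2 * Real.pi * Complex.I * j))) /
            (x + 2 * Real.pi * Complex.I * j))) +
        tail G (1 - Complex.I) (x + 2 * Real.pi * Complex.I * (M + 1)) := by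
  obtain ⟨r, hr, hq⟩ := hc (M + 1)
  obtain ⟨hd, C, hC⟩ := exists_remainder (-κ) hr
  refine ⟨_, C, hd, hC, fun x hx => ?_⟩
  have hre (j : ℂ) (hj : j.im = 0) : 0 < (x + 2 * Real.pi * Complex.I * j).re := by
    simpa [hj] using hx
  set w := 1 - Complex.I with hw
  obtain ⟨CE, -, hCE⟩ := norm_expBinet_le_of_one_le_re (-κ)
  have hwa (a : ℝ) (ha : 0 ≤ a) : (1 - Complex.I).re ≤ (w + a).re := by rw [← hw]; simpa
  have hwi (a : ℝ) : (w + a).im ≤ (1 - Complex.I).im := by rw [← hw]; simp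
  have hi1 (j : ℕ) := integrableOn_tail (G := expBinet (-κ)) (w := w) (C := CE)
    (x := x + 2 * Real.pi * Complex.I * j)
    (fun a ha => ((differentiableAt_expBinet (-κ) (hwa a ha)).continuousAt.comp
      (f := fun a : ℝ => w + a) (by fun_prop)).continuousWithinAt)
    (fun a ha => (hCE _ (hwa a ha)).2) (hre j (by simp))
  have hi2 (j : ℕ) := integrableOn_tail (G := fun _ => 1) (w := w) (C := 1)
    (x := x + 2 * Real.pi * Complex.I * j) (by fun_prop) (by simp) (hre j (by simp))
  have hi3 := integrableOn_tail (w := w) (C := C)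
    (G := fun u => (1 + expBinet (-κ) u) * r (Complex.exp (2 * Real.pi * Complex.I * (-u))))
    (x := x + 2 * Real.pi * Complex.I * (M + 1))
    (fun a ha => ((hd (w + a) (hwa a ha) (hwi a)).continuousAt.comp
      (f := fun a : ℝ => w + a) (by fun_prop)).continuousWithinAt)
    (fun a ha => hC _ (hwa a ha) (hwi a)) (hre (M + 1) (by simp))
  simp_rw [fun j : ℕ => (tail_one (w := w) (hre j (by simp))).symm]
  simp only [tail]
  simp_rw [← integral_const_mul]
  rw [← integral_finsetSum _ fun j _ => (hi1 j).const_mul _,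
    ← integral_finsetSum _ fun j _ => (hi2 j).const_mul _,
    ← integral_add (integrable_finsetSum _ fun j _ => (hi1 j).const_mul _)
      (integrable_finsetSum _ fun j _ => (hi2 j).const_mul _),
    ← integral_add (Integrable.fun_add (integrable_finsetSum _ fun j _ => (hi1 j).const_mul _)
      (integrable_finsetSum _ fun j _ => (hi2 j).const_mul _)) hi3, lineIntegral]
  refine integral_congr_ae (Eventually.of_forall fun a => ?_)
  simp only
  set u : ℂ := w + a with hu
  have hv : -1 + Complex.I - a = -u := by rw [hu, hw]; ring
  have him : (-u).im = 1 := by simp [hu, hw]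
  set q := Complex.exp (2 * Real.pi * Complex.I * (-u)) with hqd
  have hqm : q ∈ ball (0 : ℂ) 1 := by
    rw [mem_ball_zero_iff, hqd, norm_exp_two_pi_I_mul, him]
    refine (exp_neg_two_pi_mul_le le_rfl).trans_lt (by norm_num)
  -- A power of `q` amounts to a translation of `x` by `2πij`.
  have he (j : ℕ) : Complex.exp (-u * (x + 2 * Real.pi * Complex.I * j)) =
      q ^ j * Complex.exp (-u * x) := by
    rw [hqd, ← Complex.exp_nat_mul, ← Complex.exp_add]
    ring_nf
  have he' : Complex.exp (-u * (x + 2 * Real.pi * Complex.I * (M + 1))) =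
      q ^ (M + 1) * Complex.exp (-u * x) := by
    have := he (M + 1)
    push_cast at this
    exact this
  have hE : expBinet κ (-u) = (1 + expBinet (-κ) u) * (1 - q) ^ (-κ) - 1 := by
    rw [expBinet, exp_binet_reflect κ (by rw [him]; exact one_pos), expBinet, neg_neg]
    ring
  -- The coefficient `c 0 = 1` cancels the `-1` in `hE`; hence the pole terms start at `j = 1` and
  -- the origin is regular.
  have hs := sum_range_succ_eq_add_sum_Icc (fun j => (c j : ℂ) * q ^ j) M
  simp only [hc.zero_eq_one, Complex.ofReal_one, pow_zero, mul_one] at hs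
  have hs1 : ∑ j ∈ Finset.range (M + 1), (c j : ℂ) * (expBinet (-κ) u *
      Complex.exp (-u * (x + 2 * Real.pi * Complex.I * j))) =
      (∑ j ∈ Finset.range (M + 1), (c j : ℂ) * q ^ j) * (expBinet (-κ) u * Complex.exp (-u * x)) := by
    rw [Finset.sum_mul]
    refine Finset.sum_congr rfl fun j _ => ?_
    rw [he]; ring
  have hs2 : ∑ j ∈ Finset.Icc 1 M, (c j : ℂ) * (1 *
      Complex.exp (-u * (x + 2 * Real.pi * Complex.I * j))) =
      (∑ j ∈ Finset.Icc 1 M, (c j : ℂ) * q ^ j) * Complex.exp (-u * x) := by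
    rw [Finset.sum_mul]
    refine Finset.sum_congr rfl fun j _ => ?_
    rw [he]; ring
  rw [hv, hE, hq q hqm, hs1, hs2, he', hs]
  ring

/-- The analytic continuation of `tail G w` from either half of the right half plane. -/
noncomputable def tailExt (G : ℂ → ℂ) (w x : ℂ) : ℂ :=
  if 0 < x.im then tailDown G w x else tailUp G w x

theorem differentiableAt_tailExt {G : ℂ → ℂ} {w x : ℂ} {C : ℝ}
    (hG : ∀ u : ℂ, w.re ≤ u.re → DifferentiableAt ℂ G u)
    (hC : ∀ u : ℂ, w.re ≤ u.re → ‖G u‖ ≤ C) (hx : x.im ≠ 0) :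
    DifferentiableAt ℂ (tailExt G w) x := by
  rcases hx.lt_or_gt with h | h
  · refine (differentiableAt_tailUp (fun u h1 _ => hG u h1) (fun u h1 _ => hC u h1)
      h).congr_of_eventuallyEq ?_
    filter_upwards [(isOpen_Iio.preimage Complex.continuous_im).mem_nhds h] with y hy
    exact if_neg (mem_Iio.1 hy).not_gt
  · refine (differentiableAt_tailDown (fun u h1 _ => hG u h1) (fun u h1 _ => hC u h1)
      h).congr_of_eventuallyEq ?_
    filter_upwards [(isOpen_Ioi.preimage Complex.continuous_im).mem_nhds h] with y hy
    exact if_pos hy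

theorem tail_eq_tailExt {G : ℂ → ℂ} {w x : ℂ} {C : ℝ}
    (hG : ∀ u : ℂ, w.re ≤ u.re → DifferentiableAt ℂ G u)
    (hC : ∀ u : ℂ, w.re ≤ u.re → ‖G u‖ ≤ C) (hx : x.im ≠ 0) (hx' : 0 < x.re) :
    tail G w x = tailExt G w x := by
  rw [tailExt]
  split_ifs with h
  · exact tail_eq_tailDown (fun u h1 _ => hG u h1) (fun u h1 _ => hC u h1) hx' h
  · exact tail_eq_tailUp (fun u h1 _ => hG u h1) (fun u h1 _ => hC u h1) hx'
      (lt_of_le_of_ne (not_lt.1 h) hx)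

/-- Each tail of the expansion is rotated according to the sign of its own shifted imaginary part,
nonzero by assumption. The remainder must be rotated downwards; the lower bound on `Im x` makes its
shifted imaginary part positive. -/
theorem exists_lineIntegral_extension {κ : ℤ} {c : ℕ → ℝ} (hc : IsReflectionCoeff κ c) (M : ℕ) :
    ∃ Y : ℂ → ℂ, ∀ x : ℂ, -(2 * Real.pi * (M + 1)) < x.im →
      (∀ j ≤ M, x.im + 2 * Real.pi * (j : ℕ) ≠ 0) → DifferentiableAt ℂ Y x ∧
      (0 < x.re → lineIntegral κ (-1 + Complex.I) x = Y x) := by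
  obtain ⟨G, C, hd, hC, h⟩ := lineIntegral_expansion hc M
  obtain ⟨CE, -, hCE⟩ := norm_expBinet_le_of_one_le_re (-κ)
  refine ⟨fun x => (∑ j ∈ Finset.range (M + 1), (c j : ℂ) *
          tailExt (expBinet (-κ)) (1 - Complex.I) (x + 2 * Real.pi * Complex.I * j)) +
        (∑ j ∈ Finset.Icc 1 M, (c j : ℂ) *
          (Complex.exp (-((1 - Complex.I) * (x + 2 * Real.pi * Complex.I * j))) /
            (x + 2 * Real.pi * Complex.I * j))) +
        tailDown G (1 - Complex.I) (x + 2 * Real.pi * Complex.I * (M + 1)), fun x h1 h2 => ?_⟩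
  have him (j : ℕ) (hj : j ≤ M) : (x + 2 * Real.pi * Complex.I * j).im ≠ 0 := by
    simpa using h2 j hj
  have him' : 0 < (x + 2 * Real.pi * Complex.I * (M + 1)).im := by
    simp; linarith
  have hre (j : ℂ) (hj : j.im = 0) (hx : 0 < x.re) :
      0 < (x + 2 * Real.pi * Complex.I * j).re := by simpa [hj] using hx
  constructor
  · refine (DifferentiableAt.add (DifferentiableAt.fun_sum fun j hj => ?_)
      (DifferentiableAt.fun_sum fun j hj => ?_)).add ?_
    · have := him j (by simpa [Nat.lt_succ_iff] using hj)
      refine DifferentiableAt.const_mul ?_ _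
      exact (differentiableAt_tailExt (fun u hu => differentiableAt_expBinet (-κ) hu)
        (fun u hu => (hCE u hu).2) this).comp (f := fun x => x + 2 * Real.pi * Complex.I * j) x
        (by fun_prop)
    · have := him j (Finset.mem_Icc.1 hj).2
      have h0 : x + 2 * Real.pi * Complex.I * j ≠ 0 := fun h => this (by rw [h]; rfl)
      have h3 : DifferentiableAt ℂ (fun x : ℂ =>
          Complex.exp (-((1 - Complex.I) * (x + 2 * Real.pi * Complex.I * j)))) x := by fun_prop
      exact (h3.div (by fun_prop : DifferentiableAt ℂ
        (fun x : ℂ => x + 2 * Real.pi * Complex.I * j) x) h0).const_mul _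
    · exact (differentiableAt_tailDown hd hC him').comp
        (f := fun x => x + 2 * Real.pi * Complex.I * (M + 1)) x (by fun_prop)
  · intro hx
    rw [h x hx, tail_eq_tailDown hd hC (hre _ (by simp) hx) him']
    congr 2
    refine Finset.sum_congr rfl fun j hj => ?_
    rw [tail_eq_tailExt (fun u hu => differentiableAt_expBinet (-κ) hu)
        (fun u hu => (hCE u hu).2) (him j (by simpa [Nat.lt_succ_iff] using hj))
        (hre _ (by simp) hx)]

/-- `borel κ` continues analytically from the right half plane to the strips between the poles. -/
theorem exists_borel_extension {κ : ℤ} {c : ℕ → ℝ} (hc : IsReflectionCoeff κ c) (M : ℕ) :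
    ∃ A : ℂ → ℂ, ∀ x : ℂ, |x.im| < 2 * Real.pi * (M + 1) →
      (∀ j ≤ M, |x.im| ≠ 2 * Real.pi * (j : ℕ)) → DifferentiableAt ℂ A x ∧
      (0 < x.re → borel κ x = A x) := by
  obtain ⟨Y, hY⟩ := exists_lineIntegral_extension hc M
  obtain ⟨V, hV, h⟩ := exists_borel_eq_lineIntegral κ
  -- The conjugate half-line is continued by the reflected function, evaluated through `conj x`;
  -- this is why the hypotheses involve `|Im x|`.
  refine ⟨fun x => (V x + Complex.I * Y x + reflect (fun x => Complex.I * Y x) x) /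
    (2 * Real.pi), fun x h1 h2 => ?_⟩
  have hj (j : ℕ) (hj : j ≤ M) : x.im + 2 * Real.pi * j ≠ 0 ∧ -x.im + 2 * Real.pi * j ≠ 0 := by
    have h0 := h2 j hj
    have h3 : (0 : ℝ) ≤ 2 * Real.pi * j := by positivity
    refine ⟨fun h4 => h0 ?_, fun h4 => h0 ?_⟩
    · rw [abs_of_nonpos (by linarith)]; linarith
    · rw [abs_of_nonneg (by linarith)]; linarith
  rw [abs_lt] at h1
  have hY1 := hY x h1.1 fun j hjM => (hj j hjM).1
  have hY2 := hY ((starRingEnd ℂ) x) (by rw [Complex.conj_im]; linarith [h1.2]) fun j hjM => by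
    rw [Complex.conj_im]
    exact (hj j hjM).2
  constructor
  · exact ((hV.differentiableAt.add (hY1.1.const_mul _)).add
      (differentiableAt_reflect (hY2.1.const_mul _))).div_const _
  · intro hx
    simp only [reflect]
    rw [← hY1.2 hx, ← hY2.2 (by simpa using hx), ← h x hx]
    field_simp

/-! ### Estimate of `borel κ` near its poles -/

/-- The decay `O(1 / Re u)` of the integrand along the half-line leaves only a logarithm as `Re x`
tends to zero. -/
theorem norm_tail_expBinet_le (κ : ℤ) : ∃ C, 0 ≤ C ∧ ∀ x : ℂ, 0 < x.re →
    ‖tail (expBinet κ) (1 - Complex.I) x‖ ≤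
      C * Real.exp (2 * ‖x‖) * (1 + Real.log (1 + 1 / x.re)) := by
  obtain ⟨C, hC0, hC⟩ := norm_expBinet_le_of_one_le_re κ
  refine ⟨C, hC0, fun x hx => ?_⟩
  obtain ⟨hi, hle⟩ := integral_exp_div_one_add_le hx
  have h1 : ‖tail (expBinet κ) (1 - Complex.I) x‖ ≤
      ∫ a in Ioi (0 : ℝ), C * Real.exp (2 * ‖x‖) * (Real.exp (-x.re * a) / (1 + a)) := by
    refine norm_integral_le_of_norm_le (hi.const_mul _) ?_
    filter_upwards [ae_restrict_mem measurableSet_Ioi] with a ha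
    have ha0 : (0 : ℝ) < a := ha
    have h2 := (hC (1 - Complex.I + a) (by simpa using ha0.le)).1
    have h3 : (1 - Complex.I + (a : ℂ)).re = 1 + a := by simp
    rw [h3] at h2
    have h4 : ‖Complex.exp (-(1 - Complex.I + a) * x)‖ ≤
        Real.exp (2 * ‖x‖) * Real.exp (-x.re * a) := by
      rw [Complex.norm_exp, ← Real.exp_add, Real.exp_le_exp]
      have h5 := Complex.abs_re_le_norm x
      have h6 := Complex.abs_im_le_norm x
      rw [abs_le] at h5 h6
      simp
      nlinarith
    rw [norm_mul]
    calc _ ≤ C / (1 + a) * (Real.exp (2 * ‖x‖) * Real.exp (-x.re * a)) := by gcongr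
      _ = _ := by ring
  refine h1.trans ?_
  rw [integral_const_mul]
  gcongr

/-- The exponential attached to a pole term equals `1` at the pole, so it may be dropped at a
bounded cost. -/
theorem norm_exp_div_sub_inv_le (w y : ℂ) :
    ‖Complex.exp (-(w * y)) / y - 1 / y‖ ≤ ‖w‖ * Real.exp (‖w‖ * ‖y‖) := by
  rcases eq_or_ne y 0 with rfl | hy
  · simp
  have h3 := Complex.norm_exp_sub_sum_le_norm_mul_exp (-(w * y)) 1
  simp only [Finset.range_one, Finset.sum_singleton, pow_zero, Nat.factorial_zero, Nat.cast_one,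
    div_one, pow_one, norm_neg, norm_mul] at h3
  rw [← sub_div, norm_div, div_le_iff₀ (norm_pos_iff.2 hy)]
  linarith

theorem norm_one_sub_I_le : ‖1 - Complex.I‖ ≤ 2 := by
  refine (norm_sub_le _ _).trans ?_
  rw [norm_one, Complex.norm_I]; norm_num

theorem norm_add_two_pi_le (x : ℂ) (j : ℕ) :
    ‖x + 2 * Real.pi * Complex.I * j‖ ≤ ‖x‖ + 2 * Real.pi * j := by
  refine (norm_add_le _ _).trans (le_of_eq ?_)
  simp [abs_of_pos Real.pi_pos]

theorem norm_le_of_eq_add_add {a b c d : ℂ} {x y z : ℝ} (h1 : ‖a‖ ≤ x) (h2 : ‖b‖ ≤ y)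
    (h3 : ‖c‖ ≤ z) (h : d = a + b + c) : ‖d‖ ≤ x + y + z := by
  rw [h]
  exact (norm_add₃_le).trans (by gcongr)

/-- In the expansion the tails of `expBinet` are logarithmic and the exponential terms are poles up
to bounded errors. The lower bound on `Im x` keeps the shifted point of the remainder above height
`1`, where its rotated form is bounded. -/
theorem exists_norm_lineIntegral_sub_le {κ : ℤ} {c : ℕ → ℝ} (hc : IsReflectionCoeff κ c) (M : ℕ)
    (R : ℝ) : ∃ C, 0 ≤ C ∧ ∀ x : ℂ, 0 < x.re → -(2 * Real.pi * M) ≤ x.im → ‖x‖ ≤ R →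
      ‖lineIntegral κ (-1 + Complex.I) x -
        ∑ j ∈ Finset.Icc 1 M, (c j : ℂ) * (1 / (x + 2 * Real.pi * Complex.I * j))‖ ≤
      C * (1 + Real.log (1 + 1 / x.re)) := by
  obtain ⟨G, CG, hd, hCG, h⟩ := lineIntegral_expansion hc M
  obtain ⟨CE, hCE0, hCE⟩ := norm_tail_expBinet_le (-κ)
  have hCG0 : 0 ≤ CG := (norm_nonneg _).trans (hCG (1 - Complex.I) le_rfl le_rfl)
  set R' := R + 2 * Real.pi * (M + 1) with hR'
  refine ⟨(∑ j ∈ Finset.range (M + 1), |c j| * (CE * Real.exp (2 * R'))) +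
    (∑ j ∈ Finset.Icc 1 M, |c j| * (2 * Real.exp (2 * R'))) + CG * Real.exp (2 * R'),
    by positivity, fun x hx hx' hxR => ?_⟩
  have hlog : 0 ≤ Real.log (1 + 1 / x.re) :=
    Real.log_nonneg (by have : 0 < 1 / x.re := by positivity
                        linarith)
  have hL : 1 ≤ 1 + Real.log (1 + 1 / x.re) := by linarith
  have hpi := Real.pi_pos
  have hnorm (j : ℕ) (hj : j ≤ M + 1) : ‖x + 2 * Real.pi * Complex.I * j‖ ≤ R' := by
    refine (norm_add_two_pi_le x j).trans ?_
    have : (j : ℝ) ≤ M + 1 := by exact_mod_cast hj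
    rw [hR']
    gcongr
  have hre (j : ℕ) : (x + 2 * Real.pi * Complex.I * j).re = x.re := by simp
  have h1 : ‖∑ j ∈ Finset.range (M + 1), (c j : ℂ) *
      tail (expBinet (-κ)) (1 - Complex.I) (x + 2 * Real.pi * Complex.I * j)‖ ≤
      (∑ j ∈ Finset.range (M + 1), |c j| * (CE * Real.exp (2 * R'))) *
        (1 + Real.log (1 + 1 / x.re)) := by
    rw [Finset.sum_mul]
    refine norm_sum_le_of_le _ fun j hj => ?_
    have h2 := hCE (x + 2 * Real.pi * Complex.I * j) (by rw [hre]; exact hx)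
    rw [hre] at h2
    rw [norm_mul, Complex.norm_real, Real.norm_eq_abs, mul_assoc |c j|]
    refine mul_le_mul_of_nonneg_left (h2.trans ?_) (abs_nonneg _)
    have := hnorm j (by simp at hj; omega)
    gcongr
  have h2 : ‖(∑ j ∈ Finset.Icc 1 M, (c j : ℂ) *
          (Complex.exp (-((1 - Complex.I) * (x + 2 * Real.pi * Complex.I * j))) /
            (x + 2 * Real.pi * Complex.I * j))) -
        ∑ j ∈ Finset.Icc 1 M, (c j : ℂ) * (1 / (x + 2 * Real.pi * Complex.I * j))‖ ≤
      ∑ j ∈ Finset.Icc 1 M, |c j| * (2 * Real.exp (2 * R')) := by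
    rw [← Finset.sum_sub_distrib]
    refine norm_sum_le_of_le _ fun j hj => ?_
    rw [← mul_sub, norm_mul, Complex.norm_real, Real.norm_eq_abs]
    refine mul_le_mul_of_nonneg_left ((norm_exp_div_sub_inv_le _ _).trans ?_) (abs_nonneg _)
    have h3 := hnorm j (by simp at hj; omega)
    have h4 := norm_one_sub_I_le
    gcongr
  have h3 : ‖tail G (1 - Complex.I) (x + 2 * Real.pi * Complex.I * (M + 1))‖ ≤
      CG * Real.exp (2 * R') := by
    have hn := hnorm (M + 1) le_rfl
    push_cast at hn
    have hy1 : 1 ≤ (x + 2 * Real.pi * Complex.I * (M + 1)).im := by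
      simp
      linarith [Real.pi_gt_three]
    rw [tail_eq_tailDown hd hCG (by simpa) (by linarith)]
    refine (norm_tailDown_le hCG (by linarith)).trans ?_
    refine (div_le_self (by positivity) hy1).trans ?_
    gcongr
    rw [← Complex.neg_re]
    refine (Complex.re_le_norm _).trans ?_
    rw [norm_neg, norm_mul]
    exact mul_le_mul norm_one_sub_I_le hn (norm_nonneg _) two_pos.le
  rw [h x hx]
  refine (norm_le_of_eq_add_add h1 h2 h3 ?_).trans ?_
  · ring
  · have e2 : 0 ≤ ∑ j ∈ Finset.Icc 1 M, |c j| * (2 * Real.exp (2 * R')) := by positivity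
    have e3 : 0 ≤ CG * Real.exp (2 * R') := by positivity
    nlinarith

/-- For `Im x ≥ 0` the half-line evaluated at `x` meets no pole, and the expansion of order `0`
suffices. The conjugate half-line is evaluated at `conj x`, with `Im (conj x) ≥ -2πK`, and carries
the poles up to order `K`. -/
theorem exists_norm_borel_sub_le_inv_re {κ : ℤ} {c : ℕ → ℝ} (hc : IsReflectionCoeff κ c) (K : ℕ) :
    ∃ C, 0 ≤ C ∧ ∀ x : ℂ, 0 < x.re → 0 ≤ x.im → ‖x‖ ≤ 2 * Real.pi * K →
      ‖borel κ x - ∑ j ∈ Finset.Icc 1 K,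
        (c j : ℂ) * (1 / (2 * Real.pi * Complex.I * (x - 2 * Real.pi * Complex.I * j)))‖ ≤
      C * (1 + Real.log (1 + 1 / x.re)) := by
  obtain ⟨V, hV, h⟩ := exists_borel_eq_lineIntegral κ
  obtain ⟨C₀, hC₀0, hC₀⟩ := exists_norm_lineIntegral_sub_le hc 0 (2 * Real.pi * K)
  obtain ⟨C₁, hC₁0, hC₁⟩ := exists_norm_lineIntegral_sub_le hc K (2 * Real.pi * K)
  obtain ⟨C₂, hC₂⟩ := (isCompact_closedBall (0 : ℂ) (2 * Real.pi * K)).exists_bound_of_continuousOn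
    hV.continuous.continuousOn
  have hC₂0 : 0 ≤ C₂ := (norm_nonneg _).trans (hC₂ 0 (by simp; positivity))
  refine ⟨C₂ + C₀ + C₁, by positivity, fun x hx hx' hxK => ?_⟩
  have hpi := Real.pi_gt_three
  have hL : 0 ≤ Real.log (1 + 1 / x.re) :=
    Real.log_nonneg (by have : 0 < 1 / x.re := by positivity
                        linarith)
  have h0 := hC₀ x hx (by simpa using hx') hxK
  have him : x.im ≤ 2 * Real.pi * K := ((le_abs_self _).trans (Complex.abs_im_le_norm x)).trans hxK
  have h1 := hC₁ ((starRingEnd ℂ) x) (by simpa using hx) (by simpa using him) (by simpa using hxK)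
  have h2 := hC₂ x (by simpa using hxK)
  simp only [Complex.conj_re] at h1
  simp only [zero_lt_one, Finset.Icc_eq_empty_of_lt, Finset.sum_empty, sub_zero] at h0
  have hs : (starRingEnd ℂ) (Complex.I * ∑ j ∈ Finset.Icc 1 K, (c j : ℂ) *
      (1 / ((starRingEnd ℂ) x + 2 * Real.pi * Complex.I * j))) = 2 * Real.pi *
      ∑ j ∈ Finset.Icc 1 K, (c j : ℂ) *
        (1 / (2 * Real.pi * Complex.I * (x - 2 * Real.pi * Complex.I * j))) := by
    simp only [map_mul, map_sum, map_div₀, map_add, map_one, Complex.conj_I, Complex.conj_conj,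
      Complex.conj_ofReal, map_natCast, map_ofNat]
    rw [Finset.mul_sum, Finset.mul_sum]
    refine Finset.sum_congr rfl fun j _ => ?_
    have e : x + 2 * Real.pi * -Complex.I * j = x - 2 * Real.pi * Complex.I * j := by ring
    have hp : (Real.pi : ℂ) ≠ 0 := by exact_mod_cast Real.pi_ne_zero
    rw [e, one_div, one_div, mul_inv, mul_inv, Complex.inv_I, mul_inv]
    field_simp
  have hk := h x hx
  have e1 : 2 * Real.pi * (borel κ x - ∑ j ∈ Finset.Icc 1 K, (c j : ℂ) *
        (1 / (2 * Real.pi * Complex.I * (x - 2 * Real.pi * Complex.I * j)))) =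
      V x + Complex.I * lineIntegral κ (-1 + Complex.I) x + (starRingEnd ℂ) (Complex.I *
        (lineIntegral κ (-1 + Complex.I) ((starRingEnd ℂ) x) - ∑ j ∈ Finset.Icc 1 K, (c j : ℂ) *
      (1 / ((starRingEnd ℂ) x + 2 * Real.pi * Complex.I * j)))) := by
    rw [mul_sub Complex.I, map_sub, hs, mul_sub, hk]
    ring
  have h3 := norm_le_of_eq_add_add h2 (a := V x)
    (b := Complex.I * lineIntegral κ (-1 + Complex.I) x)
    (c := (starRingEnd ℂ) (Complex.I *
        (lineIntegral κ (-1 + Complex.I) ((starRingEnd ℂ) x) - ∑ j ∈ Finset.Icc 1 K, (c j : ℂ) *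
      (1 / ((starRingEnd ℂ) x + 2 * Real.pi * Complex.I * j)))))
    (le_of_eq_of_le (by rw [norm_mul, Complex.norm_I, one_mul]) h0)
    (le_of_eq_of_le (by rw [Complex.norm_conj, norm_mul, Complex.norm_I, one_mul]) h1) e1
  have h4 : ‖(2 * Real.pi : ℂ)‖ = 2 * Real.pi := by
    simp [abs_of_pos Real.pi_pos]
  rw [norm_mul, h4] at h3
  refine (le_mul_of_one_le_left (norm_nonneg _) ?_).trans (h3.trans ?_)
  · linarith
  · nlinarith

theorem two_pi_sub_le_norm (x : ℂ) (j : ℕ) :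
    2 * Real.pi * j - ‖x‖ ≤ ‖x - 2 * Real.pi * Complex.I * j‖ := by
  have h := norm_sub_norm_le (2 * Real.pi * Complex.I * j) x
  have h2 : ‖(2 * Real.pi * Complex.I * j : ℂ)‖ = 2 * Real.pi * j := by
    simp [abs_of_pos Real.pi_pos]
  rw [h2, norm_sub_rev] at h
  exact h

theorem log_one_add_nonneg {y : ℝ} (hy : 0 ≤ y) : 0 ≤ Real.log (1 + y) :=
  Real.log_nonneg (by linarith)

/-- In the right half plane, above the real axis, `borel κ` differs from its poles by a function with
at most a logarithmic singularity at the imaginary axis. -/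
theorem exists_norm_borel_sub_le {κ : ℤ} {c : ℕ → ℝ} (hc : IsReflectionCoeff κ c) (K : ℕ) :
    ∃ C, 0 ≤ C ∧ ∀ x : ℂ, 0 < x.re → 0 ≤ x.im → ‖x‖ ≤ 2 * Real.pi * K →
      ‖borel κ x - ∑ j ∈ Finset.Icc 1 K,
        (c j : ℂ) * (1 / (2 * Real.pi * Complex.I * (x - 2 * Real.pi * Complex.I * j)))‖ ≤
      C * (1 + Real.log (1 + ‖x‖ / |x.re|)) := by
  obtain ⟨C₀, hC₀0, hC₀⟩ := exists_norm_borel_sub_le_inv_re hc K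
  have hpi := Real.pi_gt_three
  obtain ⟨C₁, hC₁⟩ := (isCompact_closedBall (0 : ℂ) 1).exists_bound_of_continuousOn
    ((differentiableOn_borel κ).continuousOn.mono fun x hx => by
      right
      have := Complex.abs_im_le_norm x
      have hx' : ‖x‖ ≤ 1 := by simpa using hx
      linarith)
  have hC₁0 : 0 ≤ C₁ := (norm_nonneg _).trans (hC₁ 0 (by simp))
  refine ⟨C₀ + (C₁ + ∑ j ∈ Finset.Icc 1 K, |c j|), by positivity, fun x hx hx' hxK => ?_⟩
  have hS : 0 ≤ ∑ j ∈ Finset.Icc 1 K, |c j| := by positivity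
  have hL := log_one_add_nonneg (y := ‖x‖ / |x.re|) (by positivity)
  -- Near the origin everything is bounded; elsewhere `1 / Re x ≤ ‖x‖ / |Re x|`. The resulting bound
  -- depends on the angle only, as needed for uniformity when `x` tends to `0`.
  rcases le_total ‖x‖ 1 with h | h
  · have h1 : ‖borel κ x - ∑ j ∈ Finset.Icc 1 K, (c j : ℂ) *
        (1 / (2 * Real.pi * Complex.I * (x - 2 * Real.pi * Complex.I * j)))‖ ≤
        C₁ + ∑ j ∈ Finset.Icc 1 K, |c j| := by
      refine (norm_sub_le _ _).trans (add_le_add (hC₁ x (by simpa using h)) ?_)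
      refine norm_sum_le_of_le _ fun j hj => ?_
      have hj1 : (1 : ℝ) ≤ j := by exact_mod_cast (Finset.mem_Icc.1 hj).1
      have h2 := two_pi_sub_le_norm x j
      have h3 : 1 ≤ ‖x - 2 * Real.pi * Complex.I * j‖ := by nlinarith
      rw [norm_mul, Complex.norm_real, Real.norm_eq_abs]
      refine mul_le_of_le_one_right (abs_nonneg _) ?_
      rw [norm_div, norm_one, norm_mul]
      refine div_le_one_of_le₀ ?_ (by positivity)
      have h4 : ‖(2 * Real.pi * Complex.I : ℂ)‖ = 2 * Real.pi := by
        simp [abs_of_pos Real.pi_pos]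
      rw [h4]
      nlinarith
    refine h1.trans ?_
    nlinarith
  · refine (hC₀ x hx hx' hxK).trans ?_
    have h1 : Real.log (1 + 1 / x.re) ≤ Real.log (1 + ‖x‖ / |x.re|) := by
      rw [abs_of_pos hx]
      gcongr
    nlinarith

/-- In the left half plane the poles come from `borel (-κ)`. -/
theorem exists_norm_borel_add_le {κ : ℤ} {c : ℕ → ℝ} (hc : IsReflectionCoeff (-κ) c) (K : ℕ) :
    ∃ C, 0 ≤ C ∧ ∀ x : ℂ, x.re < 0 → 0 ≤ x.im → ‖x‖ ≤ 2 * Real.pi * K →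
      ‖borel κ x + ∑ j ∈ Finset.Icc 1 K,
        (c j : ℂ) * (1 / (2 * Real.pi * Complex.I * (x - 2 * Real.pi * Complex.I * j)))‖ ≤
      C * (1 + Real.log (1 + ‖x‖ / |x.re|)) := by
  obtain ⟨C, hC0, hC⟩ := exists_norm_borel_sub_le hc K
  refine ⟨C, hC0, fun x hx hx' hxK => ?_⟩
  -- The reflection `x ↦ -conj x` in the imaginary axis exchanges the sides of the cut while keeping
  -- the upper half plane.
  have h := hC (-(starRingEnd ℂ) x) (by simpa using hx) (by simpa using hx') (by simpa using hxK)
  rw [norm_neg, Complex.norm_conj, Complex.neg_re, Complex.conj_re, abs_neg, ← Complex.norm_conj,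
    map_sub, ← borel_conj, map_neg, Complex.conj_conj, borel_neg, neg_neg, map_sum] at h
  rw [← norm_neg]
  refine le_of_eq_of_le (congrArg norm ?_) h
  rw [neg_add', sub_right_inj]
  refine Finset.sum_congr rfl fun j _ => ?_
  simp only [map_mul, map_div₀, map_one, map_sub, map_neg, Complex.conj_conj, Complex.conj_I,
    Complex.conj_ofReal, map_natCast, map_ofNat]
  congr 2
  ring

/-! ### Integrals along rays close to the poles -/

/-- Projecting `a` to the unit interval only increases the integrand; each of the two sides of the
projected point then gives at most `log (1 + 1 / d)`. -/
theorem integral_inv_abs_sub_add_le (a : ℝ) {d : ℝ} (hd : 0 < d) :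
    ∫ t in (0 : ℝ)..1, (|t - a| + d)⁻¹ ≤ 2 * Real.log (1 + 1 / d) := by
  set b := max 0 (min 1 a) with hb
  have hb0 : 0 ≤ b := le_max_left _ _
  have hb1 : b ≤ 1 := max_le zero_le_one (min_le_left _ _)
  have hcont (e : ℝ) (u v : ℝ) :
      IntervalIntegrable (fun t : ℝ => (|t - e| + d)⁻¹) volume u v :=
    (Continuous.inv₀ (by fun_prop) fun t => by positivity).intervalIntegrable _ _
  have h1 : ∫ t in (0 : ℝ)..1, (|t - a| + d)⁻¹ ≤ ∫ t in (0 : ℝ)..1, (|t - b| + d)⁻¹ := by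
    refine intervalIntegral.integral_mono_on zero_le_one (hcont _ _ _) (hcont _ _ _) fun t ht => ?_
    have : |t - b| ≤ |t - a| := by
      rcases le_total a 0 with h | h
      · have : b = 0 := by rw [hb]; exact max_eq_left ((min_le_right _ _).trans h)
        rw [this, abs_of_nonneg (by linarith [ht.1]), abs_of_nonneg (by linarith [ht.1])]
        linarith
      · rcases le_total a 1 with h' | h'
        · have : b = a := by rw [hb, min_eq_right h', max_eq_right h]
          rw [this]
        · have : b = 1 := by rw [hb, min_eq_left h', max_eq_right zero_le_one]
          rw [this, abs_of_nonpos (by linarith [ht.2]), abs_of_nonpos (by linarith [ht.2])]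
          linarith
    gcongr
  refine h1.trans ?_
  rw [← intervalIntegral.integral_add_adjacent_intervals (hcont b 0 b) (hcont b b 1), two_mul]
  refine add_le_add ?_ ?_
  · have : ∫ t in (0 : ℝ)..b, (|t - b| + d)⁻¹ = ∫ t in (0 : ℝ)..b, ((b + d) - t)⁻¹ := by
      refine intervalIntegral.integral_congr fun t ht => ?_
      rw [uIcc_of_le hb0] at ht
      rw [abs_of_nonpos (by linarith [ht.2])]
      congr 1; ring
    rw [this, intervalIntegral.integral_comp_sub_left (fun t : ℝ => t⁻¹), add_sub_cancel_left,
      sub_zero, integral_inv_of_pos hd (by positivity)]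
    refine Real.log_le_log (by positivity) ?_
    rw [div_le_iff₀ hd]
    field_simp
    linarith
  · have : ∫ t in b..1, (|t - b| + d)⁻¹ = ∫ t in b..1, (t - (b - d))⁻¹ := by
      refine intervalIntegral.integral_congr fun t ht => ?_
      rw [uIcc_of_le hb1] at ht
      rw [abs_of_nonneg (by linarith [ht.1])]
      congr 1; ring
    rw [this, intervalIntegral.integral_comp_sub_right (fun t : ℝ => t⁻¹), sub_sub_cancel,
      integral_inv_of_pos hd (by linarith)]
    refine Real.log_le_log (div_pos (by linarith) hd) ?_
    rw [div_le_iff₀ hd]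
    field_simp
    linarith

theorem abs_re_add_abs_im_le (x : ℂ) : |x.re| + |x.im| ≤ 2 * ‖x‖ := by
  linarith [Complex.abs_re_le_norm x, Complex.abs_im_le_norm x]

/-- Write `tx - 2πij = x (t - p)`. The pole parameter satisfies `|Im p| = 2πj |Re x| / ‖x‖²`, at
least `|Re x| / (K ‖x‖)`, so the pole is seen from the real segment at a distance comparable to the
angle with the cut. -/
theorem integral_norm_inv_sub_le {x : ℂ} (hx : x.re ≠ 0) {K j : ℕ} (hK : ‖x‖ ≤ 2 * Real.pi * K)
    (hj : 1 ≤ j) : ‖x‖ * ∫ t in (0 : ℝ)..1, ‖t * x - 2 * Real.pi * Complex.I * j‖⁻¹ ≤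
      4 * (Real.log (1 + K) + Real.log (1 + ‖x‖ / |x.re|)) := by
  have hx0 : x ≠ 0 := fun h => hx (by rw [h]; rfl)
  have hn : 0 < ‖x‖ := norm_pos_iff.2 hx0
  have hpi := Real.pi_pos
  have hK0 : (0 : ℝ) < K := by
    by_contra! h
    nlinarith
  set p : ℂ := 2 * Real.pi * Complex.I * j / x with hp
  have hpim : |p.im| = 2 * Real.pi * j * |x.re| / ‖x‖ ^ 2 := by
    have h1 : p = ((2 * Real.pi * j : ℝ) : ℂ) * (Complex.I / x) := by
      rw [hp]; push_cast; ring
    rw [h1, Complex.im_ofReal_mul, Complex.div_im, abs_mul, abs_of_nonneg (by positivity)]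
    simp [Complex.normSq_eq_norm_sq, abs_div]
    ring
  set d := |x.re| / (K * ‖x‖) with hd
  have hd0 : 0 < d := by positivity
  have hdp : d ≤ |p.im| := by
    rw [hpim, hd, div_le_div_iff₀ (by positivity) (by positivity)]
    have hj' : (1 : ℝ) ≤ j := by exact_mod_cast hj
    calc |x.re| * ‖x‖ ^ 2 = |x.re| * ‖x‖ * ‖x‖ := by ring
      _ ≤ |x.re| * ‖x‖ * (2 * Real.pi * K) := by gcongr
      _ = 2 * Real.pi * 1 * |x.re| * (K * ‖x‖) := by ring
      _ ≤ _ := by gcongr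
  have hlow (t : ℝ) : ‖x‖ * ‖t * x - 2 * Real.pi * Complex.I * j‖⁻¹ ≤
      2 * (|t - p.re| + d)⁻¹ := by
    have h1 : t * x - 2 * Real.pi * Complex.I * j = x * (t - p) := by
      rw [hp]; field_simp
    rw [h1, norm_mul, mul_inv, ← mul_assoc, mul_inv_cancel₀ hn.ne', one_mul]
    have h2 := abs_re_add_abs_im_le (t - p)
    have h3 : (t - p).re = t - p.re := by simp
    have h4 : |(t - p).im| = |p.im| := by simp
    rw [h3, h4] at h2
    rw [← one_div, ← div_eq_mul_inv, div_le_div_iff₀ _ (by positivity)]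
    · linarith
    · have : 0 < |t - p.re| + d := by positivity
      linarith
  rw [← intervalIntegral.integral_const_mul]
  have h5 : ∫ t in (0 : ℝ)..1, ‖x‖ * ‖t * x - 2 * Real.pi * Complex.I * j‖⁻¹ ≤
      ∫ t in (0 : ℝ)..1, 2 * (|t - p.re| + d)⁻¹ := by
    refine intervalIntegral.integral_mono_on zero_le_one ?_ ?_ fun t _ => hlow t
    · refine (Continuous.mul continuous_const (Continuous.inv₀ (by fun_prop) fun t h => ?_)
        ).intervalIntegrable _ _
      rw [norm_eq_zero, sub_eq_zero] at h
      have h6 := congrArg Complex.re h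
      have h7 := congrArg Complex.im h
      simp at h6 h7
      rcases h6 with h6 | h6
      · rw [h6] at h7
        simp at h7
        omega
      · exact hx h6
    · exact (Continuous.mul continuous_const (Continuous.inv₀ (by fun_prop) fun t => by
        positivity)).intervalIntegrable _ _
  refine h5.trans ?_
  rw [intervalIntegral.integral_const_mul]
  have h6 := integral_inv_abs_sub_add_le p.re hd0
  have h7 : Real.log (1 + 1 / d) ≤ Real.log (1 + K) + Real.log (1 + ‖x‖ / |x.re|) := by
    rw [← Real.log_mul (by positivity) (by positivity)]
    refine Real.log_le_log (by positivity) ?_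
    have : 1 / d = K * (‖x‖ / |x.re|) := by rw [hd]; field_simp
    rw [this]
    have h8 : 0 ≤ ‖x‖ / |x.re| := by positivity
    nlinarith
  linarith

theorem norm_pole_mul_le (c : ℝ) (x : ℂ) :
    ‖(c : ℂ) * (1 / (2 * Real.pi * Complex.I * x))‖ ≤ |c| * ‖x‖⁻¹ := by
  rw [norm_mul, Complex.norm_real, Real.norm_eq_abs, one_div, norm_inv, norm_mul]
  have h4 : ‖(2 * Real.pi * Complex.I : ℂ)‖ = 2 * Real.pi := by
    simp [abs_of_pos Real.pi_pos]
  rw [h4, mul_inv]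
  gcongr
  refine mul_le_of_le_one_left (by positivity) (inv_le_one_of_one_le₀ ?_)
  linarith [Real.pi_gt_three]

theorem exists_norm_borel_le {κ : ℤ} {c c' : ℕ → ℝ} (hc : IsReflectionCoeff κ c)
    (hc' : IsReflectionCoeff (-κ) c') (K : ℕ) :
    ∃ C, 0 ≤ C ∧ ∀ x : ℂ, x.re ≠ 0 → 0 ≤ x.im → ‖x‖ ≤ 2 * Real.pi * K →
      ‖borel κ x‖ ≤ C * (1 + Real.log (1 + ‖x‖ / |x.re|)) +
        ∑ j ∈ Finset.Icc 1 K, (|c j| + |c' j|) * ‖x - 2 * Real.pi * Complex.I * j‖⁻¹ := by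
  obtain ⟨C, hC0, hC⟩ := exists_norm_borel_sub_le hc K
  obtain ⟨C', hC'0, hC'⟩ := exists_norm_borel_add_le hc' K
  refine ⟨C + C', by positivity, fun x hx hx' hxK => ?_⟩
  have hL := log_one_add_nonneg (y := ‖x‖ / |x.re|) (by positivity)
  have key (b : ℕ → ℝ) : ‖∑ j ∈ Finset.Icc 1 K, (b j : ℂ) *
      (1 / (2 * Real.pi * Complex.I * (x - 2 * Real.pi * Complex.I * j)))‖ ≤
      ∑ j ∈ Finset.Icc 1 K, |b j| * ‖x - 2 * Real.pi * Complex.I * j‖⁻¹ :=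
    norm_sum_le_of_le _ fun j _ => norm_pole_mul_le _ _
  rcases hx.lt_or_gt with h | h
  · have h1 := hC' x h hx' hxK
    have h2 := norm_le_norm_add_norm_sub' (borel κ x) (-∑ j ∈ Finset.Icc 1 K, (c' j : ℂ) *
      (1 / (2 * Real.pi * Complex.I * (x - 2 * Real.pi * Complex.I * j))))
    rw [norm_neg, sub_neg_eq_add] at h2
    refine h2.trans ((add_le_add (key c') h1).trans ?_)
    rw [add_comm]
    refine add_le_add ?_ (Finset.sum_le_sum fun j _ => ?_)
    · gcongr; linarith
    · gcongr; linarith [abs_nonneg (c j)]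
  · have h1 := hC x h hx' hxK
    have h2 := norm_le_norm_add_norm_sub' (borel κ x) (∑ j ∈ Finset.Icc 1 K, (c j : ℂ) *
      (1 / (2 * Real.pi * Complex.I * (x - 2 * Real.pi * Complex.I * j))))
    refine h2.trans ((add_le_add (key c) h1).trans ?_)
    rw [add_comm]
    refine add_le_add ?_ (Finset.sum_le_sum fun j _ => ?_)
    · gcongr; linarith
    · gcongr; linarith [abs_nonneg (c' j)]

/-- The integral of `borel κ` along a ray grows at most logarithmically as the ray approaches the
cut. -/
theorem exists_integral_norm_borel_le {κ : ℤ} {c c' : ℕ → ℝ} (hc : IsReflectionCoeff κ c)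
    (hc' : IsReflectionCoeff (-κ) c') (K : ℕ) :
    ∃ C, 0 ≤ C ∧ ∀ x : ℂ, x.re ≠ 0 → 0 ≤ x.im → ‖x‖ ≤ 2 * Real.pi * K →
      ‖x‖ * ∫ t in (0 : ℝ)..1, ‖borel κ (t * x)‖ ≤ C * (1 + Real.log (1 + ‖x‖ / |x.re|)) := by
  obtain ⟨C, hC0, hC⟩ := exists_norm_borel_le hc hc' K
  set B := ∑ j ∈ Finset.Icc 1 K, (|c j| + |c' j|) with hB
  have hB0 : 0 ≤ B := by positivity
  have hLK := log_one_add_nonneg (y := K) (by positivity)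
  refine ⟨2 * Real.pi * K * C + B * (4 * (Real.log (1 + K) + 1)), by positivity,
    fun x hx hx' hxK => ?_⟩
  have hL := log_one_add_nonneg (y := ‖x‖ / |x.re|) (by positivity)
  set L := Real.log (1 + ‖x‖ / |x.re|) with hLd
  have hne (j : ℕ) (hj : j ∈ Finset.Icc 1 K) (t : ℝ) :
      ‖t * x - 2 * Real.pi * Complex.I * j‖ ≠ 0 := by
    intro h
    rw [norm_eq_zero, sub_eq_zero] at h
    have h6 := congrArg Complex.re h
    have h7 := congrArg Complex.im h
    simp at h6 h7 hj
    rcases h6 with h6 | h6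
    · rw [h6] at h7
      simp at h7
      omega
    · exact hx h6
  have hci (j : ℕ) (hj : j ∈ Finset.Icc 1 K) : IntervalIntegrable (fun t : ℝ =>
      (|c j| + |c' j|) * ‖t * x - 2 * Real.pi * Complex.I * j‖⁻¹) volume 0 1 :=
    (Continuous.mul continuous_const
      (Continuous.inv₀ (by fun_prop) fun t => hne j hj t)).intervalIntegrable _ _
  have hsum : IntervalIntegrable (fun t : ℝ => ∑ j ∈ Finset.Icc 1 K,
      (|c j| + |c' j|) * ‖t * x - 2 * Real.pi * Complex.I * j‖⁻¹) volume 0 1 := by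
    have := IntervalIntegrable.sum (Finset.Icc 1 K) hci
    convert! this using 1
    ext t
    simp
  have h1 : ∫ t in (0 : ℝ)..1, ‖borel κ (t * x)‖ ≤ ∫ t in (0 : ℝ)..1, (C * (1 + L) +
      ∑ j ∈ Finset.Icc 1 K, (|c j| + |c' j|) * ‖t * x - 2 * Real.pi * Complex.I * j‖⁻¹) := by
    refine intervalIntegral.integral_mono_on_of_le_Ioo zero_le_one ?_
      (intervalIntegrable_const.add hsum) fun t ht => ?_
    · have : ContinuousOn (fun t : ℝ => ‖borel κ (t * x)‖) (Icc 0 1) := by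
        refine ((differentiableOn_borel κ).continuousOn.comp (by fun_prop) fun t ht => ?_).norm
        exact isStar_slitDomain x (Or.inl hx) t ht
      exact (this.mono (by rw [uIcc_of_le zero_le_one])).intervalIntegrable
    · have ht0 : 0 < t := ht.1
      have e1 : (t * x).re = t * x.re := by simp
      have e2 : (t * x).im = t * x.im := by simp
      have e3 : ‖t * x‖ = t * ‖x‖ := by simp [abs_of_pos ht0]
      have h := hC (t * x) (by rw [e1]; exact mul_ne_zero ht0.ne' hx)
        (by rw [e2]; positivity) (by rw [e3]; exact (mul_le_of_le_one_left (norm_nonneg _) ht.2.le).trans hxK)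
      -- The ratio `‖x‖ / |Re x|` is constant along the ray, so the logarithm can be taken out of
      -- the integral.
      rwa [e1, e3, abs_mul, abs_of_pos ht0, mul_div_mul_left _ _ ht0.ne'] at h
  calc ‖x‖ * ∫ t in (0 : ℝ)..1, ‖borel κ (t * x)‖
      ≤ ‖x‖ * ∫ t in (0 : ℝ)..1, (C * (1 + L) +
      ∑ j ∈ Finset.Icc 1 K, (|c j| + |c' j|) * ‖t * x - 2 * Real.pi * Complex.I * j‖⁻¹) := by gcongr
    _ = ‖x‖ * (C * (1 + L)) + ∑ j ∈ Finset.Icc 1 K, (|c j| + |c' j|) *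
        (‖x‖ * ∫ t in (0 : ℝ)..1, ‖t * x - 2 * Real.pi * Complex.I * j‖⁻¹) := by
      rw [intervalIntegral.integral_add intervalIntegrable_const hsum,
        intervalIntegral.integral_finsetSum hci, mul_add, Finset.mul_sum]
      simp only [intervalIntegral.integral_const, sub_zero, one_smul,
        intervalIntegral.integral_const_mul]
      congr 1
      refine Finset.sum_congr rfl fun j _ => ?_
      ring
    _ ≤ (2 * Real.pi * K) * (C * (1 + L)) + ∑ j ∈ Finset.Icc 1 K, (|c j| + |c' j|) *
        (4 * (Real.log (1 + K) + L)) := by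
      refine add_le_add (by gcongr) (Finset.sum_le_sum fun j hj => ?_)
      refine mul_le_mul_of_nonneg_left ?_ (by positivity)
      exact integral_norm_inv_sub_le hx hxK (Finset.mem_Icc.1 hj).1
    _ = 2 * Real.pi * K * C * (1 + L) + B * (4 * (Real.log (1 + K) + L)) := by
      rw [← Finset.sum_mul]; ring
    _ ≤ _ := by nlinarith [mul_nonneg hB0 hL, mul_nonneg hB0 hLK, mul_nonneg (mul_nonneg hB0 hL) hLK]

/-! ### The density as a convolution exponential -/

/-- The logarithm of the density with respect to convolution. -/
noncomputable def logDensity (c : ℂ) (z : ℂ) : ℂ :=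
  3 * (c * binetKernel (c * z) + (starRingEnd ℂ) c * binetKernel ((starRingEnd ℂ) c * z))

/-- The analytic density of states, measured from the ground frequency. -/
noncomputable def density (c : ℂ) : ℂ → ℂ := convExp (logDensity c)

/-- The plane slit along two lines. -/
def doubleSlit (c : ℂ) : Set ℂ := {z | c * z ∈ slitDomain ∧ (starRingEnd ℂ) c * z ∈ slitDomain}

theorem isOpen_doubleSlit (c : ℂ) : IsOpen (doubleSlit c) :=
  (isOpen_ray_slitDomain c).inter (isOpen_ray_slitDomain _)

theorem isStar_doubleSlit (c : ℂ) : IsStar (doubleSlit c) := fun z hz t ht =>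
  ⟨isStar_ray_slitDomain c z hz.1 t ht, isStar_ray_slitDomain _ z hz.2 t ht⟩

theorem ofReal_mem_doubleSlit {c : ℂ} (hc : 0 < c.re) (x : ℝ) (hx : 0 ≤ x) :
    (x : ℂ) ∈ doubleSlit c :=
  ⟨ofReal_mem_ray_slitDomain hc x hx, ofReal_mem_ray_slitDomain (by simpa) x hx⟩

theorem differentiableOn_logDensity (c : ℂ) : DifferentiableOn ℂ (logDensity c) (doubleSlit c) :=
  (((differentiableOn_ray differentiableOn_binetKernel c).mono fun _ h => h.1).add
    ((differentiableOn_ray differentiableOn_binetKernel _).mono fun _ h => h.2)).const_mul _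

theorem differentiableOn_density (c : ℂ) : DifferentiableOn ℂ (density c) (doubleSlit c) :=
  differentiableOn_convExp (isOpen_doubleSlit c) (isStar_doubleSlit c) (differentiableOn_logDensity c)

theorem density_conj (c z : ℂ) : density c ((starRingEnd ℂ) z) = (starRingEnd ℂ) (density c z) := by
  refine convExp_conj (fun z => ?_) z
  simp only [logDensity, map_mul, map_add, ← binetKernel_conj, Complex.conj_conj, map_ofNat]
  ring

theorem density_conj_left (c z : ℂ) : density ((starRingEnd ℂ) c) z = density c z := by
  have : logDensity ((starRingEnd ℂ) c) = logDensity c := by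
    ext z
    rw [logDensity, logDensity, Complex.conj_conj, add_comm]
  rw [density, density, this]

theorem convPow_ofReal_nonneg {b : ℂ → ℂ} {β : ℝ → ℝ} (hβ : ∀ x, 0 ≤ x → 0 ≤ β x)
    (hb : ∀ x : ℝ, 0 ≤ x → b x = β x) (n : ℕ) :
    ∃ γ : ℝ → ℝ, ∀ x : ℝ, 0 ≤ x → 0 ≤ γ x ∧ convPow b n x = γ x := by
  induction n with
  | zero => exact ⟨β, fun x hx => ⟨hβ x hx, hb x hx⟩⟩
  | succ n ih =>
    obtain ⟨γ, hγ⟩ := ih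
    refine ⟨fun x => x * ∫ t in (0 : ℝ)..1, γ (t * x) * β ((1 - t) * x), fun x hx => ⟨?_, ?_⟩⟩
    · refine mul_nonneg hx (intervalIntegral.integral_nonneg zero_le_one fun t ht => ?_)
      exact mul_nonneg (hγ _ (mul_nonneg ht.1 hx)).1
        (hβ _ (mul_nonneg (sub_nonneg.2 ht.2) hx))
    · rw [convPow, rayConv, Complex.ofReal_mul, ← intervalIntegral.integral_ofReal]
      congr 1
      refine intervalIntegral.integral_congr fun t ht => ?_
      rw [uIcc_of_le zero_le_one] at ht
      have h1 := (hγ _ (mul_nonneg ht.1 hx)).2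
      have h2 := hb _ (mul_nonneg (sub_nonneg.2 ht.2) hx)
      push_cast at h1 h2 ⊢
      rw [h1, h2]

theorem logDensity_ofReal (c : ℂ) (x : ℝ) :
    logDensity c x = ((6 * (c * binetKernel (c * x)).re : ℝ) : ℂ) := by
  have h : (starRingEnd ℂ) c * binetKernel ((starRingEnd ℂ) c * x) =
      (starRingEnd ℂ) (c * binetKernel (c * x)) := by
    rw [map_mul, ← binetKernel_conj, map_mul, Complex.conj_ofReal]
  rw [logDensity, h, Complex.add_conj]
  push_cast
  ring

/-- On the positive axis `logDensity` is positive, hence so are the convolution powers up to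
vanishing; the first term of the series alone is strictly positive. -/
theorem density_ofReal_pos {c : ℂ} (hc : 0 < c.re) {x : ℝ} (hx : 0 ≤ x) :
    0 < (density c x).re ∧ density c x = ((density c x).re : ℂ) := by
  have hpos (x : ℝ) := re_binetKernel_ray_pos hc x
  choose γ hγ using convPow_ofReal_nonneg (b := logDensity c)
    (β := fun x => 6 * (c * binetKernel (c * x)).re)
    (fun x _ => by have := hpos x; positivity) (fun x _ => logDensity_ofReal c x)
  have hs := (summable_convExp (isStar_doubleSlit c) (differentiableOn_logDensity c).continuousOn
    (ofReal_mem_doubleSlit hc x hx)).hasSum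
  have hterm (n : ℕ) : convPow (logDensity c) n x / (n + 1).factorial =
      ((γ n x / (n + 1).factorial : ℝ) : ℂ) := by
    rw [(hγ n x hx).2]; push_cast; rfl
  simp_rw [hterm] at hs
  have hd : density c x = ∑' n : ℕ, ((γ n x / (n + 1).factorial : ℝ) : ℂ) := by
    rw [density, convExp]
    exact tsum_congr hterm
  rw [← hd] at hs
  have hre := Complex.hasSum_re hs
  simp only [Complex.ofReal_re] at hre
  have h0 : 0 < γ 0 x := by
    have h1 := (hγ 0 x hx).2
    rw [convPow, logDensity_ofReal, Complex.ofReal_inj] at h1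
    rw [← h1]
    have := hpos x
    positivity
  constructor
  · have h1 := le_hasSum hre 0 fun n _ => div_nonneg (hγ n x hx).1 (by positivity)
    simp at h1
    linarith
  · have h1 : HasSum (fun n : ℕ => ((γ n x / (n + 1).factorial : ℝ) : ℂ)) ((density c x).re : ℂ) :=
      Complex.hasSum_ofReal.2 hre
    exact hs.unique h1

theorem laplace_logDensity {c ρ : ℂ} (hc : 0 < c.re) (hρ : 0 < ρ.re) :
    laplace (logDensity c) ρ = 3 * (binet (ρ / c) + binet (ρ / (starRingEnd ℂ) c)) := by
  have hint (c : ℂ) (hc : 0 < c.re) :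
      IntegrableOn (laplaceIntegrand (fun z => c * binetKernel (c * z)) ρ) (Ioi 0) := by
    obtain ⟨M, hM⟩ := exists_bound_binetKernel_ray hc
    refine integrableOn_laplaceIntegrand_convPow (b := fun z => c * binetKernel (c * z))
      (isOpen_ray_slitDomain c) (isStar_ray_slitDomain c)
      (ofReal_mem_ray_slitDomain hc) (differentiableOn_ray differentiableOn_binetKernel c)
      (M := ‖c‖ * M) (fun x _ => ?_) 0 hρ
    rw [norm_mul]
    gcongr
    exact hM x
  have hc' : 0 < ((starRingEnd ℂ) c).re := by simpa
  rw [← laplace_binetKernel hc hρ, ← laplace_binetKernel hc' hρ, laplace, laplace, laplace,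
    ← integral_add (hint c hc) (hint _ hc'), ← integral_const_mul]
  refine integral_congr_ae (Eventually.of_forall fun x => ?_)
  simp only [laplaceIntegrand, logDensity]
  ring

theorem exists_bound_logDensity {c : ℂ} (hc : 0 < c.re) :
    ∃ M, ∀ x : ℝ, 0 ≤ x → ‖logDensity c x‖ ≤ M := by
  obtain ⟨M, hM⟩ := exists_bound_binetKernel_ray hc
  refine ⟨6 * (‖c‖ * M), fun x _ => ?_⟩
  rw [logDensity_ofReal, Complex.norm_real, Real.norm_eq_abs, abs_mul, abs_of_pos (by norm_num)]
  gcongr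
  refine (Complex.abs_re_le_norm _).trans ?_
  rw [norm_mul]
  gcongr
  exact hM x

theorem laplace_density {c ρ : ℂ} (hc : 0 < c.re) (hρ : 0 < ρ.re) :
    IntegrableOn (laplaceIntegrand (density c) ρ) (Ioi 0) ∧ laplace (density c) ρ =
      Complex.exp (3 * (binet (ρ / c) + binet (ρ / (starRingEnd ℂ) c))) - 1 := by
  obtain ⟨M, hM⟩ := exists_bound_logDensity hc
  rw [← laplace_logDensity hc hρ]
  exact ⟨(laplaceIntegrand_convExp_hasSum (isOpen_doubleSlit c) (isStar_doubleSlit c)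
    (ofReal_mem_doubleSlit hc) (differentiableOn_logDensity c) hM hρ).2,
    laplace_convExp (isOpen_doubleSlit c) (isStar_doubleSlit c)
    (ofReal_mem_doubleSlit hc) (differentiableOn_logDensity c) hM hρ⟩

/-- The factor of the density with singularities along one line. -/
noncomputable def rayDensity (c z : ℂ) : ℂ := c * borel 3 (c * z)

theorem differentiableOn_rayDensity (c : ℂ) :
    DifferentiableOn ℂ (rayDensity c) {z | c * z ∈ slitDomain} :=
  differentiableOn_ray (differentiableOn_borel 3) c

theorem continuousAt_ofReal_of_differentiableOn {f : ℂ → ℂ} {D : Set ℂ} (hD : IsOpen D)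
    (hf : DifferentiableOn ℂ f D) {x : ℝ} (hx : (x : ℂ) ∈ D) :
    ContinuousAt (fun x : ℝ => f x) x :=
  ContinuousAt.comp (f := fun x : ℝ => (x : ℂ)) (hf.differentiableAt (hD.mem_nhds hx)).continuousAt
    (by fun_prop)

theorem differentiableOn_rayConv_rayDensity (c : ℂ) : DifferentiableOn ℂ
    (rayConv (rayDensity c) (rayDensity ((starRingEnd ℂ) c))) (doubleSlit c) :=
  differentiableOn_rayConv (isOpen_doubleSlit c) (isStar_doubleSlit c)
    ((differentiableOn_rayDensity c).mono fun _ h => h.1)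
    ((differentiableOn_rayDensity _).mono fun _ h => h.2)

/-- The density is the convolution of its two factors. -/
theorem density_eq {c : ℂ} (hc : 0 < c.re) : EqOn (density c)
    (fun z => rayDensity c z + rayDensity ((starRingEnd ℂ) c) z +
      rayConv (rayDensity c) (rayDensity ((starRingEnd ℂ) c)) z) (doubleSlit c) := by
  set c' := (starRingEnd ℂ) c with hc'd
  have hc' : 0 < c'.re := by simpa [hc'd]
  have hd : DifferentiableOn ℂ (fun z => rayDensity c z + rayDensity c' z +
      rayConv (rayDensity c) (rayDensity c') z) (doubleSlit c) :=
    (((differentiableOn_rayDensity c).mono fun _ h => h.1).add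
      ((differentiableOn_rayDensity _).mono fun _ h => h.2)).add
      (differentiableOn_rayConv_rayDensity c)
  refine eqOn_of_eq_ofReal (isOpen_doubleSlit c) (isStar_doubleSlit c).isPreconnected
    (fun x hx => ofReal_mem_doubleSlit hc x hx.le) (differentiableOn_density c) hd fun x hx => ?_
  have hL (c ρ : ℂ) (hc : 0 < c.re) (hρ : 0 < ρ.re) := laplace_borel_ray 3 hc hρ
  have hi (ρ : ℂ) (hρ : 0 < ρ.re) : IntegrableOn (laplaceIntegrand (fun z => rayDensity c z +
      rayDensity c' z + rayConv (rayDensity c) (rayDensity c') z) ρ) (Ioi 0) ∧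
      laplace (fun z => rayDensity c z + rayDensity c' z +
        rayConv (rayDensity c) (rayDensity c') z) ρ =
      laplace (rayDensity c) ρ + laplace (rayDensity c') ρ +
        laplace (rayDensity c) ρ * laplace (rayDensity c') ρ := by
    have i1 : IntegrableOn (laplaceIntegrand (rayDensity c) ρ) (Ioi 0) := (hL c ρ hc hρ).1
    have i2 : IntegrableOn (laplaceIntegrand (rayDensity c') ρ) (Ioi 0) := (hL c' ρ hc' hρ).1
    have i3 := integrableOn_laplaceIntegrand_rayConv i1 i2
    have e : laplaceIntegrand (fun z => rayDensity c z + rayDensity c' z +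
        rayConv (rayDensity c) (rayDensity c') z) ρ = fun x => laplaceIntegrand (rayDensity c) ρ x +
        laplaceIntegrand (rayDensity c') ρ x +
        laplaceIntegrand (rayConv (rayDensity c) (rayDensity c')) ρ x := by
      ext x
      simp only [laplaceIntegrand]
      ring
    rw [← laplace_rayConv i1 i2, laplace, e]
    exact ⟨(Integrable.fun_add (Integrable.fun_add i1 i2) i3), by
      rw [integral_add (Integrable.fun_add i1 i2) i3, integral_add i1 i2]; rfl⟩
  refine eq_of_laplace_eq (β := 1) hx (laplace_density hc (by simp)).1 (hi _ (by simp)).1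
    (continuousAt_ofReal_of_differentiableOn (isOpen_doubleSlit c) (differentiableOn_density c)
      (ofReal_mem_doubleSlit hc x hx.le))
    (continuousAt_ofReal_of_differentiableOn (isOpen_doubleSlit c) hd
      (ofReal_mem_doubleSlit hc x hx.le)) fun ρ hρ => ?_
  have hρ0 : 0 < ρ.re := by rw [hρ]; exact one_pos
  have e1 : laplace (rayDensity c) ρ = _ := (hL c ρ hc hρ0).2
  have e2 : laplace (rayDensity c') ρ = _ := (hL c' ρ hc' hρ0).2
  -- With `A` and `B` the two exponents, this is `exp (A + B) - 1 = (exp A - 1) + (exp B - 1) + (exp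
  -- A - 1)(exp B - 1)`.
  rw [(laplace_density hc hρ0).2, (hi ρ hρ0).2, e1, e2, mul_add, Complex.exp_add]
  push_cast
  ring

/-! ### Uniqueness of the density with given Laplace transform on the real axis -/

theorem differentiableOn_laplace {f : ℂ → ℂ}
    (hf : ∀ β : ℝ, 0 < β → IntegrableOn (laplaceIntegrand f β) (Ioi 0)) :
    DifferentiableOn ℂ (laplace f) {ρ | 0 < ρ.re} := by
  have key (β : ℝ) (hβ : 0 < β) (ρ : ℂ) : laplaceIntegrand f ρ =
      fun x : ℝ => laplaceIntegrand f β x * Complex.exp ((β - ρ) * x) := by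
    ext x
    rw [laplaceIntegrand, laplaceIntegrand, mul_assoc, ← Complex.exp_add]
    ring_nf
  intro ρ hρ
  have hρ0 : 0 < ρ.re := hρ
  have hr : 0 < ρ.re / 2 := by positivity
  refine (hasDerivAt_integral_of_differentiableOn (μ := volume.restrict (Ioi (0 : ℝ)))
    (F := fun ρ x => laplaceIntegrand f ρ x) (z₀ := ρ) hr
    (bound := fun x => ‖laplaceIntegrand f ((ρ.re / 2 : ℝ) : ℂ) x‖) ?_ ?_ ?_
    (hf _ hr).norm).differentiableAt.differentiableWithinAt
  · intro z _
    rw [key _ hr z]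
    exact (hf _ hr).aestronglyMeasurable.mul (Continuous.aestronglyMeasurable (by fun_prop))
  · refine Eventually.of_forall fun x => ?_
    simp only [laplaceIntegrand]
    fun_prop
  · filter_upwards [ae_restrict_mem measurableSet_Ioi] with x hx z hz
    have hx0 : (0 : ℝ) < x := hx
    rw [norm_laplaceIntegrand, norm_laplaceIntegrand]
    refine mul_le_mul_of_nonneg_left (Real.exp_le_exp.2 ?_) (norm_nonneg _)
    rw [mem_ball, dist_eq_norm] at hz
    have := (Complex.abs_re_le_norm (z - ρ)).trans hz.le
    rw [Complex.sub_re, abs_le] at this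
    rw [Complex.ofReal_re]
    nlinarith

/-- The partition function is prescribed for real `β` only. Both transforms are holomorphic in the
right half plane, so they agree on vertical lines as well, where inversion applies. -/
theorem eq_of_laplace_eq_ofReal {f g : ℂ → ℂ} {x : ℝ} (hx : 0 < x)
    (hf : ∀ β : ℝ, 0 < β → IntegrableOn (laplaceIntegrand f β) (Ioi 0))
    (hg : ∀ β : ℝ, 0 < β → IntegrableOn (laplaceIntegrand g β) (Ioi 0))
    (hfc : ContinuousAt (fun x : ℝ => f x) x) (hgc : ContinuousAt (fun x : ℝ => g x) x)
    (h : ∀ β : ℝ, 0 < β → laplace f β = laplace g β) : f x = g x := by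
  have heq := eqOn_of_eq_ofReal isOpen_rightHalfPlane isPreconnected_rightHalfPlane
    (fun x hx => by simpa using hx) (differentiableOn_laplace hf) (differentiableOn_laplace hg) h
  refine eq_of_laplace_eq (β := 1) hx (hf 1 one_pos) (hg 1 one_pos) hfc hgc fun ρ hρ => heq ?_
  change 0 < ρ.re
  rw [hρ]; exact one_pos

/-! ### The rotation that takes the cuts to the imaginary axis -/

variable {η φ : ℝ}

/-- The slope `λ` such that `λ (z - ω_φ)` runs along the imaginary axis on one of the lines carrying
the cuts. -/
noncomputable def slope (η φ : ℝ) : ℂ :=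
  ((2 * Real.pi / η : ℝ) : ℂ) * (Complex.I * Complex.exp (-(Complex.I * φ)))

theorem exp_neg_I_mul (φ : ℝ) :
    Complex.exp (-(Complex.I * φ)) = Real.cos φ - Real.sin φ * Complex.I := by
  rw [show -(Complex.I * (φ : ℂ)) = ((-φ : ℝ) : ℂ) * Complex.I by push_cast; ring,
    Complex.exp_mul_I, ← Complex.ofReal_cos, ← Complex.ofReal_sin, Real.cos_neg, Real.sin_neg]
  push_cast; ring

theorem exp_I_mul (φ : ℝ) :
    Complex.exp (Complex.I * φ) = Real.cos φ + Real.sin φ * Complex.I := by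
  rw [mul_comm, Complex.exp_mul_I, ← Complex.ofReal_cos, ← Complex.ofReal_sin]

theorem conj_exp_neg_I_mul (φ : ℝ) :
    (starRingEnd ℂ) (Complex.exp (-(Complex.I * φ))) = Complex.exp (Complex.I * φ) := by
  rw [← Complex.exp_conj]
  simp

theorem conj_slope (η φ : ℝ) : (starRingEnd ℂ) (slope η φ) =
    ((2 * Real.pi / η : ℝ) : ℂ) * (-Complex.I * Complex.exp (Complex.I * φ)) := by
  rw [slope, map_mul, map_mul, Complex.conj_I, Complex.conj_ofReal, conj_exp_neg_I_mul]

theorem slope_re (η φ : ℝ) : (slope η φ).re = 2 * Real.pi / η * Real.sin φ := by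
  rw [slope, Complex.re_ofReal_mul, exp_neg_I_mul]
  simp [Complex.mul_re, -Complex.ofReal_sin, -Complex.ofReal_cos]

theorem slope_re_pos (hη : 0 < η) (hφ : 0 < φ) (hφ' : φ < Real.pi / 2) : 0 < (slope η φ).re := by
  rw [slope_re]
  have := Real.sin_pos_of_pos_of_lt_pi hφ (by linarith [Real.pi_pos])
  have := Real.pi_pos
  positivity

theorem slope_mul_exp (η φ s : ℝ) :
    slope η φ * (s * Complex.exp (Complex.I * φ)) = ((2 * Real.pi / η * s : ℝ) : ℂ) * Complex.I := by
  have : Complex.exp (-(Complex.I * φ)) * Complex.exp (Complex.I * φ) = 1 := by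
    rw [← Complex.exp_add, neg_add_cancel, Complex.exp_zero]
  rw [slope]
  push_cast
  linear_combination (2 * Real.pi / η * s * Complex.I : ℂ) * this

theorem conj_slope_mul_exp (η φ s : ℝ) : (starRingEnd ℂ) (slope η φ) *
    (s * Complex.exp (-(Complex.I * φ))) = ((-(2 * Real.pi / η * s) : ℝ) : ℂ) * Complex.I := by
  have h := congrArg (starRingEnd ℂ) (slope_mul_exp η φ s)
  have h2 : (starRingEnd ℂ) (Complex.exp (Complex.I * φ)) = Complex.exp (-(Complex.I * φ)) := by
    rw [← conj_exp_neg_I_mul, Complex.conj_conj]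
  simp only [map_mul, Complex.conj_ofReal, Complex.conj_I, h2] at h
  rw [h]
  push_cast
  ring

theorem slope_ne_zero (hη : 0 < η) : slope η φ ≠ 0 := by
  refine mul_ne_zero ?_ (mul_ne_zero Complex.I_ne_zero (Complex.exp_ne_zero _))
  have := Real.pi_pos
  exact_mod_cast (by positivity : 2 * Real.pi / η ≠ 0)

theorem notMem_slitDomain_iff {x : ℂ} :
    x ∉ slitDomain ↔ ∃ y : ℝ, 2 * Real.pi ≤ |y| ∧ x = y * Complex.I := by
  constructor
  · intro h
    simp only [slitDomain, mem_ofPred_eq, not_or, not_not, not_lt] at h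
    exact ⟨x.im, h.2, Complex.ext (by simpa using h.1) (by simp)⟩
  · rintro ⟨y, hy, rfl⟩ h
    rcases h with h | h
    · simp at h
    · simp at h
      linarith

/-- Multiplication by the slope takes the line of direction `exp (iφ)` to the imaginary axis and the
length `η` to `2π`; the conjugate slope does the same for the other line. -/
theorem mem_doubleSlit_iff (hη : 0 < η) {z : ℂ} :
    z ∈ doubleSlit (slope η φ) ↔ (groundFrequency η φ : ℂ) + z ∉ cuts η φ := by
  have hpi := Real.pi_pos
  have hc := slope_ne_zero (φ := φ) hη
  have habs (s : ℝ) (hs : η ≤ |s|) : 2 * Real.pi ≤ |2 * Real.pi / η * s| := by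
    rw [abs_mul, abs_of_pos (by positivity), div_mul_eq_mul_div, le_div_iff₀ hη]
    gcongr
  have habs' (y : ℝ) (hy : 2 * Real.pi ≤ |y|) : η ≤ |η / (2 * Real.pi) * y| := by
    rw [abs_mul, abs_of_pos (by positivity), div_mul_eq_mul_div, le_div_iff₀ (by positivity)]
    gcongr
  rw [← not_iff_not, not_not]
  constructor
  · intro h
    simp only [doubleSlit, mem_ofPred_eq, not_and_or] at h
    rcases h with h | h
    · obtain ⟨y, hy, hxy⟩ := notMem_slitDomain_iff.1 h
      refine ⟨η / (2 * Real.pi) * y, habs' y hy, Or.inl ?_⟩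
      congr 1
      refine mul_left_cancel₀ hc ?_
      rw [hxy, slope_mul_exp]
      congr 2
      field_simp
    · obtain ⟨y, hy, hxy⟩ := notMem_slitDomain_iff.1 h
      refine ⟨η / (2 * Real.pi) * (-y), habs' (-y) (by rwa [abs_neg]), Or.inr ?_⟩
      congr 1
      refine mul_left_cancel₀ ((map_ne_zero (starRingEnd ℂ)).2 hc) ?_
      rw [hxy, conj_slope_mul_exp]
      congr 2
      field_simp
  · rintro ⟨s, hs, h | h⟩ hz
    · rw [add_right_inj] at h
      exact notMem_slitDomain_iff.2 ⟨_, habs s hs, by rw [h, slope_mul_exp]⟩ hz.1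
    · rw [add_right_inj] at h
      exact notMem_slitDomain_iff.2 ⟨-(2 * Real.pi / η * s), by rw [abs_neg]; exact habs s hs, by
        rw [h, conj_slope_mul_exp]⟩ hz.2

/-! ### The partition function -/

/-- The argument of `Γ` has modulus `ρ` and angle `π / 2 - φ`, which lies in the right half plane;
the formula is Stirling's in polar coordinates. -/
theorem norm_Gamma_sq {ρ : ℝ} (hρ : 0 < ρ) (hφ : 0 < φ) (hφ' : φ < Real.pi / 2) :
    ‖Complex.Gamma (Complex.I * ρ * Complex.exp (-(Complex.I * φ)))‖ ^ 2 = 2 * Real.pi *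
      Real.exp (2 * ((ρ * Real.sin φ - 1 / 2) * Real.log ρ - ρ * Real.cos φ * (Real.pi / 2 - φ) -
        ρ * Real.sin φ + (binet (Complex.I * ρ * Complex.exp (-(Complex.I * φ)))).re)) := by
  have hsin := Real.sin_pos_of_pos_of_lt_pi hφ (by linarith [Real.pi_pos])
  set w := Complex.I * ρ * Complex.exp (-(Complex.I * φ)) with hw
  have hw1 : w = (ρ * Real.sin φ : ℝ) + (ρ * Real.cos φ : ℝ) * Complex.I := by
    rw [hw, exp_neg_I_mul]
    push_cast
    linear_combination (-ρ * Complex.sin φ) * Complex.I_sq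
  have hlog : Complex.log w = (Real.log ρ : ℝ) + (Real.pi / 2 - φ : ℝ) * Complex.I := by
    have h1 : w = ρ * (Complex.cos ((Real.pi / 2 - φ : ℝ) : ℂ) +
        Complex.sin ((Real.pi / 2 - φ : ℝ) : ℂ) * Complex.I) := by
      rw [← Complex.ofReal_cos, ← Complex.ofReal_sin, Real.cos_pi_div_two_sub,
        Real.sin_pi_div_two_sub, hw1]
      push_cast
      ring
    have hn : ‖w‖ = ρ := by
      rw [h1]
      rw [norm_mul, Complex.norm_cos_add_sin_mul_I, mul_one, Complex.norm_real,
        Real.norm_of_nonneg hρ.le]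
    rw [Complex.log, hn, h1, Complex.arg_mul_cos_add_sin_mul_I hρ ⟨by linarith, by linarith⟩]
  have hwre : w.re = ρ * Real.sin φ := by
    rw [hw1]; simp [-Complex.ofReal_sin, -Complex.ofReal_cos]
  have hslit : w ∈ Complex.slitPlane := by
    left
    rw [hwre]
    positivity
  rw [Gamma_eq_stirling hslit, norm_mul, mul_pow, Complex.norm_real, Real.norm_eq_abs, sq_abs,
    Real.sq_sqrt (by positivity), Complex.norm_exp, ← Real.exp_nat_mul]
  congr 3
  rw [hlog, Complex.add_re, Complex.sub_re, hwre, hw1]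
  simp [-Complex.ofReal_sin, -Complex.ofReal_cos, -Complex.ofReal_mul]

/-- With `w` the argument of `Γ`, the quotients of `β` by the conjugate slope and the slope are `w`
and `conj w`. The prefactors of `Z` cancel the logarithms in Stirling's formula, its linear terms
form the ground frequency, and the Binet terms form `1` plus the transform of the density. -/
theorem partitionFunction_eq (hη : 0 < η) (hφ : 0 < φ) (hφ' : φ < Real.pi / 2) {β : ℝ}
    (hβ : 0 < β) : (partitionFunction η φ β : ℂ) = Complex.exp (-β * groundFrequency η φ) *
      (1 + laplace (density (slope η φ)) β) := by
  have hpi := Real.pi_pos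
  have hc := slope_ne_zero (φ := φ) hη
  set ρ := η * β / (2 * Real.pi) with hρd
  have hρ : 0 < ρ := by positivity
  set w := Complex.I * ρ * Complex.exp (-(Complex.I * φ)) with hw
  have h1 : (β : ℂ) / (starRingEnd ℂ) (slope η φ) = w := by
    rw [div_eq_iff ((map_ne_zero _).2 hc), conj_slope, hw, hρd]
    have h2 : Complex.exp (-(Complex.I * φ)) * Complex.exp (Complex.I * φ) = 1 := by
      rw [← Complex.exp_add, neg_add_cancel, Complex.exp_zero]
    have h3 : ((η * β / (2 * Real.pi) : ℝ) : ℂ) * ((2 * Real.pi / η : ℝ) : ℂ) = β := by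
      rw [← Complex.ofReal_mul]
      congr 1
      field_simp
    calc (β : ℂ) = -(Complex.I ^ 2) * (((η * β / (2 * Real.pi) : ℝ) : ℂ) *
          ((2 * Real.pi / η : ℝ) : ℂ)) *
          (Complex.exp (-(Complex.I * φ)) * Complex.exp (Complex.I * φ)) := by
          rw [h2, h3, Complex.I_sq]; ring
      _ = _ := by ring
  have h2 : (β : ℂ) / slope η φ = (starRingEnd ℂ) w := by
    rw [← h1, map_div₀, Complex.conj_conj, Complex.conj_ofReal]
  rw [(laplace_density (slope_re_pos hη hφ hφ') (ρ := β) (by simpa)).2, h1, h2, binet_conj,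
    add_comm ((starRingEnd ℂ) _), Complex.add_conj, add_sub_cancel, ← Complex.exp_add]
  have h3 : -(β : ℂ) * groundFrequency η φ + 3 * ((2 * (binet w).re : ℝ) : ℂ) =
      ((-β * groundFrequency η φ + 3 * (2 * (binet w).re) : ℝ) : ℂ) := by push_cast; ring
  rw [h3, ← Complex.ofReal_exp, Complex.ofReal_inj, partitionFunction]
  rw [← hρd, ← hw, norm_Gamma_sq hρ hφ hφ', ← hw]
  have h4 : ρ / (2 * Real.pi) * Real.exp (-2 * ρ * Real.log ρ * Real.sin φ) * (2 * Real.pi *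
      Real.exp (2 * ((ρ * Real.sin φ - 1 / 2) * Real.log ρ - ρ * Real.cos φ * (Real.pi / 2 - φ) -
        ρ * Real.sin φ + (binet w).re))) = Real.exp (Real.log ρ +
        (-2 * ρ * Real.log ρ * Real.sin φ) + 2 * ((ρ * Real.sin φ - 1 / 2) * Real.log ρ -
        ρ * Real.cos φ * (Real.pi / 2 - φ) - ρ * Real.sin φ + (binet w).re)) := by
    rw [Real.exp_add, Real.exp_add, Real.exp_log hρ]
    field_simp
  rw [h4, ← Real.exp_nat_mul]
  congr 1
  have hb : β = 2 * Real.pi * ρ / η := by rw [hρd]; field_simp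
  rw [groundFrequency, hb]
  push_cast
  field_simp
  ring

theorem groundFrequency_pos (hη : 0 < η) (hφ : 0 < φ) (hφ' : φ < Real.pi / 2) :
    0 < groundFrequency η φ := by
  have h1 := Real.sin_pos_of_pos_of_lt_pi hφ (by linarith [Real.pi_pos])
  have h2 := Real.cos_pos_of_mem_Ioo ⟨by linarith, hφ'⟩
  have h3 : 0 < Real.pi / 2 - φ := by linarith
  have := Real.pi_pos
  rw [groundFrequency]
  positivity

/-! ### Existence and uniqueness of the effective density -/

/-- A function that vanishes below `a` and is nonnegative and continuous above `a`. -/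
structure IsHalfLineDensity (a : ℝ) (f : ℝ → ℝ) : Prop where
  zero : ∀ ω, ω < a → f ω = 0
  nonneg : ∀ ω, 0 ≤ f ω
  continuousOn : ContinuousOn f (Ici a)

theorem integral_comp_const_add (a : ℝ) (g : ℝ → ℂ) :
    ∫ ω in Ioi a, g ω = ∫ x in Ioi (0 : ℝ), g (a + x) := by
  have := (measurePreserving_add_left volume a).setIntegral_preimage_emb
    (measurableEmbedding_addLeft a) g (Ioi a)
  rw [← this]
  simp

theorem integrableOn_comp_const_add (a : ℝ) (g : ℝ → ℂ) :
    IntegrableOn (fun x => g (a + x)) (Ioi 0) ↔ IntegrableOn g (Ioi a) := by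
  have := (measurePreserving_add_left volume a).integrableOn_comp_preimage
    (measurableEmbedding_addLeft a) (f := g) (s := Ioi a)
  simpa [Function.comp_def] using this

theorem integrable_complex_ofReal_iff {f : ℝ → ℝ} {μ : Measure ℝ} :
    Integrable (fun x => (f x : ℂ)) μ ↔ Integrable f μ :=
  ⟨fun h => by simpa using h.re, fun h => h.ofReal⟩

namespace IsHalfLineDensity

variable {a : ℝ} {f : ℝ → ℝ}

theorem aemeasurable (hf : IsHalfLineDensity a f) : AEMeasurable f := by
  have h : f = (Ici a).indicator f := by
    ext ω
    by_cases hω : ω ∈ Ici a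
    · rw [indicator_of_mem hω]
    · rw [indicator_of_notMem hω, hf.zero ω (not_le.1 hω)]
  rw [h, aemeasurable_indicator_iff measurableSet_Ici]
  exact hf.continuousOn.aemeasurable measurableSet_Ici

theorem integrable_iff (hf : IsHalfLineDensity a f) (β : ℝ) :
    Integrable (fun ω : ℝ => Real.exp (-β * ω)) (volume.withDensity fun ω => ENNReal.ofReal (f ω)) ↔
      IntegrableOn (laplaceIntegrand (fun z => f (a + z.re)) β) (Ioi 0) := by
  rw [integrable_withDensity_iff_integrable_smul₀' hf.aemeasurable.ennreal_ofReal
    (Eventually.of_forall fun _ => ENNReal.ofReal_lt_top)]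
  simp only [ENNReal.toReal_ofReal (hf.nonneg _), smul_eq_mul]
  rw [← integrable_complex_ofReal_iff]
  have h1 : (fun ω : ℝ => ((f ω * Real.exp (-β * ω) : ℝ) : ℂ)) =
      (Ici a).indicator fun ω : ℝ => ((f ω * Real.exp (-β * ω) : ℝ) : ℂ) := by
    ext ω
    by_cases hω : ω ∈ Ici a
    · rw [indicator_of_mem hω]
    · rw [indicator_of_notMem hω, hf.zero ω (not_le.1 hω), zero_mul, Complex.ofReal_zero]
  have h2 : laplaceIntegrand (fun z => f (a + z.re)) β = fun x : ℝ =>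
      Complex.exp (β * a) * ((f (a + x) * Real.exp (-β * (a + x)) : ℝ) : ℂ) := by
    ext x
    simp only [laplaceIntegrand, Complex.ofReal_re]
    push_cast
    rw [mul_left_comm, ← Complex.exp_add]
    ring_nf
  have h3 := integrableOn_comp_const_add a fun ω : ℝ => ((f ω * Real.exp (-β * ω) : ℝ) : ℂ)
  change Integrable (fun ω : ℝ => ((f ω * Real.exp (-β * ω) : ℝ) : ℂ)) ↔ _
  rw [h1, integrable_indicator_iff measurableSet_Ici, integrableOn_Ici_iff_integrableOn_Ioi, ← h3, h2]
  exact (integrable_const_mul_iff (isUnit_iff_ne_zero.2 (Complex.exp_ne_zero _)) _).symm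

theorem integral_eq (hf : IsHalfLineDensity a f) (β : ℝ) :
    ((∫ ω, Real.exp (-β * ω) ∂(volume.withDensity fun ω => ENNReal.ofReal (f ω)) : ℝ) : ℂ) =
      Complex.exp (-β * a) * laplace (fun z => f (a + z.re)) β := by
  rw [integral_withDensity_eq_integral_toReal_smul₀ hf.aemeasurable.ennreal_ofReal
    (Eventually.of_forall fun _ => ENNReal.ofReal_lt_top)]
  simp only [ENNReal.toReal_ofReal (hf.nonneg _), smul_eq_mul]
  rw [← integral_complex_ofReal]
  have h1 : (fun ω : ℝ => ((f ω * Real.exp (-β * ω) : ℝ) : ℂ)) =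
      (Ici a).indicator fun ω : ℝ => ((f ω * Real.exp (-β * ω) : ℝ) : ℂ) := by
    ext ω
    by_cases hω : ω ∈ Ici a
    · rw [indicator_of_mem hω]
    · rw [indicator_of_notMem hω, hf.zero ω (not_le.1 hω), zero_mul, Complex.ofReal_zero]
  rw [h1, integral_indicator measurableSet_Ici, integral_Ici_eq_integral_Ioi,
    integral_comp_const_add, laplace, ← integral_const_mul]
  refine integral_congr_ae (Eventually.of_forall fun x => ?_)
  simp only [laplaceIntegrand, Complex.ofReal_re]
  push_cast
  rw [mul_left_comm, ← Complex.exp_add]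
  ring_nf

/-- The point mass accounts for the summand `1` in `partitionFunction_eq`. After removal of the
common exponential, the condition becomes an equality of Laplace transforms measured from the ground
frequency. -/
theorem isEffectiveMeasure_iff (hf : IsHalfLineDensity a f) (hη : 0 < η) (hφ : 0 < φ) (hφ' : φ < Real.pi / 2)
    (ha : a = groundFrequency η φ) :
    IsEffectiveMeasure η φ (Measure.dirac (groundFrequency η φ) +
      volume.withDensity (fun ω : ℝ => ENNReal.ofReal (f ω))) ↔ ∀ β : ℝ, 0 < β →
      IntegrableOn (laplaceIntegrand (fun z => f (a + z.re)) β) (Ioi 0) ∧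
      laplace (fun z => f (a + z.re)) β = laplace (density (slope η φ)) β := by
  have hd (β : ℝ) : Integrable (fun ω : ℝ => Real.exp (-β * ω))
      (Measure.dirac (groundFrequency η φ)) := integrable_dirac (by simp)
  have hi (β : ℝ) : Integrable (fun ω : ℝ => Real.exp (-β * ω))
      (Measure.dirac (groundFrequency η φ) +
      volume.withDensity (fun ω : ℝ => ENNReal.ofReal (f ω))) ↔
      IntegrableOn (laplaceIntegrand (fun z => f (a + z.re)) β) (Ioi 0) := by
    rw [integrable_add_measure, ← hf.integrable_iff]
    exact and_iff_right (hd β)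
  have he (β : ℝ) (hβ : 0 < β)
      (hint : IntegrableOn (laplaceIntegrand (fun z => f (a + z.re)) β) (Ioi 0)) :
      ∫ ω : ℝ, Real.exp (-β * ω) ∂(Measure.dirac (groundFrequency η φ) +
        volume.withDensity (fun ω : ℝ => ENNReal.ofReal (f ω))) = partitionFunction η φ β ↔
      laplace (fun z => f (a + z.re)) β = laplace (density (slope η φ)) β := by
    rw [integral_add_measure (hd β) ((hf.integrable_iff β).2 hint), integral_dirac,
      ← Complex.ofReal_inj, Complex.ofReal_add, hf.integral_eq,
      partitionFunction_eq hη hφ hφ' hβ, ha, mul_add, mul_one]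
    push_cast
    rw [add_right_inj, mul_right_inj' (Complex.exp_ne_zero _)]
  constructor
  · exact fun h β hβ => ⟨(hi β).1 (h.integrable β hβ),
      (he β hβ ((hi β).1 (h.integrable β hβ))).1 (h.laplace β hβ)⟩
  · refine fun h => ⟨?_, fun β hβ => (hi β).2 (h β hβ).1, fun β hβ =>
      (he β hβ (h β hβ).1).2 (h β hβ).2⟩
    have hg := groundFrequency_pos hη hφ hφ'
    rw [Measure.add_apply, Measure.dirac_apply' _ measurableSet_Iio, withDensity_apply _
      measurableSet_Iio, setLIntegral_congr_fun measurableSet_Iio (g := fun _ => 0) fun ω hω => ?_]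
    · simp [hg.le]
    · simp only [mem_Iio] at hω
      rw [hf.zero ω (by linarith), ENNReal.ofReal_zero]

end IsHalfLineDensity

theorem exists_isEffectiveDensity (hη : 0 < η) (hφ : 0 < φ) (hφ' : φ < Real.pi / 2) :
    ∃ f : ℝ → ℝ, IsEffectiveDensity η φ f ∧ ∀ ω, groundFrequency η φ ≤ ω →
      density (slope η φ) (ω - groundFrequency η φ) = f ω := by
  set a := groundFrequency η φ with ha
  have hc := slope_re_pos hη hφ hφ'
  set f : ℝ → ℝ := fun ω => if a ≤ ω then (density (slope η φ) (ω - a : ℝ)).re else 0 with hfd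
  have hf1 (ω : ℝ) (hω : a ≤ ω) : f ω = (density (slope η φ) (ω - a : ℝ)).re := if_pos hω
  have hpos (ω : ℝ) (hω : a ≤ ω) : 0 < f ω := by
    rw [hf1 ω hω]
    exact (density_ofReal_pos hc (sub_nonneg.2 hω)).1
  have hf : IsHalfLineDensity a f := by
    refine ⟨fun ω hω => if_neg hω.not_ge, fun ω => ?_, ?_⟩
    · by_cases h : a ≤ ω
      · exact (hpos ω h).le
      · exact (if_neg h).ge
    · refine ContinuousOn.congr (fun ω hω => ContinuousAt.continuousWithinAt ?_) hf1
      have h1 := continuousAt_ofReal_of_differentiableOn (isOpen_doubleSlit _)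
        (differentiableOn_density _) (ofReal_mem_doubleSlit hc (ω - a) (sub_nonneg.2 hω))
      exact Complex.continuous_re.continuousAt.comp
        (h1.comp (f := fun ω : ℝ => ω - a) (x := ω) (by fun_prop))
  have heq (ω : ℝ) (hω : a ≤ ω) : density (slope η φ) (ω - a) = f ω := by
    have := (density_ofReal_pos hc (sub_nonneg.2 hω)).2
    rw [hf1 ω hω, ← this]
    push_cast
    rfl
  refine ⟨f, ⟨hf.zero, hpos, hf.continuousOn,
    (hf.isEffectiveMeasure_iff hη hφ hφ' rfl).2 fun β hβ => ?_⟩, heq⟩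
  have h2 := laplace_density hc (ρ := β) (by simpa)
  have h3 : EqOn (laplaceIntegrand (fun z => f (a + z.re)) β)
      (laplaceIntegrand (density (slope η φ)) β) (Ioi 0) := by
    intro x hx
    have hx0 : (0 : ℝ) < x := hx
    simp only [laplaceIntegrand, Complex.ofReal_re]
    rw [← heq _ (by linarith)]
    simp
  exact ⟨h2.1.congr_fun h3.symm measurableSet_Ioi, setIntegral_congr_fun measurableSet_Ioi h3⟩

theorem effectiveDensity_eq_density {f : ℝ → ℝ} (hf : IsEffectiveDensity η φ f) (hη : 0 < η)
    (hφ : 0 < φ) (hφ' : φ < Real.pi / 2) {x : ℝ} (hx : 0 < x) :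
    (f (groundFrequency η φ + x) : ℂ) = density (slope η φ) x := by
  have hc := slope_re_pos hη hφ hφ'
  have hf' : IsHalfLineDensity (groundFrequency η φ) f := by
    refine ⟨hf.zero, fun ω => ?_, hf.continuousOn⟩
    rcases lt_or_ge ω (groundFrequency η φ) with h | h
    · exact (hf.zero ω h).ge
    · exact (hf.pos ω h).le
  have h := (hf'.isEffectiveMeasure_iff hη hφ hφ' rfl).1 hf.measure
  have := eq_of_laplace_eq_ofReal (f := fun z => f (groundFrequency η φ + z.re)) hx
    (fun β hβ => (h β hβ).1) (fun β hβ => (laplace_density hc (ρ := β) (by simpa)).1) ?_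
    (continuousAt_ofReal_of_differentiableOn (isOpen_doubleSlit _) (differentiableOn_density _)
      (ofReal_mem_doubleSlit hc x hx.le)) fun β hβ => (h β hβ).2
  · simpa using this
  · simp only [Complex.ofReal_re]
    refine Complex.continuous_ofReal.continuousAt.comp (ContinuousAt.comp
      (f := fun x => groundFrequency η φ + x) (g := f) ?_ (by fun_prop))
    exact hf.continuousOn.continuousAt (Ici_mem_nhds (by linarith))

theorem isContinuedDensity_density (hη : 0 < η) (hφ : 0 < φ) (hφ' : φ < Real.pi / 2) :
    IsContinuedDensity η φ fun z => density (slope η φ) (z - groundFrequency η φ) := by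
  refine ⟨fun z hz => ?_, exists_isEffectiveDensity hη hφ hφ'⟩
  have h1 : z - groundFrequency η φ ∈ doubleSlit (slope η φ) :=
    (mem_doubleSlit_iff hη).2 (by rwa [add_sub_cancel])
  exact ((differentiableOn_density _).analyticAt
    ((isOpen_doubleSlit _).mem_nhds h1)).comp_of_eq (f := fun z : ℂ => z - groundFrequency η φ)
    (by fun_prop) rfl

theorem continuedDensity_eq_density {Φ : ℂ → ℂ} (hΦ : IsContinuedDensity η φ Φ) (hη : 0 < η)
    (hφ : 0 < φ) (hφ' : φ < Real.pi / 2) {z : ℂ} (hz : z ∈ doubleSlit (slope η φ)) :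
    Φ (groundFrequency η φ + z) = density (slope η φ) z := by
  have hc := slope_re_pos hη hφ hφ'
  obtain ⟨f, hf, hfΦ⟩ := hΦ.density
  refine eqOn_of_eq_ofReal (f := fun z => Φ (groundFrequency η φ + z)) (isOpen_doubleSlit _)
    (isStar_doubleSlit _).isPreconnected (fun x hx => ofReal_mem_doubleSlit hc x hx.le)
    (fun z hz => ?_) (differentiableOn_density _) (fun x hx => ?_) hz
  · have h1 := (hΦ.analytic _ ((mem_doubleSlit_iff hη).1 hz)).differentiableAt
    exact (h1.comp (f := fun z => (groundFrequency η φ : ℂ) + z) z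
      (by fun_prop)).differentiableWithinAt
  · have := hfΦ (groundFrequency η φ + x) (by linarith)
    push_cast at this
    rw [this, ← effectiveDensity_eq_density hf hη hφ hφ' hx]

/-! ### Extension of the density from either side of a cut -/

theorem integral_segment_eq_sub {F P : ℂ → ℂ} {D : Set ℂ} (hF : ContinuousOn F D)
    (hP : ∀ s ∈ D, HasDerivAt P (F s) s) {m z : ℂ}
    (hseg : ∀ t ∈ Icc (0 : ℝ) 1, m + t * (z - m) ∈ D) :
    (z - m) * ∫ t in (0 : ℝ)..1, F (m + t * (z - m)) = P z - P m := by
  have hd (t : ℝ) (ht : t ∈ uIcc (0 : ℝ) 1) : HasDerivAt (fun t : ℝ => P (m + t * (z - m)))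
      ((z - m) * F (m + t * (z - m))) t := by
    rw [uIcc_of_le zero_le_one] at ht
    have h1 : HasDerivAt (fun t : ℝ => m + (t : ℂ) * (z - m)) (1 * (z - m)) t :=
      ((Complex.ofRealCLM.hasDerivAt (x := t)).mul_const (z - m)).const_add m
    have h2 := (hP _ (hseg t ht)).comp t h1
    rw [one_mul, mul_comm] at h2
    exact h2
  rw [← intervalIntegral.integral_const_mul, intervalIntegral.integral_eq_sub_of_hasDerivAt hd]
  · simp
  · refine ContinuousOn.intervalIntegrable (continuousOn_const.mul (hF.comp (by fun_prop)
      fun t ht => hseg t ?_))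
    rwa [uIcc_of_le zero_le_one] at ht

/-- The convolution along a ray, computed along a broken line. -/
theorem rayConv_eq_broken {f g : ℂ → ℂ} {D T : Set ℂ} (hDo : IsOpen D) (hD : IsStar D)
    (hf : DifferentiableOn ℂ f D) (hTo : IsOpen T) (hT : Convex ℝ T)
    (hg : DifferentiableOn ℂ g T) {m z : ℂ} (hz : z ∈ T) (hzm : z - m ∈ T) (h0 : 0 ∈ T)
    (hseg : ∀ t ∈ Icc (0 : ℝ) 1, m + t * (z - m) ∈ D) :
    rayConv f g z = m * (∫ t in (0 : ℝ)..1, f (t * m) * g (z - t * m)) +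
      (z - m) * ∫ t in (0 : ℝ)..1, f (m + t * (z - m)) * g ((1 - t) * (z - m)) := by
  -- The integrand `f s * g (z - s)` is holomorphic on this star domain and has a radial primitive
  -- there, so the path from `0` to `z` may be broken at `m`.
  set E : Set ℂ := {s | s ∈ D ∧ z - s ∈ T} with hE
  have hEo : IsOpen E := hDo.inter (hTo.preimage (by fun_prop : Continuous fun s => z - s))
  have hcomb (a b : ℂ) (ha : a ∈ T) (hb : b ∈ T) (t : ℝ) (ht : t ∈ Icc (0 : ℝ) 1) :
      (1 - t) * a + t * b ∈ T := by
    have := hT ha hb (sub_nonneg.2 ht.2) ht.1 (sub_add_cancel 1 t)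
    simpa using this
  have hEs : IsStar E := fun s hs t ht => ⟨hD s hs.1 t ht, by
    have := hcomb z (z - s) hz hs.2 t ht
    rwa [show (1 - (t : ℂ)) * z + t * (z - s) = z - t * s by ring] at this⟩
  have hF : DifferentiableOn ℂ (fun s => f s * g (z - s)) E :=
    (hf.mono fun _ h => h.1).mul (hg.comp (by fun_prop) fun _ h => h.2)
  have hP (s : ℂ) (hs : s ∈ E) := hasDerivAt_radial_primitive hEo hEs hF hs
  have h1 := integral_segment_eq_sub (m := m) (z := z) hF.continuousOn hP fun t ht =>
    ⟨hseg t ht, by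
      have := hcomb (z - m) 0 hzm h0 t ht
      rwa [show (1 - (t : ℂ)) * (z - m) + t * 0 = z - (m + t * (z - m)) by ring] at this⟩
  have h2 : ∫ t in (0 : ℝ)..1, f (m + t * (z - m)) * g (z - (m + t * (z - m))) =
      ∫ t in (0 : ℝ)..1, f (m + t * (z - m)) * g ((1 - t) * (z - m)) := by
    refine intervalIntegral.integral_congr fun t _ => ?_
    congr 2
    ring
  have h3 : rayConv f g z = z * ∫ t in (0 : ℝ)..1, f (t * z) * g (z - t * z) := by
    rw [rayConv]
    congr 1
    refine intervalIntegral.integral_congr fun t _ => ?_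
    congr 2
    ring
  rw [h2] at h1
  rw [h3, h1]
  ring

/-- The convolution of two functions extends analytically to a neighbourhood of a boundary point to
which the first factor extends. -/
theorem exists_rayConv_extension {f fe g : ℂ → ℂ} {D T S : Set ℂ} (hDo : IsOpen D) (hD : IsStar D)
    (hf : DifferentiableOn ℂ f D) (hTo : IsOpen T) (hT : IsStar T)
    (hg : DifferentiableOn ℂ g T) {z₀ : ℂ} (hz₀ : z₀ ∈ T) {r : ℝ} (hr : 0 < r)
    (hfe : DifferentiableOn ℂ fe (ball z₀ r)) (hSD : S ⊆ D) (hS : Convex ℝ S)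
    (heq : ∀ z ∈ ball z₀ r ∩ S, f z = fe z) (hcl : z₀ ∈ closure S) :
    ∃ ε, 0 < ε ∧ ε ≤ r ∧ ball z₀ ε ⊆ T ∧ ∃ G : ℂ → ℂ, DifferentiableOn ℂ G (ball z₀ ε) ∧
      EqOn (rayConv f g) G (ball z₀ ε ∩ S) := by
  have hcomp : IsCompact (segment ℝ 0 z₀) := by
    rw [segment_eq_image]
    exact isCompact_Icc.image (by fun_prop)
  have hsegT : segment ℝ 0 z₀ ⊆ T := by
    rw [segment_eq_image]
    rintro _ ⟨t, ht, rfl⟩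
    simpa using hT z₀ hz₀ t ht
  -- `T` is only star-shaped, but a thin neighbourhood of the segment to `z₀` is convex, and all
  -- arguments of `g` stay inside it.
  obtain ⟨δ, hδ, hδT⟩ := hcomp.exists_thickening_subset_open hTo hsegT
  set V := thickening δ (segment ℝ 0 z₀) with hV
  have hVc : Convex ℝ V := (convex_segment 0 z₀).thickening δ
  have hVo : IsOpen V := isOpen_thickening
  have hgV : DifferentiableOn ℂ g V := hg.mono hδT
  set ε := min r (δ / 3) with hε
  have hε0 : 0 < ε := lt_min hr (by positivity)
  have hεr : ε ≤ r := min_le_left _ _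
  have hεδ : 2 * ε < δ := by
    have : ε ≤ δ / 3 := min_le_right _ _
    linarith
  have hmemV (a : ℝ) (ha : a ∈ Icc (0 : ℝ) 1) (x : ℂ) (hx : ‖x - a * z₀‖ < 2 * ε) : x ∈ V := by
    refine mem_thickening_iff.2 ⟨a * z₀, ?_, by rw [dist_eq_norm]; linarith⟩
    rw [segment_eq_image]
    exact ⟨a, ha, by simp⟩
  -- The path goes from `0` to the fixed point `m` near `z₀`, then on to `z`. On the first leg `f`
  -- does not depend on `z`; the second leg lies in the ball, where `f` can be replaced by its
  -- extension `fe`.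
  obtain ⟨m, hmS, hm⟩ := Metric.mem_closure_iff.1 hcl ε hε0
  rw [dist_comm, dist_eq_norm] at hm
  have hmB : m ∈ ball z₀ ε := by rwa [mem_ball, dist_eq_norm]
  have hzmV (z : ℂ) (hz : z ∈ ball z₀ ε) (t : ℝ) (ht : t ∈ Icc (0 : ℝ) 1) : z - t * m ∈ V := by
    rw [mem_ball, dist_eq_norm] at hz
    refine hmemV (1 - t) ⟨sub_nonneg.2 ht.2, sub_le_self _ ht.1⟩ _ ?_
    have : z - t * m - ((1 - t : ℝ) : ℂ) * z₀ = (z - z₀) - t * (m - z₀) := by push_cast; ring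
    rw [this]
    refine (norm_sub_le _ _).trans_lt ?_
    rw [norm_mul, Complex.norm_real, Real.norm_of_nonneg ht.1]
    nlinarith [norm_nonneg (m - z₀), ht.2]
  have hsmall (z : ℂ) (hz : z ∈ ball z₀ ε) (t : ℝ) (ht : t ∈ Icc (0 : ℝ) 1) :
      (1 - t) * (z - m) ∈ V := by
    rw [mem_ball, dist_eq_norm] at hz
    refine hmemV 0 (by simp) _ ?_
    have h1 : (1 - (t : ℂ)) = ((1 - t : ℝ) : ℂ) := by push_cast; rfl
    rw [Complex.ofReal_zero, zero_mul, sub_zero, h1, norm_mul, Complex.norm_real,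
      Real.norm_of_nonneg (sub_nonneg.2 ht.2)]
    have h2 : ‖z - m‖ < 2 * ε := by
      rw [← sub_sub_sub_cancel_right z m z₀]
      refine (norm_sub_le _ _).trans_lt (by linarith)
    nlinarith [norm_nonneg (z - m), ht.1]
  have hsegB (z : ℂ) (hz : z ∈ ball z₀ ε) (t : ℝ) (ht : t ∈ Icc (0 : ℝ) 1) :
      m + t * (z - m) ∈ ball z₀ ε := by
    have := (convex_ball z₀ ε).add_smul_sub_mem hmB hz ht
    simpa using this
  have hsegS (z : ℂ) (hz : z ∈ S) (t : ℝ) (ht : t ∈ Icc (0 : ℝ) 1) : m + t * (z - m) ∈ S := by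
    have := hS.add_smul_sub_mem hmS hz ht
    simpa using this
  refine ⟨ε, hε0, hεr, fun z hz => hδT ?_, fun z =>
    m * (∫ t in (0 : ℝ)..1, f (t * m) * g (z - t * m)) +
      (z - m) * ∫ t in (0 : ℝ)..1, fe (m + t * (z - m)) * g ((1 - t) * (z - m)), ?_, ?_⟩
  · simpa using hzmV z hz 0 (by simp)
  · have hfm : ContinuousOn (fun t : ℝ => f (t * m)) (Icc 0 1) :=
      hf.continuousOn.comp (by fun_prop) fun t ht => hD m (hSD hmS) t ht
    refine ((differentiableOn_intervalIntegral isOpen_ball zero_le_one ?_ fun t ht => ?_).const_mul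
      _).add ((differentiableOn_id.sub_const m).mul
      (differentiableOn_intervalIntegral isOpen_ball zero_le_one ?_ fun t ht => ?_))
    · exact (hfm.comp (by fun_prop) fun p hp => hp.2).mul (hgV.continuousOn.comp (by fun_prop)
        fun p hp => hzmV p.1 hp.1 p.2 hp.2)
    · exact (hgV.comp (by fun_prop) fun z hz => hzmV z hz t ht).const_mul _
    · exact (hfe.continuousOn.comp (by fun_prop) fun p hp =>
        ball_subset_ball hεr (hsegB p.1 hp.1 p.2 hp.2)).mul (hgV.continuousOn.comp (by fun_prop)
        fun p hp => hsmall p.1 hp.1 p.2 hp.2)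
    · exact (hfe.comp (by fun_prop) fun z hz => ball_subset_ball hεr (hsegB z hz t ht)).mul
        (hgV.comp (by fun_prop) fun z hz => hsmall z hz t ht)
  · rintro z ⟨hz, hzS⟩
    have hzV : z ∈ V := by simpa using hzmV z hz 0 (by simp)
    have hzm : z - m ∈ V := by simpa using hzmV z hz 1 (by simp)
    have h0 : (0 : ℂ) ∈ V := by simpa using hsmall z hz 1 (by simp)
    rw [rayConv_eq_broken hDo hD hf hVo hVc hgV hzV hzm h0 fun t ht => hSD (hsegS z hzS t ht)]
    congr 2
    refine intervalIntegral.integral_congr fun t ht => ?_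
    rw [uIcc_of_le zero_le_one] at ht
    rw [heq _ ⟨ball_subset_ball hεr (hsegB z hz t ht), hsegS z hzS t ht⟩]

/-- From the right half plane this is `exists_borel_extension` with `κ = 3`; from the left it is the
case `κ = -3` at the opposite point, by `borel_neg`. -/
theorem exists_borel_extension_near {y₀ : ℝ} (hy : ∀ j : ℕ, |y₀| ≠ 2 * Real.pi * j) {σ : ℝ}
    (hσ : σ = 1 ∨ σ = -1) : ∃ r, 0 < r ∧ ∃ A : ℂ → ℂ,
      DifferentiableOn ℂ A (ball (y₀ * Complex.I) r) ∧
      ∀ x ∈ ball (y₀ * Complex.I) r, 0 < σ * x.re → borel 3 x = A x := by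
  have key (κ : ℤ) (c : ℕ → ℝ) (hc : IsReflectionCoeff κ c) (y₀ : ℝ)
      (hy : ∀ j : ℕ, |y₀| ≠ 2 * Real.pi * j) : ∃ r, 0 < r ∧ ∃ A : ℂ → ℂ,
      DifferentiableOn ℂ A (ball (y₀ * Complex.I) r) ∧
      ∀ x ∈ ball (y₀ * Complex.I) r, 0 < x.re → borel κ x = A x := by
    obtain ⟨M, hM⟩ := exists_nat_gt (|y₀| / (2 * Real.pi))
    rw [div_lt_iff₀ (by positivity)] at hM
    obtain ⟨A, hA⟩ := exists_borel_extension hc M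
    have h1 : ∀ᶠ x : ℂ in 𝓝 (y₀ * Complex.I), |x.im| < 2 * Real.pi * (M + 1) := by
      refine ContinuousAt.eventually_lt (by fun_prop) (by fun_prop) ?_
      simp only [Complex.mul_im, Complex.ofReal_re, Complex.I_im, mul_one, Complex.ofReal_im,
        Complex.I_re, mul_zero, add_zero]
      nlinarith [Real.pi_pos]
    have h2 : ∀ᶠ x : ℂ in 𝓝 (y₀ * Complex.I),
        ∀ j ∈ Finset.range (M + 1), |x.im| ≠ 2 * Real.pi * (j : ℕ) := by
      refine (Finset.eventually_all _).2 fun j _ => ?_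
      have : ContinuousAt (fun x : ℂ => |x.im|) (y₀ * Complex.I) := by fun_prop
      exact this.eventually_ne (by simpa using hy j)
    obtain ⟨r, hr, h⟩ := Metric.eventually_nhds_iff_ball.1 (h1.and h2)
    refine ⟨r, hr, A, fun x hx => ?_, fun x hx hx' => ?_⟩
    · exact (hA x (h x hx).1 fun j hj =>
        (h x hx).2 j (by simpa [Nat.lt_succ_iff] using hj)).1.differentiableWithinAt
    · exact (hA x (h x hx).1 fun j hj =>
        (h x hx).2 j (by simpa [Nat.lt_succ_iff] using hj)).2 hx'
  rcases hσ with rfl | rfl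
  · simpa using key 3 _ isReflectionCoeff_three y₀ hy
  · obtain ⟨r, hr, A, hA, h⟩ := key (-3) _ isReflectionCoeff_neg_three (-y₀)
      fun j => by rw [abs_neg]; exact hy j
    have hmem (x : ℂ) (hx : x ∈ ball (y₀ * Complex.I) r) :
        -x ∈ ball (((-y₀ : ℝ) : ℂ) * Complex.I) r := by
      rw [mem_ball, dist_eq_norm] at hx ⊢
      rw [← norm_neg]
      push_cast
      convert! hx using 2
      ring
    refine ⟨r, hr, fun x => -A (-x), (hA.comp (by fun_prop) hmem).neg, fun x hx hx' => ?_⟩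
    simp only
    rw [← h (-x) (hmem x hx) (by simp at hx' ⊢; linarith), borel_neg]
    simp

/-- The density extends analytically across each cut from either side, away from the poles. -/
theorem exists_density_extension {c : ℂ} (hc : 0 < c.re) (hc' : c.im ≠ 0) {z₀ : ℂ} {y₀ : ℝ}
    (hz₀ : c * z₀ = y₀ * Complex.I) (hy : ∀ j : ℕ, |y₀| ≠ 2 * Real.pi * j) {σ : ℝ}
    (hσ : σ = 1 ∨ σ = -1) : ∃ r, 0 < r ∧ ∃ G : ℂ → ℂ, DifferentiableOn ℂ G (ball z₀ r) ∧
      ball z₀ r ∩ {z | 0 < σ * (c * z).re} ⊆ doubleSlit c ∧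
      EqOn (density c) G (ball z₀ r ∩ {z | 0 < σ * (c * z).re}) := by
  have hc0 : c ≠ 0 := fun h => by rw [h] at hc; simp at hc
  have hσ2 : σ * σ = 1 := by rcases hσ with rfl | rfl <;> norm_num
  have hy0 : y₀ ≠ 0 := fun h => hy 0 (by simp [h])
  obtain ⟨r, hr, A, hA, hAeq⟩ := exists_borel_extension_near hy hσ
  have hrc : 0 < r / ‖c‖ := div_pos hr (norm_pos_iff.2 hc0)
  have hmaps (z : ℂ) (hz : z ∈ ball z₀ (r / ‖c‖)) : c * z ∈ ball (y₀ * Complex.I) r := by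
    rw [mem_ball, dist_eq_norm] at hz ⊢
    rw [← hz₀, ← mul_sub, norm_mul, mul_comm]
    exact (lt_div_iff₀ (norm_pos_iff.2 hc0)).1 hz
  set S : Set ℂ := {z | 0 < σ * (c * z).re} with hS
  have hSl (z : ℂ) : σ * (c * z).re = (σ * c.re) * z.re + (-(σ * c.im)) * z.im := by
    simp only [Complex.mul_re]; ring
  have hSc : Convex ℝ S := by
    refine convex_halfSpace_gt (f := fun z : ℂ => σ * (c * z).re) ⟨fun x y => ?_, fun a x => ?_⟩ 0
    · simp only [mul_add, Complex.add_re]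
    · simp only [Complex.real_smul, Complex.mul_re, Complex.mul_im, Complex.ofReal_re,
        Complex.ofReal_im, smul_eq_mul]
      ring
  have hSD : S ⊆ {z | c * z ∈ slitDomain} := fun z hz => Or.inl fun h => by
    have hz' : 0 < σ * (c * z).re := hz
    rw [h, mul_zero] at hz'
    exact lt_irrefl _ hz'
  -- Since `c` is neither real nor imaginary, the two lines meet only at the origin. The second
  -- factor is therefore holomorphic at `z₀`.
  have hT : z₀ ∈ {z | (starRingEnd ℂ) c * z ∈ slitDomain} := by
    left
    have h1 : z₀ = y₀ * Complex.I / c := by rw [← hz₀]; field_simp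
    have h2 : (starRingEnd ℂ) c * z₀ = (y₀ / Complex.normSq c : ℝ) *
        (Complex.I * ((starRingEnd ℂ) c * (starRingEnd ℂ) c)) := by
      rw [h1, div_eq_mul_inv, Complex.inv_def]
      push_cast
      ring
    rw [h2, Complex.re_ofReal_mul]
    refine mul_ne_zero (div_ne_zero hy0 (by simpa using hc0)) ?_
    simp only [Complex.mul_re, Complex.I_re, zero_mul, Complex.I_im, Complex.mul_im,
      Complex.conj_re, Complex.conj_im, one_mul, zero_sub]
    intro h
    have : c.re * c.im = 0 := by linarith
    rcases mul_eq_zero.1 this with h | h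
    · exact hc.ne' h
    · exact hc' h
  have hcl : z₀ ∈ closure S := by
    refine Metric.mem_closure_iff.2 fun ε hε => ⟨z₀ + σ * (ε / 2 * ‖c‖ : ℝ) / c, ?_, ?_⟩
    · have h1 : c * (z₀ + σ * (ε / 2 * ‖c‖ : ℝ) / c) =
          y₀ * Complex.I + ((σ * (ε / 2 * ‖c‖) : ℝ) : ℂ) := by
        rw [← hz₀]; push_cast; field_simp
      change 0 < σ * (c * (z₀ + σ * (ε / 2 * ‖c‖ : ℝ) / c)).re
      rw [h1]
      have hn : 0 < ‖c‖ := norm_pos_iff.2 hc0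
      have : 0 < σ * σ * (ε / 2 * ‖c‖) := by rw [hσ2]; positivity
      simpa [mul_assoc] using this
    · rw [dist_eq_norm, sub_add_cancel_left, norm_neg, norm_div, norm_mul, Complex.norm_real,
        Complex.norm_real]
      have hn : 0 < ‖c‖ := norm_pos_iff.2 hc0
      have h3 : ‖σ‖ = 1 := by rcases hσ with rfl | rfl <;> simp
      rw [h3, Real.norm_of_nonneg (by positivity : 0 ≤ ε / 2 * ‖c‖), one_mul, mul_div_assoc, div_self hn.ne']
      linarith
  have hfe : DifferentiableOn ℂ (fun z => c * A (c * z)) (ball z₀ (r / ‖c‖)) :=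
    (hA.comp (f := fun z => c * z) (by fun_prop) hmaps).const_mul c
  obtain ⟨ε, hε, hεr, hεT, G, hG, hGeq⟩ := exists_rayConv_extension (isOpen_ray_slitDomain c)
    (isStar_ray_slitDomain c) (differentiableOn_rayDensity c) (isOpen_ray_slitDomain _)
    (isStar_ray_slitDomain _) (differentiableOn_rayDensity ((starRingEnd ℂ) c)) hT hrc hfe hSD hSc
    (fun z hz => by rw [rayDensity, hAeq _ (hmaps z hz.1) hz.2]) hcl
  refine ⟨ε, hε, fun z => c * A (c * z) + rayDensity ((starRingEnd ℂ) c) z + G z,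
    ((hfe.mono (ball_subset_ball hεr)).add ((differentiableOn_rayDensity _).mono hεT)).add hG,
    fun z hz => ⟨hSD hz.2, hεT hz.1⟩, ?_⟩
  rintro z ⟨hz, hzS⟩
  rw [density_eq hc ⟨hSD hzS, hεT hz⟩]
  simp only
  rw [hGeq ⟨hz, hzS⟩, rayDensity, hAeq _ (hmaps z (ball_subset_ball hεr hz)) hzS]

/-! ### The pole pairs -/

theorem conj_resonance (η φ : ℝ) (j : ℤ) : (starRingEnd ℂ) (resonance η φ j) =
    (groundFrequency η φ : ℂ) + j * η * Complex.exp (Complex.I * φ) := by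
  simp only [resonance, map_add, map_mul, Complex.conj_ofReal, conj_exp_neg_I_mul]
  simp

theorem singularPoints_subset_cuts (hη : 0 < η) : singularPoints η φ ⊆ cuts η φ := by
  rintro z ⟨j, hj, hz⟩
  have h1 : η ≤ |((j : ℝ) * η)| := by
    rw [abs_mul, abs_of_pos hη]
    have : (1 : ℝ) ≤ |(j : ℝ)| := by exact_mod_cast Int.one_le_abs hj
    nlinarith
  refine ⟨j * η, h1, ?_⟩
  push_cast
  rcases hz with rfl | rfl
  · exact Or.inr rfl
  · exact Or.inl (conj_resonance η φ j)

theorem analyticAt_polePair {j : ℕ} (hj : 1 ≤ j) {z : ℂ} (hz : z ∉ singularPoints η φ) :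
    AnalyticAt ℂ (polePair η φ j) z := by
  have hj0 : (j : ℤ) ≠ 0 := by omega
  have hpi : (2 * Real.pi * Complex.I : ℂ) ≠ 0 := by simp [Real.pi_ne_zero]
  have h1 : z - resonance η φ j ≠ 0 := fun h => hz ⟨j, hj0, Or.inl (sub_eq_zero.1 h)⟩
  have h2 : z - (starRingEnd ℂ) (resonance η φ j) ≠ 0 := fun h =>
    hz ⟨j, hj0, Or.inr (sub_eq_zero.1 h)⟩
  unfold polePair
  refine AnalyticAt.add (AnalyticAt.div (by fun_prop) (by fun_prop) ?_)
    (AnalyticAt.div (by fun_prop) (by fun_prop) ?_)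
  · exact mul_ne_zero hpi h1
  · exact mul_ne_zero hpi h2

theorem polePair_conj (η φ : ℝ) (j : ℕ) (z : ℂ) :
    polePair η φ j ((starRingEnd ℂ) z) = (starRingEnd ℂ) (polePair η φ j z) := by
  simp only [polePair, map_add, map_div₀, map_mul, map_sub, map_neg, map_one, Complex.conj_I,
    Complex.conj_ofReal, Complex.conj_conj, map_ofNat]
  rw [add_comm]
  congr 1
  · rw [mul_neg, neg_mul, neg_div_neg_eq]
  · rw [mul_neg, neg_mul, div_neg, neg_div]

/-- The first term is the pole that `rayDensity` inherits from `borel 3`. The second has, for `j ≥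
1`, its pole in the lower half plane and can be absorbed into the bounded error on the first
quadrant. -/
theorem polePair_eq (hη : 0 < η) (j : ℕ) (z : ℂ) :
    polePair η φ j ((groundFrequency η φ : ℂ) + z) =
      slope η φ * (1 / (2 * Real.pi * Complex.I * (slope η φ * z - 2 * Real.pi * Complex.I * j))) -
      1 / (2 * Real.pi * Complex.I * (z - j * η * Complex.exp (-(Complex.I * φ)))) := by
  have hc := slope_ne_zero (φ := φ) hη
  have h1 : slope η φ * (j * η * Complex.exp (Complex.I * φ)) = 2 * Real.pi * Complex.I * j := by
    have := slope_mul_exp η φ (j * η)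
    push_cast at this
    rw [this]
    have : (η : ℂ) ≠ 0 := by exact_mod_cast hη.ne'
    field_simp
  have h2 : slope η φ * (1 / (2 * Real.pi * Complex.I *
      (slope η φ * z - 2 * Real.pi * Complex.I * j))) =
      1 / (2 * Real.pi * Complex.I * (z - j * η * Complex.exp (Complex.I * φ))) := by
    rw [← h1, ← mul_sub, mul_left_comm, one_div, mul_inv, ← mul_assoc, mul_inv_cancel₀ hc, one_mul,
      one_div]
  rw [h2, polePair, conj_resonance, resonance]
  simp only [Int.cast_natCast, add_sub_add_left_eq_sub]
  ring

theorem inv_sub_inv_eq_lorentz {A B b i p : ℂ} (hA : A ≠ 0) (hB : B ≠ 0) (hi : i ≠ 0) (hp : p ≠ 0)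
    (h : A - B = 2 * b * i) :
    -1 / (2 * p * i * A) + 1 / (2 * p * i * B) = 1 / p * (b / (A * B)) := by
  field_simp
  linear_combination h

theorem polePair_ofReal (hη : 0 < η) (hφ : 0 < φ) (hφ' : φ < Real.pi / 2) {j : ℕ} (hj : 1 ≤ j)
    (ω : ℝ) : polePair η φ j ω = ((1 / Real.pi * (j * η * Real.sin φ /
          ((ω - groundFrequency η φ - j * η * Real.cos φ) ^ 2 +
            (j * η * Real.sin φ) ^ 2)) : ℝ) : ℂ) := by
  have hsin := Real.sin_pos_of_pos_of_lt_pi hφ (by linarith [Real.pi_pos])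
  have hj' : (0 : ℝ) < j := by exact_mod_cast hj
  set a := ω - groundFrequency η φ - j * η * Real.cos φ with ha
  set b := j * η * Real.sin φ with hb
  have hb0 : 0 < b := by positivity
  have h1 : (ω : ℂ) - resonance η φ j = a + b * Complex.I := by
    rw [resonance, exp_neg_I_mul, ha, hb]
    push_cast
    ring
  have h2 : (ω : ℂ) - (starRingEnd ℂ) (resonance η φ j) = a - b * Complex.I := by
    rw [conj_resonance, exp_I_mul, ha, hb]
    push_cast
    ring
  have h3 : (a : ℂ) + b * Complex.I ≠ 0 := fun h => hb0.ne' (by simpa using congrArg Complex.im h)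
  have h4 : (a : ℂ) - b * Complex.I ≠ 0 := fun h => hb0.ne' (by simpa using congrArg Complex.im h)
  have h5 : ((a : ℂ) ^ 2 + (b : ℂ) ^ 2) = (a + b * Complex.I) * (a - b * Complex.I) := by
    linear_combination ((b : ℂ) ^ 2) * Complex.I_sq
  have hp : (Real.pi : ℂ) ≠ 0 := by exact_mod_cast Real.pi_ne_zero
  rw [polePair, h1, h2]
  push_cast
  rw [h5]
  exact inv_sub_inv_eq_lorentz h3 h4 Complex.I_ne_zero hp (by ring)

theorem integral_lorentz (a : ℝ) {b : ℝ} (hb : 0 < b) :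
    Integrable (fun ω : ℝ => 1 / Real.pi * (b / ((ω - a) ^ 2 + b ^ 2))) ∧
      ∫ ω : ℝ, 1 / Real.pi * (b / ((ω - a) ^ 2 + b ^ 2)) = 1 := by
  have e : (fun ω : ℝ => 1 / Real.pi * (b / ((ω - a) ^ 2 + b ^ 2))) =
      fun ω => (1 / Real.pi * b⁻¹) * (fun x : ℝ => (1 + (b⁻¹ * x) ^ 2)⁻¹) (ω - a) := by
    ext ω
    field_simp
    ring
  have h1 : Integrable fun x : ℝ => (1 + (b⁻¹ * x) ^ 2)⁻¹ :=
    integrable_inv_one_add_sq.comp_mul_left' (inv_ne_zero hb.ne')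
  rw [e]
  refine ⟨(h1.comp_sub_right a).const_mul _, ?_⟩
  rw [integral_const_mul, integral_sub_right_eq_self (fun x : ℝ => (1 + (b⁻¹ * x) ^ 2)⁻¹),
    Measure.integral_comp_mul_left (fun x : ℝ => (1 + x ^ 2)⁻¹), integral_univ_inv_one_add_sq,
    inv_inv, abs_of_pos hb, smul_eq_mul]
  field_simp

/-! ### The remainder is analytic up to the cuts -/

theorem exists_continuedDensity_extension {Φ Q : ℂ → ℂ} (hΦ : IsContinuedDensity η φ Φ) (hη : 0 < η)
    (hφ : 0 < φ) (hφ' : φ < Real.pi / 2) {c z₀ : ℂ} {y₀ σ : ℝ} (hc : 0 < c.re) (hc' : c.im ≠ 0)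
    (hcs : c = slope η φ ∨ c = (starRingEnd ℂ) (slope η φ))
    (hz₀ : c * z₀ = y₀ * Complex.I) (hy : ∀ j : ℕ, |y₀| ≠ 2 * Real.pi * j)
    (hσ : σ = 1 ∨ σ = -1) (hQ : AnalyticAt ℂ Q (groundFrequency η φ + z₀)) :
    ∃ ε, 0 < ε ∧ ∃ G : ℂ → ℂ, AnalyticOnNhd ℂ G (ball (groundFrequency η φ + z₀) ε) ∧
      EqOn (fun z => Φ z - Q z) G (ball (groundFrequency η φ + z₀) ε ∩
        {z | 0 < σ * (c * (z - groundFrequency η φ)).re}) := by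
  obtain ⟨r, hr, G, hG, hsub, hGeq⟩ := exists_density_extension hc hc' hz₀ hy hσ
  obtain ⟨r', hr', hQ'⟩ := Metric.eventually_nhds_iff_ball.1 hQ.eventually_analyticAt
  have hmaps (z : ℂ) (hz : z ∈ ball ((groundFrequency η φ : ℂ) + z₀) (min r r')) :
      z - groundFrequency η φ ∈ ball z₀ r := by
    rw [mem_ball, dist_eq_norm] at hz ⊢
    rw [sub_sub]
    exact hz.trans_le (min_le_left _ _)
  have hdd : doubleSlit c = doubleSlit (slope η φ) := by
    rcases hcs with rfl | rfl
    · rfl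
    · ext z
      simp only [doubleSlit, Complex.conj_conj]
      exact and_comm
  have hde (z : ℂ) : density c z = density (slope η φ) z := by
    rcases hcs with rfl | rfl
    · rfl
    · exact density_conj_left _ _
  refine ⟨min r r', lt_min hr hr', fun z => G (z - groundFrequency η φ) - Q z, ?_, ?_⟩
  · intro z hz
    refine AnalyticAt.sub ?_ (hQ' z (ball_subset_ball (min_le_right _ _) hz))
    exact (hG.analyticAt (isOpen_ball.mem_nhds (hmaps z hz))).comp_of_eq
      (f := fun z : ℂ => z - groundFrequency η φ) (by fun_prop) rfl
  · rintro z ⟨hz, hzS⟩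
    have h1 := hmaps z hz
    have h2 : z - groundFrequency η φ ∈ doubleSlit (slope η φ) := hdd ▸ hsub ⟨h1, hzS⟩
    have h3 := continuedDensity_eq_density hΦ hη hφ hφ' h2
    rw [add_sub_cancel] at h3
    simp only
    rw [h3, ← hde, hGeq ⟨h1, hzS⟩]

theorem slope_im (η φ : ℝ) : (slope η φ).im = 2 * Real.pi / η * Real.cos φ := by
  rw [slope, Complex.im_ofReal_mul, exp_neg_I_mul]
  simp [Complex.mul_im, -Complex.ofReal_sin, -Complex.ofReal_cos]

theorem slope_im_pos (hη : 0 < η) (hφ : 0 < φ) (hφ' : φ < Real.pi / 2) : 0 < (slope η φ).im := by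
  rw [slope_im]
  have := Real.cos_pos_of_mem_Ioo ⟨by linarith, hφ'⟩
  have := Real.pi_pos
  positivity

theorem re_slope_mul (η φ : ℝ) (w : ℂ) : (slope η φ * w).re =
    -(2 * Real.pi / η * (w / Complex.exp (Complex.I * φ)).im) := by
  have : slope η φ * w = ((2 * Real.pi / η : ℝ) : ℂ) *
      (Complex.I * (w / Complex.exp (Complex.I * φ))) := by
    rw [slope, Complex.exp_neg]; ring
  rw [this, Complex.re_ofReal_mul]
  simp

theorem re_conj_slope_mul (η φ : ℝ) (w : ℂ) : ((starRingEnd ℂ) (slope η φ) * w).re =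
    2 * Real.pi / η * (w / Complex.exp (-(Complex.I * φ))).im := by
  have : (starRingEnd ℂ) (slope η φ) * w = ((2 * Real.pi / η : ℝ) : ℂ) *
      (-Complex.I * (w / Complex.exp (-(Complex.I * φ)))) := by
    rw [conj_slope, Complex.exp_neg, div_inv_eq_mul]; ring
  rw [this, Complex.re_ofReal_mul]
  simp

/-- The subtracted function is analytic off the singular points, so the claim concerns the density
alone, at points of a cut that are not poles. -/
theorem analyticUpToCuts_sub {Φ Q : ℂ → ℂ} (hΦ : IsContinuedDensity η φ Φ) (hη : 0 < η)
    (hφ : 0 < φ) (hφ' : φ < Real.pi / 2) (hQ : ∀ z, z ∉ singularPoints η φ → AnalyticAt ℂ Q z) :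
    AnalyticUpToCuts η φ fun z => Φ z - Q z := by
  have hpi := Real.pi_pos
  have hcr := slope_re_pos hη hφ hφ'
  have hci := slope_im_pos hη hφ hφ'
  have hpos : 0 < 2 * Real.pi / η := by positivity
  refine ⟨fun z hz => (hΦ.analytic z hz).sub
    (hQ z fun h => hz (singularPoints_subset_cuts hη h)), ?_⟩
  intro u hu s hs hsing
  -- Equality would mean `|s| = j η`, a singular point for `j ≥ 1`; the case `j = 0` is excluded by
  -- `η ≤ |s|`.
  have hy (j : ℕ) : |2 * Real.pi / η * s| ≠ 2 * Real.pi * j := by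
    intro h
    rw [abs_mul, abs_of_pos hpos, div_mul_eq_mul_div, div_eq_iff hη.ne', mul_assoc, mul_assoc, mul_assoc] at h
    rw [mul_right_inj' two_ne_zero, mul_right_inj' hpi.ne'] at h
    have hj : j ≠ 0 := by
      rintro rfl
      simp only [CharP.cast_eq_zero, zero_mul] at h
      linarith
    obtain ⟨i, hi, hsi⟩ : ∃ i : ℤ, i ≠ 0 ∧ s = i * η := by
      rcases abs_eq_abs.1 (h.trans (abs_of_pos (by positivity : 0 < (j : ℝ) * η)).symm) with h | h
      · exact ⟨j, by exact_mod_cast hj, by exact_mod_cast h⟩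
      · exact ⟨-j, by simpa using hj, by rw [h]; push_cast; ring⟩
    refine hsing ⟨i, hi, ?_⟩
    rw [conj_resonance, resonance, hsi]
    push_cast
    rcases hu with rfl | rfl
    · exact Or.inr rfl
    · exact Or.inl rfl
  -- Both cuts are treated at once: `c` is the slope or its conjugate, and the sign `τ` records how
  -- the sides of the cut correspond to the sign of `Re (c w)`.
  obtain ⟨c, τ, y₀, hτ, hcs, hc, hc', hz₀, hy₀, hside⟩ : ∃ (c : ℂ) (τ y₀ : ℝ), (τ = 1 ∨ τ = -1) ∧
      (c = slope η φ ∨ c = (starRingEnd ℂ) (slope η φ)) ∧ 0 < c.re ∧ c.im ≠ 0 ∧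
      c * (s * u) = y₀ * Complex.I ∧ |y₀| = |2 * Real.pi / η * s| ∧
      ∀ w : ℂ, (c * w).re = 2 * Real.pi / η * (τ * (w / u).im) := by
    rcases hu with rfl | rfl
    · exact ⟨slope η φ, -1, _, Or.inr rfl, Or.inl rfl, hcr, hci.ne', slope_mul_exp η φ s, rfl,
        fun w => by rw [re_slope_mul]; ring⟩
    · exact ⟨(starRingEnd ℂ) (slope η φ), 1, _, Or.inl rfl, Or.inr rfl, by simpa, by simpa using hci.ne',
        conj_slope_mul_exp η φ s, abs_neg _, fun w => by rw [re_conj_slope_mul]; ring⟩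
  have hττ : τ * τ = 1 := by rcases hτ with rfl | rfl <;> norm_num
  have hy₀' (j : ℕ) : |y₀| ≠ 2 * Real.pi * j := by rw [hy₀]; exact hy j
  obtain ⟨ε₁, hε₁, G₁, hG₁, heq₁⟩ := exists_continuedDensity_extension hΦ hη hφ hφ' hc hc' hcs hz₀
    hy₀' hτ (hQ _ hsing)
  obtain ⟨ε₂, hε₂, G₂, hG₂, heq₂⟩ := exists_continuedDensity_extension (σ := -τ) hΦ hη hφ hφ' hc hc'
    hcs hz₀ hy₀' (by rcases hτ with rfl | rfl <;> simp) (hQ _ hsing)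
  have hs₁ (w : ℂ) : τ * (c * w).re = 2 * Real.pi / η * (w / u).im := by
    rw [hside]; linear_combination (2 * Real.pi / η * (w / u).im) * hττ
  refine ⟨min ε₁ ε₂, lt_min hε₁ hε₂,
    ⟨G₁, hG₁.mono (ball_subset_ball (min_le_left _ _)), fun z hz => heq₁
      ⟨ball_subset_ball (min_le_left _ _) hz.1, ?_⟩⟩,
    ⟨G₂, hG₂.mono (ball_subset_ball (min_le_right _ _)), fun z hz => heq₂
      ⟨ball_subset_ball (min_le_right _ _) hz.1, ?_⟩⟩⟩
  · have h1 : 0 < ((z - groundFrequency η φ) / u).im := hz.2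
    change 0 < τ * (c * (z - groundFrequency η φ)).re
    rw [hs₁]
    exact mul_pos hpos h1
  · have h1 : ((z - groundFrequency η φ) / u).im < 0 := hz.2
    change 0 < -τ * (c * (z - groundFrequency η φ)).re
    rw [neg_mul, hs₁]
    exact neg_pos.2 (mul_neg_of_pos_of_neg hpos h1)

/-! ### Estimate of the density near the cuts -/

/-- The closed first quadrant. -/
def quadrant : Set ℂ := {z | 0 ≤ z.re ∧ 0 ≤ z.im}

theorem isCompact_quadrant (R : ℝ) : IsCompact (closedBall 0 R ∩ quadrant) :=
  (isCompact_closedBall 0 R).inter_right ((isClosed_le continuous_const Complex.continuous_re).inter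
    (isClosed_le continuous_const Complex.continuous_im))

/-- `Re (c̄ z) = Re c Re z + Im c Im z` is positive in the closed quadrant except at the origin. -/
theorem quadrant_subset {c : ℂ} (hc : 0 < c.re) (hc' : 0 < c.im) :
    quadrant ⊆ {z | (starRingEnd ℂ) c * z ∈ slitDomain} := by
  rintro z ⟨h1, h2⟩
  rcases h1.eq_or_lt with h | h
  · rcases h2.eq_or_lt with h' | h'
    · right
      have : z = 0 := Complex.ext h.symm h'.symm
      simp [this, Real.pi_pos]
    · left
      simp only [Complex.mul_re, Complex.conj_re, Complex.conj_im]
      have := mul_pos hc' h'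
      rw [← h]
      linarith
  · left
    simp only [Complex.mul_re, Complex.conj_re, Complex.conj_im]
    have := mul_pos hc h
    have := mul_nonneg hc'.le h2
    linarith

theorem norm_le_of_norm_mul_le {c z : ℂ} (hc : c ≠ 0) {R : ℝ} (h : ‖c * z‖ ≤ R) :
    ‖z‖ ≤ R / ‖c‖ := by
  rw [norm_mul] at h
  rw [le_div_iff₀ (norm_pos_iff.2 hc)]
  linarith

/-- On the quadrant the factor belonging to `conj c` is bounded, so the cross term is at most a
constant times the integral of `|borel 3|` along the ray, which is logarithmic. -/
theorem exists_norm_density_sub_rayDensity_le {c : ℂ} (hc : 0 < c.re) (hc' : 0 < c.im) (K : ℕ) :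
    ∃ C, 0 ≤ C ∧ ∀ z ∈ quadrant, (c * z).re ≠ 0 → 0 ≤ (c * z).im → ‖c * z‖ ≤ 2 * Real.pi * K →
      ‖density c z - rayDensity c z‖ ≤ C * (1 + Real.log (1 + ‖c * z‖ / |(c * z).re|)) := by
  have hc0 : c ≠ 0 := fun h => by rw [h] at hc; simp at hc
  obtain ⟨C₁, hC₁0, hC₁⟩ := exists_integral_norm_borel_le isReflectionCoeff_three
    isReflectionCoeff_neg_three K
  obtain ⟨C₂, hC₂⟩ := (isCompact_quadrant (2 * Real.pi * K / ‖c‖)).exists_bound_of_continuousOn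
    ((differentiableOn_rayDensity ((starRingEnd ℂ) c)).continuousOn.mono
      (inter_subset_right.trans (quadrant_subset hc hc')))
  have hC₂0 : 0 ≤ C₂ := (norm_nonneg _).trans (hC₂ 0 ⟨by simp; positivity, by simp [quadrant]⟩)
  refine ⟨C₂ + C₁ * C₂, by positivity, fun z hz hre him hK => ?_⟩
  have hzn := norm_le_of_norm_mul_le hc0 hK
  have hzR : z ∈ closedBall 0 (2 * Real.pi * K / ‖c‖) ∩ quadrant := ⟨by simpa using hzn, hz⟩
  have hL := log_one_add_nonneg (y := ‖c * z‖ / |(c * z).re|) (by positivity)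
  have hzd : z ∈ doubleSlit c := ⟨Or.inl hre, quadrant_subset hc hc' hz⟩
  rw [density_eq hc hzd]
  have h1 : rayDensity c z + rayDensity ((starRingEnd ℂ) c) z +
      rayConv (rayDensity c) (rayDensity ((starRingEnd ℂ) c)) z - rayDensity c z =
      rayDensity ((starRingEnd ℂ) c) z +
        rayConv (rayDensity c) (rayDensity ((starRingEnd ℂ) c)) z := by ring
  have hcont : ContinuousOn (fun t : ℝ => ‖borel 3 (t * (c * z))‖) (uIcc 0 1) := by
    rw [uIcc_of_le zero_le_one]
    exact ((differentiableOn_borel 3).continuousOn.comp (by fun_prop) fun t ht =>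
      isStar_slitDomain (c * z) hzd.1 t ht).norm
  have h2 : ‖rayConv (rayDensity c) (rayDensity ((starRingEnd ℂ) c)) z‖ ≤
      (‖c * z‖ * ∫ t in (0 : ℝ)..1, ‖borel 3 (t * (c * z))‖) * C₂ := by
    rw [rayConv, norm_mul]
    have h3 : ‖∫ t in (0 : ℝ)..1, rayDensity c (t * z) *
        rayDensity ((starRingEnd ℂ) c) ((1 - t) * z)‖ ≤
        ∫ t in (0 : ℝ)..1, ‖c‖ * C₂ * ‖borel 3 (t * (c * z))‖ := by
      refine intervalIntegral.norm_integral_le_of_norm_le zero_le_one ?_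
        (hcont.intervalIntegrable.const_mul _)
      refine Eventually.of_forall fun t ht => ?_
      have h4 : (1 - (t : ℂ)) * z ∈ closedBall 0 (2 * Real.pi * K / ‖c‖) ∩ quadrant := by
        have h5 : (1 - (t : ℂ)) = ((1 - t : ℝ) : ℂ) := by push_cast; rfl
        have h6 : 0 ≤ 1 - t := sub_nonneg.2 ht.2
        rw [h5]
        refine ⟨?_, ?_, ?_⟩
        · rw [mem_closedBall_zero_iff, norm_mul, Complex.norm_real, Real.norm_of_nonneg h6]
          exact (mul_le_of_le_one_left (norm_nonneg _) (by linarith [ht.1])).trans hzn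
        · rw [Complex.re_ofReal_mul]; exact mul_nonneg h6 hz.1
        · rw [Complex.im_ofReal_mul]; exact mul_nonneg h6 hz.2
      rw [norm_mul, rayDensity, norm_mul, mul_left_comm c]
      calc _ ≤ ‖c‖ * ‖borel 3 (t * (c * z))‖ * C₂ := by gcongr; exact hC₂ _ h4
        _ = _ := by ring
    rw [intervalIntegral.integral_const_mul] at h3
    calc _ ≤ ‖z‖ * (‖c‖ * C₂ * ∫ t in (0 : ℝ)..1, ‖borel 3 (t * (c * z))‖) := by gcongr
      _ = _ := by rw [norm_mul]; ring
  rw [h1]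
  refine (norm_add_le _ _).trans ((add_le_add (hC₂ z hzR) h2).trans ?_)
  have h3 := mul_le_mul_of_nonneg_right (hC₁ (c * z) hre him hK) hC₂0
  nlinarith

/-- If `borel 3` differs from given poles by a logarithmically bounded function, then so does the
density from the corresponding pole pairs. -/
theorem exists_norm_density_sub_polePair_le (hη : 0 < η) (hφ : 0 < φ) (hφ' : φ < Real.pi / 2)
    {K : ℕ} {b : ℕ → ℝ} {P : ℂ → Prop} {C : ℝ} (hC0 : 0 ≤ C)
    (hb : ∀ x : ℂ, P x → 0 ≤ x.im → ‖x‖ ≤ 2 * Real.pi * K → ‖borel 3 x - ∑ j ∈ Finset.Icc 1 K,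
        (b j : ℂ) * (1 / (2 * Real.pi * Complex.I * (x - 2 * Real.pi * Complex.I * j)))‖ ≤
      C * (1 + Real.log (1 + ‖x‖ / |x.re|))) :
    ∃ C', 0 ≤ C' ∧ ∀ z ∈ quadrant, P (slope η φ * z) → (slope η φ * z).re ≠ 0 →
      0 ≤ (slope η φ * z).im → ‖slope η φ * z‖ ≤ 2 * Real.pi * K →
      ‖density (slope η φ) z - ∑ j ∈ Finset.Icc 1 K,
        (b j : ℂ) * polePair η φ j ((groundFrequency η φ : ℂ) + z)‖ ≤
      C' * (1 + Real.log (1 + ‖slope η φ * z‖ / |(slope η φ * z).re|)) := by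
  set c := slope η φ with hcd
  have hc : 0 < c.re := slope_re_pos hη hφ hφ'
  have hc' : 0 < c.im := slope_im_pos hη hφ hφ'
  have hc0 : c ≠ 0 := slope_ne_zero hη
  have hsin := Real.sin_pos_of_pos_of_lt_pi hφ (by linarith [Real.pi_pos])
  obtain ⟨C₁, hC₁0, hC₁⟩ := exists_norm_density_sub_rayDensity_le hc hc' K
  -- These are the halves of the pole pairs with poles in the lower half plane, bounded on the
  -- compact part of the quadrant.
  have hcont : ContinuousOn (fun z : ℂ => ∑ j ∈ Finset.Icc 1 K, (b j : ℂ) *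
      (1 / (2 * Real.pi * Complex.I * (z - j * η * Complex.exp (-(Complex.I * φ)))))) quadrant := by
    refine continuousOn_finsetSum _ fun j hj => continuousOn_const.mul
      (ContinuousOn.div continuousOn_const (by fun_prop) fun z hz => ?_)
    refine mul_ne_zero (by simp [Real.pi_ne_zero]) fun h => ?_
    have hj1 : (0 : ℝ) < j := by exact_mod_cast (Finset.mem_Icc.1 hj).1
    have h1 := congrArg Complex.im (sub_eq_zero.1 h)
    rw [exp_neg_I_mul] at h1
    simp [-Complex.ofReal_sin, -Complex.ofReal_cos] at h1
    have h2 : 0 < j * η * Real.sin φ := by positivity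
    have h3 := hz.2
    linarith
  obtain ⟨C₂, hC₂⟩ := (isCompact_quadrant (2 * Real.pi * K / ‖c‖)).exists_bound_of_continuousOn
    (hcont.mono inter_subset_right)
  have hC₂0 : 0 ≤ C₂ := (norm_nonneg _).trans (hC₂ 0 ⟨by simp; positivity, by simp [quadrant]⟩)
  refine ⟨C₁ + ‖c‖ * C + C₂, by positivity, fun z hz hP hre him hK => ?_⟩
  have hzR : z ∈ closedBall 0 (2 * Real.pi * K / ‖c‖) ∩ quadrant :=
    ⟨by simpa using norm_le_of_norm_mul_le hc0 hK, hz⟩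
  have hL := log_one_add_nonneg (y := ‖c * z‖ / |(c * z).re|) (by positivity)
  have h1 : ‖rayDensity c z - c * ∑ j ∈ Finset.Icc 1 K, (b j : ℂ) *
      (1 / (2 * Real.pi * Complex.I * (c * z - 2 * Real.pi * Complex.I * j)))‖ ≤
      ‖c‖ * C * (1 + Real.log (1 + ‖c * z‖ / |(c * z).re|)) := by
    rw [rayDensity, ← mul_sub, norm_mul, mul_assoc ‖c‖]
    exact mul_le_mul_of_nonneg_left (hb _ hP him hK) (norm_nonneg _)
  refine (norm_le_of_eq_add_add (hC₁ z hz hre him hK) h1 (hC₂ z hzR) ?_).trans ?_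
  · simp only [polePair_eq hη, mul_sub, Finset.sum_sub_distrib, Finset.mul_sum]
    rw [Finset.sum_congr rfl fun j _ => mul_left_comm (b j : ℂ) (slope η φ) _, ← hcd]
    ring
  · nlinarith

/-- Jordan's inequality bounds `1 + 1 / sin d` by `π / d`, and `1 + log π ≤ 4`. -/
theorem log_one_add_inv_sin_le {d : ℝ} (hd : 0 < d) (hd' : d < Real.pi / 2) :
    1 + Real.log (1 + 1 / Real.sin d) ≤ 4 * (1 + |Real.log d|) := by
  have hpi := Real.pi_pos
  have h1 := Real.mul_le_sin hd.le hd'.le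
  have h0 : 0 < 2 / Real.pi * d := by positivity
  have h2 : 1 + 1 / Real.sin d ≤ Real.pi / d := by
    have h3 : 1 / Real.sin d ≤ 1 / (2 / Real.pi * d) := one_div_le_one_div_of_le h0 h1
    have h4 : 1 / (2 / Real.pi * d) = Real.pi / (2 * d) := by field_simp
    have h5 : 1 ≤ Real.pi / (2 * d) := by rw [le_div_iff₀ (by positivity)]; linarith
    have h6 : Real.pi / d = Real.pi / (2 * d) + Real.pi / (2 * d) := by field_simp; ring
    linarith
  have hs : 0 < Real.sin d := h0.trans_le h1
  have h3 := Real.log_le_log (by positivity) h2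
  rw [Real.log_div hpi.ne' hd.ne'] at h3
  have h4 : Real.log Real.pi ≤ 3 := by
    have := Real.log_le_sub_one_of_pos hpi
    linarith [Real.pi_lt_four]
  linarith [neg_abs_le (Real.log d), abs_nonneg (Real.log d)]

/-! ### Polar coordinates about the ground frequency -/

theorem slope_mul_polar (η φ s χ : ℝ) : slope η φ * (s * Complex.exp (Complex.I * χ)) =
    (2 * Real.pi / η * s * Real.sin (φ - χ) : ℝ) +
      (2 * Real.pi / η * s * Real.cos (φ - χ) : ℝ) * Complex.I := by
  have h : Complex.exp (-(Complex.I * φ)) * Complex.exp (Complex.I * χ) =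
      Real.cos (φ - χ) - Real.sin (φ - χ) * Complex.I := by
    rw [← exp_neg_I_mul, ← Complex.exp_add]
    push_cast
    ring_nf
  rw [slope]
  push_cast at h ⊢
  linear_combination (2 * Real.pi / η * s * Complex.I : ℂ) * h -
    (2 * Real.pi / η * s * Complex.sin (φ - χ) : ℂ) * Complex.I_sq

theorem norm_slope_mul_polar (hη : 0 < η) {s : ℝ} (hs : 0 < s) (χ : ℝ) :
    ‖slope η φ * (s * Complex.exp (Complex.I * χ))‖ = 2 * Real.pi / η * s := by
  have hpi := Real.pi_pos
  have h1 : ‖Complex.exp (Complex.I * χ)‖ = 1 := by rw [mul_comm, Complex.norm_exp_ofReal_mul_I]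
  have h2 : ‖Complex.exp (-(Complex.I * φ))‖ = 1 := by
    rw [show -(Complex.I * (φ : ℂ)) = ((-φ : ℝ) : ℂ) * Complex.I by push_cast; ring,
      Complex.norm_exp_ofReal_mul_I]
  rw [slope, norm_mul, norm_mul, norm_mul, norm_mul, h1, h2, Complex.norm_I, Complex.norm_real,
    Complex.norm_real, Real.norm_of_nonneg (by positivity), Real.norm_of_nonneg hs.le]
  ring

theorem re_slope_mul_polar (η φ s χ : ℝ) : (slope η φ * (s * Complex.exp (Complex.I * χ))).re =
    2 * Real.pi / η * s * Real.sin (φ - χ) := by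
  rw [slope_mul_polar]
  simp [-Complex.ofReal_sin, -Complex.ofReal_cos, -Complex.ofReal_mul]

theorem polar_mem_doubleSlit (hη : 0 < η) (hφ : 0 < φ) (hφ' : φ < Real.pi / 2) {s χ : ℝ}
    (hs : 0 < s) (hχ : |χ| < Real.pi / 2) (hne : φ ≠ |χ|) :
    (s : ℂ) * Complex.exp (Complex.I * χ) ∈ doubleSlit (slope η φ) := by
  have hpi := Real.pi_pos
  have hq0 : 2 * Real.pi / η * s ≠ 0 := by positivity
  have hsin (χ : ℝ) (hχ : |χ| < Real.pi / 2) (hne : φ ≠ |χ|) : Real.sin (φ - χ) ≠ 0 := by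
    rw [abs_lt] at hχ
    intro h
    have h1 := (Real.sin_eq_zero_iff_of_lt_of_lt (by linarith) (by linarith)).1 h
    exact hne (by rw [← sub_eq_zero.1 h1, abs_of_pos hφ])
  refine ⟨Or.inl ?_, Or.inl ?_⟩
  · rw [re_slope_mul_polar]
    exact mul_ne_zero hq0 (hsin χ hχ hne)
  · have h1 : (starRingEnd ℂ) (slope η φ) * (s * Complex.exp (Complex.I * χ)) =
        (starRingEnd ℂ) (slope η φ * (s * Complex.exp (Complex.I * (-χ : ℝ)))) := by
      rw [map_mul, map_mul, Complex.conj_ofReal, ← Complex.exp_conj]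
      simp
    rw [h1, Complex.conj_re, re_slope_mul_polar]
    exact mul_ne_zero hq0 (hsin (-χ) (by rwa [abs_neg]) (by rwa [abs_neg]))

/-- Passage to polar coordinates; the lower half plane is reached by conjugation. -/
theorem norm_density_sub_polar_le (hη : 0 < η) (hφ : 0 < φ) (hφ' : φ < Real.pi / 2)
    {K : ℕ} {b : ℕ → ℝ} {P : ℂ → Prop} {C : ℝ} (hC0 : 0 ≤ C)
    (h : ∀ z ∈ quadrant, P (slope η φ * z) → (slope η φ * z).re ≠ 0 →
      0 ≤ (slope η φ * z).im → ‖slope η φ * z‖ ≤ 2 * Real.pi * K →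
      ‖density (slope η φ) z - ∑ j ∈ Finset.Icc 1 K,
        (b j : ℂ) * polePair η φ j ((groundFrequency η φ : ℂ) + z)‖ ≤
      C * (1 + Real.log (1 + ‖slope η φ * z‖ / |(slope η φ * z).re|)))
    {s χ : ℝ} (hs : 0 < s) (hsK : s ≤ K * η) (hχ : |χ| < Real.pi / 2) (hne : φ ≠ |χ|)
    (hP : P (slope η φ * (s * Complex.exp (Complex.I * |χ|)))) :
    ‖density (slope η φ) (s * Complex.exp (Complex.I * χ)) - ∑ j ∈ Finset.Icc 1 K,
        (b j : ℂ) * polePair η φ j ((groundFrequency η φ : ℂ) + s * Complex.exp (Complex.I * χ))‖ ≤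
      4 * C * (1 + |Real.log (abs (φ - |χ|))|) := by
  have hpi := Real.pi_pos
  have hχ0 := abs_nonneg χ
  have key : ‖density (slope η φ) (s * Complex.exp (Complex.I * |χ|)) - ∑ j ∈ Finset.Icc 1 K,
        (b j : ℂ) * polePair η φ j ((groundFrequency η φ : ℂ) +
          s * Complex.exp (Complex.I * |χ|))‖ ≤ 4 * C * (1 + |Real.log (abs (φ - |χ|))|) := by
    set ψ := |χ| with hψ
    have hd : 0 < |φ - ψ| := abs_pos.2 (sub_ne_zero.2 hne)
    have hd' : |φ - ψ| < Real.pi / 2 := by rw [abs_lt]; constructor <;> linarith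
    have hsin := Real.sin_pos_of_pos_of_lt_pi hd (by linarith)
    have hsin' : |Real.sin (φ - ψ)| = Real.sin |φ - ψ| := by
      rw [abs_lt] at hd'
      exact (Real.abs_sin_eq_sin_abs_of_abs_le_pi (by rw [abs_le]; constructor <;> linarith))
    have hre : (slope η φ * (s * Complex.exp (Complex.I * ψ))).re =
        2 * Real.pi / η * s * Real.sin (φ - ψ) := re_slope_mul_polar η φ s ψ
    have him : (slope η φ * (s * Complex.exp (Complex.I * ψ))).im =
        2 * Real.pi / η * s * Real.cos (φ - ψ) := by
      rw [slope_mul_polar]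
      simp [-Complex.ofReal_sin, -Complex.ofReal_cos, -Complex.ofReal_mul]
    have hq : (s : ℂ) * Complex.exp (Complex.I * ψ) ∈ quadrant := by
      rw [exp_I_mul]
      have h1 := Real.cos_nonneg_of_mem_Icc (x := ψ) ⟨by linarith, hχ.le⟩
      have h2 := Real.sin_nonneg_of_nonneg_of_le_pi hχ0 (by linarith)
      constructor
      · rw [Complex.re_ofReal_mul]
        simpa [-Complex.ofReal_sin, -Complex.ofReal_cos] using mul_nonneg hs.le h1
      · rw [Complex.im_ofReal_mul]
        simpa [-Complex.ofReal_sin, -Complex.ofReal_cos] using mul_nonneg hs.le h2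
    have hcos : 0 ≤ Real.cos (φ - ψ) := by
      rw [abs_lt] at hd'
      exact Real.cos_nonneg_of_mem_Icc ⟨hd'.1.le, hd'.2.le⟩
    have hne0 : Real.sin (φ - ψ) ≠ 0 := by
      rw [← abs_pos, hsin']; exact hsin
    -- The modulus of `slope * z` is `2πs / η`, so `s ≤ K η` is the required radius. The ratio of
    -- modulus to `|Re|` is `1 / sin |φ - ψ|`, independent of `s`.
    have h1 := h _ hq hP (by rw [hre]; positivity) (by rw [him]; positivity) (by
      rw [norm_slope_mul_polar hη hs, div_mul_eq_mul_div, div_le_iff₀ hη, mul_assoc (2 * Real.pi)]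
      gcongr)
    refine h1.trans ?_
    have hq0 : 0 < 2 * Real.pi / η * s := by positivity
    rw [norm_slope_mul_polar hη hs, hre, abs_mul, abs_of_pos hq0, hsin', ← div_div,
      div_self hq0.ne', mul_comm 4 C, mul_assoc]
    exact mul_le_mul_of_nonneg_left (log_one_add_inv_sin_le hd hd') hC0
  rcases abs_choice χ with hc | hc
  · rwa [hc] at key ⊢
  · have hconj : (s : ℂ) * Complex.exp (Complex.I * χ) =
        (starRingEnd ℂ) (s * Complex.exp (Complex.I * (|χ| : ℝ))) := by
      rw [map_mul, Complex.conj_ofReal, ← Complex.exp_conj, hc]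
      simp
    have hg : (groundFrequency η φ : ℂ) + (starRingEnd ℂ) (s * Complex.exp (Complex.I * (|χ| : ℝ))) =
        (starRingEnd ℂ) ((groundFrequency η φ : ℂ) + s * Complex.exp (Complex.I * (|χ| : ℝ))) := by
      rw [map_add, Complex.conj_ofReal]
    rw [hconj, density_conj, hg]
    simp only [polePair_conj]
    rw [← Complex.norm_conj, map_sub, map_sum, Complex.conj_conj]
    simpa only [map_mul, Complex.conj_conj, Complex.conj_ofReal] using key

end ChargedOscillator

open ChargedOscillator in
theorem theorem3p6 (η φ : ℝ) (hη : 0 < η) (hφ : 0 < φ) (hφ' : φ < Real.pi / 2) :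
    -- on the real line the pole pairs are Lorentz profiles of total mass one
    (∀ j : ℕ, 1 ≤ j →
      (∀ ω : ℝ, polePair η φ j ω =
        ((1 / Real.pi * (j * η * Real.sin φ /
          ((ω - groundFrequency η φ - j * η * Real.cos φ) ^ 2 +
            (j * η * Real.sin φ) ^ 2)) : ℝ) : ℂ)) ∧
      Integrable (fun ω : ℝ => polePair η φ j ω) ∧
      ∫ ω : ℝ, polePair η φ j ω = 1) ∧
    -- the analytically continued effective density of states exists
    (∃ Φ : ℂ → ℂ, IsContinuedDensity η φ Φ) ∧
    -- and it has the following structure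
    ∀ Φ : ℂ → ℂ, IsContinuedDensity η φ Φ → ∀ N : ℕ,
      ∃ h h' : ℂ → ℂ, AnalyticUpToCuts η φ h ∧ AnalyticUpToCuts η φ h' ∧
        ∃ C : ℝ, ∀ s χ : ℝ, 0 < s → s < N * η → |χ| < Real.pi / 2 →
          ∀ z : ℂ, z = groundFrequency η φ + s * Complex.exp (Complex.I * χ) →
            (|χ| < φ →
              Φ z = (∑ j ∈ Finset.Icc 1 N, (Nat.choose (j + 2) 2 : ℂ) * polePair η φ j z) + h z ∧
              ‖h z‖ ≤ C * (1 + |Real.log (φ - |χ|)|)) ∧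
            (φ < |χ| →
              Φ z = -(∑ j ∈ Finset.Icc 1 3,
                (-1 : ℂ) ^ j * (Nat.choose 3 j : ℂ) * polePair η φ j z) + h' z ∧
              ‖h' z‖ ≤ C * (1 + |Real.log (|χ| - φ)|)) := by
  refine ⟨fun j hj => ⟨polePair_ofReal hη hφ hφ' hj, ?_, ?_⟩,
    ⟨_, isContinuedDensity_density hη hφ hφ'⟩, fun Φ hΦ N => ?_⟩
  · have hb : 0 < j * η * Real.sin φ := by
      have := Real.sin_pos_of_pos_of_lt_pi hφ (by linarith [Real.pi_pos])
      have : (0 : ℝ) < j := by exact_mod_cast hj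
      positivity
    simp_rw [polePair_ofReal hη hφ hφ' hj, sub_sub]
    exact (integral_lorentz _ hb).1.ofReal
  · have hb : 0 < j * η * Real.sin φ := by
      have := Real.sin_pos_of_pos_of_lt_pi hφ (by linarith [Real.pi_pos])
      have : (0 : ℝ) < j := by exact_mod_cast hj
      positivity
    simp_rw [polePair_ofReal hη hφ hφ' hj, sub_sub]
    rw [integral_complex_ofReal, (integral_lorentz _ hb).2, Complex.ofReal_one]
  · set Q : ℂ → ℂ := fun z => ∑ j ∈ Finset.Icc 1 N,
      (Nat.choose (j + 2) 2 : ℂ) * polePair η φ j z with hQ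
    set Q' : ℂ → ℂ := fun z => -(∑ j ∈ Finset.Icc 1 3,
      (-1 : ℂ) ^ j * (Nat.choose 3 j : ℂ) * polePair η φ j z) with hQ'
    have hQa (z : ℂ) (hz : z ∉ singularPoints η φ) : AnalyticAt ℂ Q z :=
      Finset.analyticAt_fun_sum _ fun j hj =>
        analyticAt_const.mul (analyticAt_polePair (Finset.mem_Icc.1 hj).1 hz)
    have hQa' (z : ℂ) (hz : z ∉ singularPoints η φ) : AnalyticAt ℂ Q' z :=
      (Finset.analyticAt_fun_sum _ fun j hj =>
        analyticAt_const.mul (analyticAt_polePair (Finset.mem_Icc.1 hj).1 hz)).neg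
    refine ⟨fun z => Φ z - Q z, fun z => Φ z - Q' z, analyticUpToCuts_sub hΦ hη hφ hφ' hQa,
      analyticUpToCuts_sub hΦ hη hφ hφ' hQa', ?_⟩
    obtain ⟨C₁, hC₁0, hC₁⟩ := exists_norm_borel_sub_le isReflectionCoeff_three N
    obtain ⟨C₂, hC₂0, hC₂⟩ := exists_norm_density_sub_polePair_le hη hφ hφ'
      (P := fun x => 0 < x.re) hC₁0 fun x hx him hK => hC₁ x hx him hK
    -- The order is `max N 3`: at least `N` to cover the radius, and at least `3` so that all three
    -- pole pairs appear even for small `N`.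
    obtain ⟨C₃, hC₃0, hC₃⟩ := exists_norm_borel_add_le (κ := 3) isReflectionCoeff_neg_three (max N 3)
    obtain ⟨C₄, hC₄0, hC₄⟩ := exists_norm_density_sub_polePair_le hη hφ hφ' (K := max N 3)
      -- The sign is the one in `borel (-κ) x = -borel κ (-x)`, which turned the difference into a
      -- sum in `exists_norm_borel_add_le`.
      (b := fun j => -((-1 : ℝ) ^ j * (Nat.choose 3 j : ℝ)))
      (P := fun x => x.re < 0) hC₃0 fun x hx him hK => by
        simpa only [Complex.ofReal_neg, neg_mul, Finset.sum_neg_distrib, sub_neg_eq_add] using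
          hC₃ x hx him hK
    have hpi := Real.pi_pos
    refine ⟨4 * C₂ + 4 * C₄, fun s χ hs hsN hχ z hz => ⟨fun hlt => ⟨by simp [Q], ?_⟩,
      fun hlt => ⟨by simp [Q'], ?_⟩⟩⟩
    all_goals have hχ0 := abs_nonneg χ
    · have hP : 0 < (slope η φ * (s * Complex.exp (Complex.I * |χ|))).re := by
        rw [re_slope_mul_polar]
        have := Real.sin_pos_of_pos_of_lt_pi (sub_pos.2 hlt) (by linarith)
        positivity
      have h1 := norm_density_sub_polar_le (P := fun x => 0 < x.re) hη hφ hφ' hC₂0 hC₂ hs hsN.le hχ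
        hlt.ne' hP
      rw [abs_of_pos (sub_pos.2 hlt), ← continuedDensity_eq_density hΦ hη hφ hφ'
        (polar_mem_doubleSlit hη hφ hφ' hs hχ hlt.ne'), ← hz] at h1
      have h2 : ‖Φ z - Q z‖ ≤ 4 * C₂ * (1 + |Real.log (φ - |χ|)|) := by
        simpa only [hQ, Complex.ofReal_natCast] using h1
      refine h2.trans (mul_le_mul_of_nonneg_right ?_ (by positivity))
      linarith
    · have hP : (slope η φ * (s * Complex.exp (Complex.I * |χ|))).re < 0 := by
        rw [re_slope_mul_polar]
        have := Real.sin_neg_of_neg_of_neg_pi_lt (sub_neg.2 hlt) (by linarith)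
        exact mul_neg_of_pos_of_neg (by positivity) this
      have hsK : s ≤ (max N 3 : ℕ) * η := hsN.le.trans (by gcongr; exact le_max_left N 3)
      have h1 := norm_density_sub_polar_le (P := fun x => x.re < 0) hη hφ hφ' hC₄0 hC₄ hs hsK hχ
        hlt.ne hP
      rw [abs_of_neg (sub_neg.2 hlt), neg_sub, ← continuedDensity_eq_density hΦ hη hφ hφ'
        (polar_mem_doubleSlit hη hφ hφ' hs hχ hlt.ne), ← hz] at h1
      have hsum : ∑ j ∈ Finset.Icc 1 (max N 3), ((-((-1 : ℝ) ^ j * (Nat.choose 3 j : ℝ)) : ℝ) : ℂ) *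
          polePair η φ j z = Q' z := by
        simp only [hQ']
        rw [← Finset.sum_neg_distrib]
        -- The terms with `j > 3` vanish with their binomial coefficients.
        refine (Finset.sum_subset (Finset.Icc_subset_Icc_right (le_max_right N 3))
          fun j hj hj' => ?_).symm.trans (Finset.sum_congr rfl fun j _ => ?_)
        · simp only [Finset.mem_Icc] at hj hj'
          rw [Nat.choose_eq_zero_of_lt (by omega)]
          simp
        · push_cast
          ring
      rw [hsum] at h1
      refine h1.trans (mul_le_mul_of_nonneg_right ?_ (by positivity))
      linarith
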